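/- **Setting.** All index sets $\mathcal K$, $\mathcal I_k\neq\emptyset$, $\mathcal L_k$ ($k\in\mathcal K$), $\mathcal J$ are finite. A *proper cone* is a closed convex cone $C\subseteq\mathbb R^{n}$, $n\ge 1$, with nonempty interior that contains no line; $C^*$ is its dual cone, $\mathbf y\preceq_C\mathbf y'$ means $\mathbf y'-\mathbf y\in C$ and $\mathbf y\prec_C\mathbf y'$ means $\mathbf y'-\mathbf y\in\operatorname{int}C$. To $\mathbb R^n$ one adds a largest and a smallest element $\pm\infty_C$, with $\boldsymbol\lambda^\top(\pm\infty_C)=\pm\infty$ for every $\boldsymbol\lambda\in C^*$ (also for $\boldsymbol\lambda=\mathbf 0$, so $\mathbf 0^\top f$ is the indicator function of $\operatorname{dom}f$). Let $f:\mathbb R^d\to\mathbb R^n\cup\{\pm\infty_C\}$ and $\operatorname{dom} f=\{\mathbf x: f(\mathbf x)\prec_C+\infty_C\}$. Then $f$ is *proper* if it never equals $-\infty_C$ and $\operatorname{dom} f\ne\emptyset$; it is *$C$-convex* if $\operatorname{dom}f$ is convex and $f(\theta \mathbf x+(1-\theta)\mathbf x')\preceq_C\theta f(\mathbf x)+(1-\theta)f(\mathbf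 x')$ for $\mathbf x,\mathbf x'\in\operatorname{dom}f$, $\theta\in[0,1]$; it is *star $C$-lower semicontinuous* if $\boldsymbol\lambda^\top f$ is lower semicontinuous for every $\boldsymbol\lambda\in C^*\setminus\{\mathbf 0\}$. For such $f$ (all three), the perspective $t f(\mathbf v/t)$ has its literal meaning if $t>0$; for $t=0$ it is the vector $\mathbf y\in\mathbb R^n$ with $\boldsymbol\lambda^\top\mathbf y=\delta^*_{\operatorname{dom}((\boldsymbol\lambda^\top f)^*)}(\mathbf v)$ for all $\boldsymbol\lambda\in C^*\setminus\{\mathbf 0\}$ if there is one, and $+\infty_C$ otherwise. Here $f^*$ denotes the conjugate and $\delta^*_X$ the support function of $X$. If $-g$ is proper, closed and convex, then $0\,g(\mathbf v/0)=-\delta^*_{\operatorname{dom}((-g)^*)}(\mathbf v)$. **Data.** Let $p_k>0$ with $\sum_k p_k=1$; let $H_j\subseteq\mathbb R^{d_{H_j}}$ and $C_{\ell k}\subseteq\mathbb R^{d_{C_{\ell k}}}$ be proper cones and $\boldsymbol\mu_j\in\mathbb R^{d_{H_j}}$. Let $\mathbf c_{\ell k}$ be proper, star $C_{\ell k}$-lower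 semicontinuous and $C_{\ell k}$-convex on $\mathbb R^d$, let $\mathbf h_{jk}$ be proper, star $H_j$-lower semicontinuous and $H_j$-convex on $\mathbb R^d$, and let $g_{ik}:\mathbb R^d\to\overline{\mathbb R}$ be such that $-g_{ik}$ is proper, closed and convex. Let $S_k=\{\mathbf z:\mathbf c_{\ell k}(\mathbf z)\preceq_{C_{\ell k}}\mathbf 0\ \forall \ell\in\mathcal L_k\}$ be mutually disjoint, and let $g$, $\mathbf h_j$ satisfy $g=\max_{i\in\mathcal I_k}g_{ik}$ and $\mathbf h_j=\mathbf h_{jk}$ on $S_k$. Assume that $\bar S_{ik}=S_k\cap\bigcap_j\operatorname{dom}(\mathbf h_{jk})\cap\operatorname{dom}(-g_{ik})$ is nonempty for all $i\in\mathcal I_k$, $k\in\mathcal K$, and put $\bar S_k=\bigcup_{i\in\mathcal I_k}\bar S_{ik}$. **Problems.** (For a maximization (minimization) problem, points with objective value $-\infty$ ($+\infty$) are infeasible; a feasible problem is solved by a feasible point that attains its optimal value, and an infeasible problem is solved by any point; infeasible problems have optimal value $-\infty$ or $+\infty$, respectively.) * (P-UQ$_g$): maximize $\mathbb E_{\mathbb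 P}[g]$ over all probability measures $\mathbb P$ on $\mathbb R^d$ supported on $\bigcup_kS_k$ with $\mathbb P[S_k]=p_k$ for all $k$ and $\mathbb E_{\mathbb P}[\mathbf h_j]\preceq_{H_j}\boldsymbol\mu_j$ for all $j$; the last condition means $\mathbb E_{\mathbb P}[\boldsymbol\lambda^\top\mathbf h_j]\le\boldsymbol\lambda^\top\boldsymbol\mu_j$ for all $\boldsymbol\lambda\in H_j^*\setminus\{\mathbf 0\}$. If positive and negative part both have infinite expectation, then $\mathbb E_{\mathbb P}[g]=-\infty$ and $\mathbb E_{\mathbb P}[\boldsymbol\lambda^\top\mathbf h_j]=+\infty$. * (D-UQ$_g$): minimize $\sum_kp_k\alpha_k+\sum_j\boldsymbol\mu_j^\top\boldsymbol\beta_j$ over $\alpha_k\in\mathbb R$, $\boldsymbol\beta_j\in H_j^*$ with $\sup_{\mathbf z\in\bar S_k}\{g(\mathbf z)-\alpha_k-\sum_j\boldsymbol\beta_j^\top\mathbf h_{jk}(\mathbf z)\}\le0$ for all $k$. * (FR$_g$): maximize $\sum_k\sum_{i\in\mathcal I_k}\lambda_{ik}g(\mathbf z_{ik})$ over $\lambda_{ik}\ge0$,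 $\mathbf z_{ik}\in\bar S_k$ with $\sum_{i\in\mathcal I_k}\lambda_{ik}=p_k$ for all $k$ and $\sum_{k}\sum_{i\in\mathcal I_k}\lambda_{ik}\mathbf h_j(\mathbf z_{ik})\preceq_{H_j}\boldsymbol\mu_j$ for all $j$. * (AP-W$'_g$): minimize $\sum_kp_k\alpha_k+\sum_j\boldsymbol\mu_j^\top\boldsymbol\beta_j$ over $\alpha_k\in\mathbb R$, $\boldsymbol\beta_j\in H_j^*$, $\boldsymbol\nu_{i\ell k}\in C_{\ell k}^*$ and free $\mathbf y^{(0)}_{ik},\mathbf y^{(1)}_{ijk},\mathbf y^{(2)}_{i\ell k}\in\mathbb R^d$ such that for all $i\in\mathcal I_k$, $k\in\mathcal K$: $(-g_{ik})^*(\mathbf y^{(0)}_{ik})+\sum_j(\boldsymbol\beta_j^\top\mathbf h_{jk})^*(\mathbf y^{(1)}_{ijk})+\sum_{\ell\in\mathcal L_k}(\boldsymbol\nu_{i\ell k}^\top\mathbf c_{\ell k})^*(\mathbf y^{(2)}_{i\ell k})\le\alpha_k$ and $\mathbf y^{(0)}_{ik}+\sum_j\mathbf y^{(1)}_{ijk}+\sum_{\ell\in\mathcal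 L_k}\mathbf y^{(2)}_{i\ell k}=\mathbf 0$. * (AD-B$'_g$): maximize $\sum_k\sum_{i\in\mathcal I_k}\tau_{ik}$ over $\lambda_{ik}\ge0$ and free $\tau_{ik}\in\mathbb R$, $\boldsymbol\omega_{ijk}\in\mathbb R^{d_{H_j}}$, $\mathbf v_{ik}\in\mathbb R^d$ such that $\sum_{i\in\mathcal I_k}\lambda_{ik}=p_k$, $\sum_{k}\sum_{i\in\mathcal I_k}\boldsymbol\omega_{ijk}\preceq_{H_j}\boldsymbol\mu_j$, $\lambda_{ik}\mathbf c_{\ell k}(\mathbf v_{ik}/\lambda_{ik})\preceq_{C_{\ell k}}\mathbf 0$, $\lambda_{ik}\mathbf h_{jk}(\mathbf v_{ik}/\lambda_{ik})\preceq_{H_j}\boldsymbol\omega_{ijk}$ and $\lambda_{ik}g_{ik}(\mathbf v_{ik}/\lambda_{ik})\ge\tau_{ik}$ for all indices $i\in\mathcal I_k$, $j\in\mathcal J$, $\ell\in\mathcal L_k$, $k\in\mathcal K$. A *Slater point* of (AP-W$'_g$) or (AD-B$'_g$) is a feasible point that lies in the relative interior of the domain of every constraint function and at which every conic or scalar inequality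 constraint, written as $F(\mathbf x)\preceq_C\mathbf 0$, holds strictly ($F(\mathbf x)\prec_C\mathbf 0$), except possibly those with $F$ affine (on the arguments where the expression is defined: perspectives for $\lambda_{ik}\ge0$, conjugates for $\boldsymbol\beta_j\in H_j^*$, $\boldsymbol\nu_{i\ell k}\in C_{\ell k}^*$) and $C$ the non-negative orthant. **Theorem.** (i) If (AD-B$'_g$) admits a Slater point with $\lambda_{ik}>0$ for all $i\in\mathcal I_k$, $k\in\mathcal K$, then (AP-W$'_g$), (D-UQ$_g$), (P-UQ$_g$), (FR$_g$) and (AD-B$'_g$) all have the same optimal value (in $\overline{\mathbb R}$), and (AP-W$'_g$) is solvable. Moreover, the components $(\boldsymbol\alpha^\star,\{\boldsymbol\beta^\star_j\}_j)$ of any solution of (AP-W$'_g$) solve (D-UQ$_g$). (ii) If (AP-W$'_g$) admits a Slater point and every $S_k$ is bounded, then (AP-W$'_g$), (D-UQ$_g$), (P-UQ$_g$), (FR$_g$) and (AD-B$'_g$) all have the same optimal value, and (AD-B$'_g$) is solvable. Moreover, if $(\boldsymbol\tau^\star,\boldsymbol\lambda^\star,\boldsymbol\omega^\star,\mathbf v^\star)$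 solves (AD-B$'_g$), then the discrete distribution that assigns probability $\lambda^\star_{ik}$ to the point $\mathbf v^\star_{ik}/\lambda^\star_{ik}$ for all $i,k$ with $\lambda^\star_{ik}>0$ solves (P-UQ$_g$). -/

import Mathlib

open MeasureTheory Set

noncomputable section

namespace ConicUQ

/-- The Euclidean space `ℝⁿ`. -/
abbrev Vec (n : ℕ) : Type := EuclideanSpace ℝ (Fin n)

/-- `ℝⁿ` with a largest element `+∞_C` (`posInf`) and a smallest element `-∞_C` (`negInf`). -/
inductive ExtVec (n : ℕ) : Type
  | negInf : ExtVec n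
  | fin (y : Vec n) : ExtVec n
  | posInf : ExtVec n

/-! ### Cones and generalized inequalities -/

/-- Proper convex cones. A Mathlib `ProperCone` is a closed convex cone containing `0`;
in addition the cone must be solid and must not contain a line. -/
structure IsProper {n : ℕ} (C : ProperCone ℝ (Vec n)) : Prop where
  solid : (interior (C : Set (Vec n))).Nonempty
  pointed : ∀ y : Vec n, y ∈ C → -y ∈ C → y = 0

/-- The dual cone `{l | ∀ y ∈ C, 0 ≤ lᵀ y}`. -/
abbrev dualCone {n : ℕ} (C : ProperCone ℝ (Vec n)) : ProperCone ℝ (Vec n) :=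
  ProperCone.innerDual (C : Set (Vec n))

/-- The cone is the non-negative orthant. -/
def IsOrthant {n : ℕ} (C : ProperCone ℝ (Vec n)) : Prop :=
  ∀ y : Vec n, y ∈ C ↔ ∀ i, 0 ≤ y i

namespace ExtVec

variable {n : ℕ}

/-- The weak inequality `a ⪯_C b`. -/
def le (C : ProperCone ℝ (Vec n)) : ExtVec n → ExtVec n → Prop
  | negInf, _ => True
  | _, posInf => True
  | fin a, fin b => b - a ∈ C
  | fin _, negInf => False
  | posInf, fin _ => False
  | posInf, negInf => False

/-- The strict inequality `a ≺_C b`. -/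
def lt (C : ProperCone ℝ (Vec n)) : ExtVec n → ExtVec n → Prop
  | negInf, fin _ => True
  | negInf, posInf => True
  | fin _, posInf => True
  | fin a, fin b => b - a ∈ interior (C : Set (Vec n))
  | negInf, negInf => False
  | fin _, negInf => False
  | posInf, _ => False

/-- Addition (`+∞_C` is absorbing; opposite infinities are never added below). -/
def add : ExtVec n → ExtVec n → ExtVec n
  | posInf, _ => posInf
  | _, posInf => posInf
  | fin a, fin b => fin (a + b)
  | negInf, negInf => negInf
  | negInf, fin _ => negInf
  | fin _, negInf => negInf

/-- Multiplication by a scalar `t ≥ 0`, with `0 · (±∞_C) = 0`. -/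
def smul (t : ℝ) : ExtVec n → ExtVec n
  | fin a => fin (t • a)
  | negInf => if t = 0 then fin 0 else negInf
  | posInf => if t = 0 then fin 0 else posInf

/-- The scalarization `lᵀ a` for `l` in the dual cone: `lᵀ (+∞_C) = +∞`, `lᵀ (-∞_C) = -∞`. The
same rule is used for `l = 0`, so that `0ᵀ f` is the indicator function of `dom f` for proper `f`.
-/
def scal (l : Vec n) : ExtVec n → EReal
  | negInf => ⊥
  | fin y => ((inner ℝ l y : ℝ) : EReal)
  | posInf => ⊤

/-- The vector part of a finite element (only applied to finite elements). -/
def toVec : ExtVec n → Vec n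
  | fin y => y
  | negInf => 0
  | posInf => 0

end ExtVec

/-! ### Extended real-valued functions -/

/-- The domain of an extended real-valued function. -/
def domR {X : Type} (f : X → EReal) : Set X := {x | f x < ⊤}

/-- Proper: never `-∞` and not identically `+∞`. -/
def ProperR {X : Type} (f : X → EReal) : Prop := (∀ x, ⊥ < f x) ∧ ∃ x, f x < ⊤

/-- Closed: lower semicontinuous, and either nowhere `-∞` or identically `-∞`. -/
def ClosedR {X : Type} [TopologicalSpace X] (f : X → EReal) : Prop :=
  LowerSemicontinuous f ∧ ((∀ x, ⊥ < f x) ∨ ∀ x, f x = ⊥)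

/-- Convex: the epigraph is convex. -/
def ConvexR {d : ℕ} (f : Vec d → EReal) : Prop :=
  Convex ℝ {q : Vec d × ℝ | f q.1 ≤ (q.2 : EReal)}

/-- The conjugate `f*(w) = sup_x { xᵀ w - f x }`. -/
def conj {d : ℕ} (f : Vec d → EReal) (w : Vec d) : EReal :=
  ⨆ x : Vec d, ((inner ℝ x w : ℝ) : EReal) - f x

/-- The support function `δ*_X(w) = sup_{x ∈ X} xᵀ w`. -/
def supp {d : ℕ} (X : Set (Vec d)) (w : Vec d) : EReal :=
  ⨆ x ∈ X, ((inner ℝ x w : ℝ) : EReal)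

/-- The concave perspective `t g(v / t)` of a function `g` with `-g` proper, closed and convex, with
the closed extension `-δ*_{dom((-g)*)}(v)` at `t = 0`; its value is `-∞` for `t < 0`. -/
def concPersp {d : ℕ} (g : Vec d → EReal) (v : Vec d) (t : ℝ) : EReal :=
  if 0 < t then (t : EReal) * g (t⁻¹ • v)
  else if t = 0 then - supp (domR (conj fun z => - g z)) v
  else ⊥

/-! ### Cone-convex functions -/

/-- The domain of a function valued in `ℝⁿ ∪ {±∞_C}`. -/
def domV {X : Type} {n : ℕ} (f : X → ExtVec n) : Set X := {x | f x ≠ ExtVec.posInf}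

/-- Proper: `f x ≻ -∞_C` everywhere and `f x ≺ +∞_C` somewhere. -/
def ProperV {X : Type} {n : ℕ} (f : X → ExtVec n) : Prop :=
  (∀ x, f x ≠ ExtVec.negInf) ∧ ∃ x, f x ≠ ExtVec.posInf

/-- `C`-convex functions. -/
def ConvexV {d n : ℕ} (C : ProperCone ℝ (Vec n)) (f : Vec d → ExtVec n) : Prop :=
  Convex ℝ (domV f) ∧
    ∀ x ∈ domV f, ∀ x' ∈ domV f, ∀ θ ∈ Icc (0 : ℝ) 1,
      ExtVec.le C (f (θ • x + (1 - θ) • x'))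
        (ExtVec.add (ExtVec.smul θ (f x)) (ExtVec.smul (1 - θ) (f x')))

/-- Star `C`-lower semicontinuous functions. -/
def StarLscV {d n : ℕ} (C : ProperCone ℝ (Vec n)) (f : Vec d → ExtVec n) : Prop :=
  ∀ l ∈ dualCone C, l ≠ 0 → LowerSemicontinuous fun x => ExtVec.scal l (f x)

/-- `y` is the vector all of whose scalarizations `lᵀ y`, `l ∈ C* \ {0}`, are the values at
`(v, 0)` of the convex perspectives of `lᵀ f`. -/
def IsRecessionValue {d n : ℕ} (C : ProperCone ℝ (Vec n)) (f : Vec d → ExtVec n) (v : Vec d)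
    (y : Vec n) : Prop :=
  ∀ l ∈ dualCone C, l ≠ 0 →
    ((inner ℝ l y : ℝ) : EReal) = supp (domR (conj fun x => ExtVec.scal l (f x))) v

open Classical in
/-- The `C`-convex perspective `t f(v / t)`. At `t = 0` it is the vector characterized by
`IsRecessionValue`, and `+∞_C` if there is none; its value is `+∞_C` for `t < 0`. -/
def persp {d n : ℕ} (C : ProperCone ℝ (Vec n)) (f : Vec d → ExtVec n) (v : Vec d) (t : ℝ) :
    ExtVec n :=
  if 0 < t then ExtVec.smul t (f (t⁻¹ • v))
  else if h : t = 0 ∧ ∃ y, IsRecessionValue C f v y then ExtVec.fin h.2.choose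
  else ExtVec.posInf

open Classical in
/-- The function `(l, y) ↦ (lᵀ f)*(y)`, defined for `l ∈ C*` and `+∞` for other `l`. -/
def scalConj {d n : ℕ} (C : ProperCone ℝ (Vec n)) (f : Vec d → ExtVec n) (l : Vec n) (y : Vec d) :
    EReal :=
  if l ∈ dualCone C then conj (fun x => ExtVec.scal l (f x)) y else ⊤

/-! ### Slater conditions for constraints -/

section Slater

variable {X : Type} [AddCommGroup X] [Module ℝ X] [TopologicalSpace X]

/-- `x` meets the Slater requirements for the constraint `f(x) ⪯_C 0` (in addition to
feasibility): `x ∈ ri (dom f)`, and `f(x) ≺_C 0` unless `f` is affine (on the set `D` of arguments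
for which its expression is defined) and `C` is the non-negative orthant. -/
def SlaterV {n : ℕ} (C : ProperCone ℝ (Vec n)) (D : Set X) (f : X → ExtVec n) (x : X) : Prop :=
  x ∈ intrinsicInterior ℝ (domV f) ∧
    (¬ ((∃ A : X →ᵃ[ℝ] Vec n, ∀ x' ∈ D, f x' = ExtVec.fin (A x')) ∧ IsOrthant C) →
      ExtVec.lt C (f x) (ExtVec.fin 0))

/-- The same for a scalar constraint `f(x) ≤ 0`. -/
def SlaterR (D : Set X) (f : X → EReal) (x : X) : Prop :=
  x ∈ intrinsicInterior ℝ (domR f) ∧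
    (¬ (∃ A : X →ᵃ[ℝ] ℝ, ∀ x' ∈ D, f x' = ((A x' : ℝ) : EReal)) → f x < 0)

end Slater

/-! ### Optimization problems, given by a feasible region and an objective function -/

/-- The optimal value of a minimization problem. -/
def infVal {X : Type} (F : Set X) (obj : X → EReal) : EReal := ⨅ x ∈ F, obj x

/-- The optimal value of a maximization problem. -/
def supVal {X : Type} (F : Set X) (obj : X → EReal) : EReal := ⨆ x ∈ F, obj x

/-- `x` solves the minimization problem: it is feasible and attains the optimal value; an
infeasible problem is solved by any `x`. -/
def SolvesMin {X : Type} (F : Set X) (obj : X → EReal) (x : X) : Prop :=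
  F.Nonempty → x ∈ F ∧ obj x = infVal F obj

/-- `x` solves the maximization problem. -/
def SolvesMax {X : Type} (F : Set X) (obj : X → EReal) (x : X) : Prop :=
  F.Nonempty → x ∈ F ∧ obj x = supVal F obj

/-! ### Expectations of extended real-valued functions -/

open Classical in
/-- The expectation of `f`, set to `-∞` if its positive and negative parts both have infinite
expectation. -/
def expLow {Ω : Type} [MeasurableSpace Ω] (P : Measure Ω) (f : Ω → EReal) : EReal :=
  if (∫⁻ z, (f z).toENNReal ∂P) = ⊤ ∧ (∫⁻ z, (- f z).toENNReal ∂P) = ⊤ then ⊥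
  else ((∫⁻ z, (f z).toENNReal ∂P : ENNReal) : EReal)
    - ((∫⁻ z, (- f z).toENNReal ∂P : ENNReal) : EReal)

open Classical in
/-- The expectation of `f`, set to `+∞` if its positive and negative parts both have infinite
expectation. -/
def expUp {Ω : Type} [MeasurableSpace Ω] (P : Measure Ω) (f : Ω → EReal) : EReal :=
  if (∫⁻ z, (f z).toENNReal ∂P) = ⊤ ∧ (∫⁻ z, (- f z).toENNReal ∂P) = ⊤ then ⊤
  else ((∫⁻ z, (f z).toENNReal ∂P : ENNReal) : EReal)
    - ((∫⁻ z, (- f z).toENNReal ∂P : ENNReal) : EReal)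

/-! ### The data of the uncertainty quantification problem -/

/-- The data of the problem: dimensions, finite index sets `𝒦`, `ℐ_k`, `ℒ_k`, `𝒥`, probabilities
`p_k`, cones `H_j` and `C_{ℓk}`, moment bounds `μ_j`, constraint functions `c_{ℓk}`, disutility
function `g` with components `g_{ik}`, and moment functions `h_j` with components `h_{jk}`. -/
structure Data where
  d : ℕ
  nK : ℕ
  nI : Fin nK → ℕ
  nL : Fin nK → ℕ
  nJ : ℕ
  dH : Fin nJ → ℕ
  dC : (k : Fin nK) → Fin (nL k) → ℕ
  p : Fin nK → ℝ
  H : (j : Fin nJ) → ProperCone ℝ (Vec (dH j))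
  C : (k : Fin nK) → (l : Fin (nL k)) → ProperCone ℝ (Vec (dC k l))
  mu : (j : Fin nJ) → Vec (dH j)
  c : (k : Fin nK) → (l : Fin (nL k)) → Vec d → ExtVec (dC k l)
  g : Vec d → EReal
  gc : (k : Fin nK) → Fin (nI k) → Vec d → EReal
  h : (j : Fin nJ) → Vec d → ExtVec (dH j)
  hc : (j : Fin nJ) → Fin nK → Vec d → ExtVec (dH j)

namespace Data

variable (D : Data)

/-- The component `S_k` of the support set. -/
def S (k : Fin D.nK) : Set (Vec D.d) :=
  {z | ∀ l, ExtVec.le (D.C k l) (D.c k l z) (ExtVec.fin 0)}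

/-- The effective support set of the component `g_{ik}` on `S_k`. -/
def Sbar (k : Fin D.nK) (i : Fin (D.nI k)) : Set (Vec D.d) :=
  {z | z ∈ D.S k ∧ (∀ j, z ∈ domV (D.hc j k)) ∧ z ∈ domR (fun z => - D.gc k i z)}

/-- The effective support set of the component `k`: the union of the previous sets over `i`. -/
def SbarU (k : Fin D.nK) : Set (Vec D.d) := ⋃ i, D.Sbar k i

/-- The standing assumptions on the data. -/
structure Standing : Prop where
  p_pos : ∀ k, 0 < D.p k
  p_sum : ∑ k, D.p k = 1
  nI_pos : ∀ k, 0 < D.nI k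
  dH_pos : ∀ j, 0 < D.dH j
  dC_pos : ∀ k l, 0 < D.dC k l
  H_proper : ∀ j, IsProper (D.H j)
  C_proper : ∀ k l, IsProper (D.C k l)
  c_reg : ∀ k l, ProperV (D.c k l) ∧ StarLscV (D.C k l) (D.c k l) ∧ ConvexV (D.C k l) (D.c k l)
  gc_reg : ∀ k i, ProperR (fun z => - D.gc k i z) ∧ ClosedR (fun z => - D.gc k i z) ∧
    ConvexR (fun z => - D.gc k i z)
  hc_reg : ∀ j k, ProperV (D.hc j k) ∧ StarLscV (D.H j) (D.hc j k) ∧ ConvexV (D.H j) (D.hc j k)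
  S_disjoint : ∀ k k', k ≠ k' → Disjoint (D.S k) (D.S k')
  g_eq : ∀ k, ∀ z ∈ D.S k, D.g z = ⨆ i, D.gc k i z
  h_eq : ∀ j k, ∀ z ∈ D.S k, D.h j z = D.hc j k z
  Sbar_nonempty : ∀ k i, (D.Sbar k i).Nonempty

/-! ### The primal uncertainty quantification problem -/

/-- The ambiguity set. The moment condition `E[h_j] ⪯_{H_j} μ_j` is read as
`E[lᵀ h_j] ≤ lᵀ μ_j` for all nonzero `l` in the dual cone. -/
def Ambiguity : Set (Measure (Vec D.d)) :=
  {P | IsProbabilityMeasure P ∧ P (⋃ k, D.S k)ᶜ = 0 ∧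
    (∀ k, P (D.S k) = ENNReal.ofReal (D.p k)) ∧
    ∀ j, ∀ l ∈ dualCone (D.H j), l ≠ 0 →
      expUp P (fun z => ExtVec.scal l (D.h j z)) ≤ ((inner ℝ l (D.mu j) : ℝ) : EReal)}

def puqObj (P : Measure (Vec D.d)) : EReal := expLow P D.g

def puqFeas : Set (Measure (Vec D.d)) := {P | P ∈ D.Ambiguity ∧ D.puqObj P ≠ ⊥}

/-! ### The dual uncertainty quantification problem, with variables `(α, β)` -/

abbrev DuqVar : Type := (Fin D.nK → ℝ) × ((j : Fin D.nJ) → Vec (D.dH j))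

def duqObj (x : D.DuqVar) : EReal :=
  ((∑ k, D.p k * x.1 k + ∑ j, inner ℝ (D.mu j) (x.2 j) : ℝ) : EReal)

def duqFeas : Set D.DuqVar :=
  {x | (∀ k, (⨆ z ∈ D.SbarU k,
        D.g z - ((x.1 k : ℝ) : EReal) - ∑ j, ExtVec.scal (x.2 j) (D.hc j k z)) ≤ 0) ∧
    ∀ j, x.2 j ∈ dualCone (D.H j)}

/-! ### The finite reduction, with variables `(λ, z)` -/

abbrev FrVar : Type :=
  ((k : Fin D.nK) → Fin (D.nI k) → ℝ) × ((k : Fin D.nK) → Fin (D.nI k) → Vec D.d)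

def frObj (x : D.FrVar) : EReal := ∑ k, ∑ i, ((x.1 k i : ℝ) : EReal) * D.g (x.2 k i)

def frFeas : Set D.FrVar :=
  {x | (∀ k, ∑ i, x.1 k i = D.p k) ∧
    (∀ j, D.mu j - ∑ k, ∑ i, x.1 k i • ExtVec.toVec (D.h j (x.2 k i)) ∈ D.H j) ∧
    (∀ k i, x.2 k i ∈ D.SbarU k) ∧
    ∀ k i, 0 ≤ x.1 k i}

/-! ### The reformulated ambiguous primal worst problem -/

/-- The variables `(α, β, y⁽⁰⁾, y⁽¹⁾, y⁽²⁾, ν)`. -/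
abbrev ApwVar : Type :=
  (Fin D.nK → ℝ) ×
  ((j : Fin D.nJ) → Vec (D.dH j)) ×
  ((k : Fin D.nK) → Fin (D.nI k) → Vec D.d) ×
  ((k : Fin D.nK) → Fin (D.nI k) → Fin D.nJ → Vec D.d) ×
  ((k : Fin D.nK) → Fin (D.nI k) → Fin (D.nL k) → Vec D.d) ×
  ((k : Fin D.nK) → Fin (D.nI k) → (l : Fin (D.nL k)) → Vec (D.dC k l))

variable {D}

def ApwVar.alpha (x : D.ApwVar) : Fin D.nK → ℝ := x.1
def ApwVar.beta (x : D.ApwVar) : (j : Fin D.nJ) → Vec (D.dH j) := x.2.1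
def ApwVar.y0 (x : D.ApwVar) : (k : Fin D.nK) → Fin (D.nI k) → Vec D.d := x.2.2.1
def ApwVar.y1 (x : D.ApwVar) : (k : Fin D.nK) → Fin (D.nI k) → Fin D.nJ → Vec D.d := x.2.2.2.1
def ApwVar.y2 (x : D.ApwVar) : (k : Fin D.nK) → Fin (D.nI k) → Fin (D.nL k) → Vec D.d :=
  x.2.2.2.2.1
def ApwVar.nu (x : D.ApwVar) :
    (k : Fin D.nK) → Fin (D.nI k) → (l : Fin (D.nL k)) → Vec (D.dC k l) := x.2.2.2.2.2

variable (D)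

def apwObj (x : D.ApwVar) : EReal :=
  ((∑ k, D.p k * x.alpha k + ∑ j, inner ℝ (D.mu j) (x.beta j) : ℝ) : EReal)

/-- The sum of conjugates on the left-hand side of the constraint with indices `i`, `k`. -/
def apwLhs (k : Fin D.nK) (i : Fin (D.nI k)) (x : D.ApwVar) : EReal :=
  conj (fun z => - D.gc k i z) (x.y0 k i)
    + ∑ j, scalConj (D.H j) (D.hc j k) (x.beta j) (x.y1 k i j)
    + ∑ l, scalConj (D.C k l) (D.c k l) (x.nu k i l) (x.y2 k i l)

def apwFeas : Set D.ApwVar :=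
  {x | (∀ k i, D.apwLhs k i x ≤ ((x.alpha k : ℝ) : EReal)) ∧
    (∀ k i, x.y0 k i + ∑ j, x.y1 k i j + ∑ l, x.y2 k i l = 0) ∧
    (∀ j, x.beta j ∈ dualCone (D.H j)) ∧
    ∀ k i l, x.nu k i l ∈ dualCone (D.C k l)}

/-- Slater points of the problem. The linear equations only have to be satisfied. -/
def ApwSlater (x : D.ApwVar) : Prop :=
  x ∈ D.apwFeas ∧
    (∀ k i, SlaterR {x' | (∀ j, x'.beta j ∈ dualCone (D.H j)) ∧
        ∀ l, x'.nu k i l ∈ dualCone (D.C k l)}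
      (fun x' : D.ApwVar => D.apwLhs k i x' - ((x'.alpha k : ℝ) : EReal)) x) ∧
    (∀ j, SlaterV (dualCone (D.H j)) univ
      (fun x' : D.ApwVar => ExtVec.fin (- x'.beta j)) x) ∧
    ∀ k i l, SlaterV (dualCone (D.C k l)) univ
      (fun x' : D.ApwVar => ExtVec.fin (- x'.nu k i l)) x

/-! ### The reformulated ambiguous dual best problem -/

/-- The variables `(τ, λ, ω, v)`. -/
abbrev AdbVar : Type :=
  ((k : Fin D.nK) → Fin (D.nI k) → ℝ) ×
  ((k : Fin D.nK) → Fin (D.nI k) → ℝ) ×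
  ((k : Fin D.nK) → Fin (D.nI k) → (j : Fin D.nJ) → Vec (D.dH j)) ×
  ((k : Fin D.nK) → Fin (D.nI k) → Vec D.d)

variable {D}

def AdbVar.tau (x : D.AdbVar) : (k : Fin D.nK) → Fin (D.nI k) → ℝ := x.1
def AdbVar.lam (x : D.AdbVar) : (k : Fin D.nK) → Fin (D.nI k) → ℝ := x.2.1
def AdbVar.omega (x : D.AdbVar) :
    (k : Fin D.nK) → Fin (D.nI k) → (j : Fin D.nJ) → Vec (D.dH j) := x.2.2.1
def AdbVar.v (x : D.AdbVar) : (k : Fin D.nK) → Fin (D.nI k) → Vec D.d := x.2.2.2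

variable (D)

def adbObj (x : D.AdbVar) : EReal := ((∑ k, ∑ i, x.tau k i : ℝ) : EReal)

def adbFeas : Set D.AdbVar :=
  {x | (∀ k, ∑ i, x.lam k i = D.p k) ∧
    (∀ j, ExtVec.le (D.H j) (ExtVec.fin (∑ k, ∑ i, x.omega k i j)) (ExtVec.fin (D.mu j))) ∧
    (∀ k i l, ExtVec.le (D.C k l) (persp (D.C k l) (D.c k l) (x.v k i) (x.lam k i))
      (ExtVec.fin 0)) ∧
    (∀ k i j, ExtVec.le (D.H j) (persp (D.H j) (D.hc j k) (x.v k i) (x.lam k i))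
      (ExtVec.fin (x.omega k i j))) ∧
    (∀ k i, ((x.tau k i : ℝ) : EReal) ≤ concPersp (D.gc k i) (x.v k i) (x.lam k i)) ∧
    ∀ k i, 0 ≤ x.lam k i}

/-- Slater points of the problem. The linear equations and the scalar linear inequalities
`λ_{ik} ≥ 0` only have to be satisfied. -/
def AdbSlater (x : D.AdbVar) : Prop :=
  x ∈ D.adbFeas ∧
    (∀ j, SlaterV (D.H j) univ
      (fun x' : D.AdbVar => ExtVec.fin (∑ k, ∑ i, x'.omega k i j - D.mu j)) x) ∧
    (∀ k i l, SlaterV (D.C k l) {x' | 0 ≤ x'.lam k i}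
      (fun x' : D.AdbVar => persp (D.C k l) (D.c k l) (x'.v k i) (x'.lam k i)) x) ∧
    (∀ k i j, SlaterV (D.H j) {x' | 0 ≤ x'.lam k i}
      (fun x' : D.AdbVar => ExtVec.add (persp (D.H j) (D.hc j k) (x'.v k i) (x'.lam k i))
        (ExtVec.fin (- x'.omega k i j))) x) ∧
    ∀ k i, SlaterR {x' | 0 ≤ x'.lam k i}
      (fun x' : D.AdbVar =>
        ((x'.tau k i : ℝ) : EReal) - concPersp (D.gc k i) (x'.v k i) (x'.lam k i)) x

open Classical in
/-- The discrete distribution that assigns probability `λ_{ik}` to the point `v_{ik} / λ_{ik}` for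
all `i`, `k` with `λ_{ik} > 0`. -/
def recovered (x : D.AdbVar) : Measure (Vec D.d) :=
  ∑ k, ∑ i, if 0 < x.lam k i then
    ENNReal.ofReal (x.lam k i) • Measure.dirac ((x.lam k i)⁻¹ • x.v k i) else 0

/-- All five problems have the same optimal value. -/
def SameValue : Prop :=
  infVal D.apwFeas D.apwObj = infVal D.duqFeas D.duqObj ∧
    infVal D.duqFeas D.duqObj = supVal D.puqFeas D.puqObj ∧
    supVal D.puqFeas D.puqObj = supVal D.frFeas D.frObj ∧
    supVal D.frFeas D.frObj = supVal D.adbFeas D.adbObj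

end Data

end ConicUQ

end

noncomputable section
namespace ConicUQ

/-! ### Lagrange multipliers for affine constraints on a convex set -/

section Multipliers

variable {V W : Type*} [AddCommGroup V] [Module ℝ V] [AddCommGroup W] [Module ℝ W]

/-- The algebraic relative interior: every segment in `X` that ends at `x` can be prolonged. -/
def AlgRi (X : Set V) (x : V) : Prop :=
  x ∈ X ∧ ∀ y ∈ X, ∃ ε > (0 : ℝ), x + ε • (x - y) ∈ X

/-- Functions that commute with affine combinations of two points. -/
def IsAff (a : V → W) : Prop :=
  ∀ (x y : V) (s t : ℝ), s + t = 1 → a (s • x + t • y) = s • a x + t • a y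

lemma IsAff.add {a b : V → W} (ha : IsAff a) (hb : IsAff b) : IsAff (fun x => a x + b x) := by
  intro x y s t h
  simp only [ha x y s t h, hb x y s t h, smul_add]
  abel

lemma IsAff.const_mul {a : V → ℝ} (ha : IsAff a) (c : ℝ) : IsAff (fun x => c * a x) := by
  intro x y s t h
  simp only [ha x y s t h, smul_eq_mul]
  ring

lemma IsAff.const (c : W) : IsAff (fun _ : V => c) := by
  intro x y s t h
  rw [← add_smul, h, one_smul]

lemma IsAff.sum {ι : Type*} (s : Finset ι) {a : ι → V → W} (ha : ∀ i, IsAff (a i)) :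
    IsAff (fun x => ∑ i ∈ s, a i x) := by
  intro x y s' t h
  simp only [fun i => ha i x y s' t h, Finset.sum_add_distrib, Finset.smul_sum]

lemma IsAff.neg {a : V → W} (ha : IsAff a) : IsAff (fun x => - a x) := by
  intro x y s t h
  simp only [ha x y s t h, smul_neg, neg_add]

lemma IsAff.sub {a b : V → W} (ha : IsAff a) (hb : IsAff b) : IsAff (fun x => a x - b x) := by
  simpa only [sub_eq_add_neg] using ha.add hb.neg

lemma IsAff.inner_left {n : ℕ} {a : V → Vec n} (ha : IsAff a) (w : Vec n) :
    IsAff (fun x => (inner ℝ w (a x) : ℝ)) := by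
  intro x y s t h
  simp only [ha x y s t h, inner_add_right, inner_smul_right, smul_eq_mul]

lemma IsAff.coord {n : ℕ} {a : V → Vec n} (ha : IsAff a) (i : Fin n) :
    IsAff (fun x => a x i) := by
  intro x y s t h
  simp [ha x y s t h]

lemma IsAff.prolong {a : V → ℝ} (ha : IsAff a) (x y : V) (ε : ℝ) :
    a (x + ε • (x - y)) = a x + ε * (a x - a y) := by
  have : x + ε • (x - y) = (1 + ε) • x + (-ε) • y := by module
  rw [this, ha x y (1 + ε) (-ε) (by ring)]
  simp only [smul_eq_mul]
  ring

lemma IsAff.convex_zero {a : V → ℝ} (ha : IsAff a) {X : Set V} (hX : Convex ℝ X) :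
    Convex ℝ {x | x ∈ X ∧ a x = 0} := by
  intro x hx y hy s t hs ht hst
  refine ⟨hX hx.1 hy.1 hs ht hst, ?_⟩
  simp [ha x y s t hst, hx.2, hy.2]

lemma AlgRi.inter_zero {a : V → ℝ} (ha : IsAff a) {X : Set V} {x : V} (h : AlgRi X x)
    (hx : a x = 0) : AlgRi {x | x ∈ X ∧ a x = 0} x := by
  refine ⟨⟨h.1, hx⟩, fun y hy => ?_⟩
  obtain ⟨ε, hε, h1⟩ := h.2 y hy.1
  refine ⟨ε, hε, h1, ?_⟩
  rw [ha.prolong, hx, hy.2]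
  simp

/-- A positive value at some `y` would become negative on prolonging the segment from `y` beyond
`x`. -/
lemma AlgRi.eq_zero_of_nonneg {a : V → ℝ} (ha : IsAff a) {X : Set V} {x : V} (h : AlgRi X x)
    (hx : a x ≤ 0) (hnn : ∀ y ∈ X, 0 ≤ a y) : ∀ y ∈ X, a y = 0 := by
  intro y hy
  obtain ⟨ε, hε, h1⟩ := h.2 y hy
  have h2 := hnn _ h1
  rw [ha.prolong] at h2
  have h3 := hnn y hy
  have h4 := hnn x h.1
  by_contra h5
  have : 0 < ε * a y := mul_pos hε (lt_of_le_of_ne h3 (Ne.symm h5))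
  nlinarith

/-- Moving from a relative interior point towards a point of a convex set. -/
lemma AlgRi.mix {X : Set V} (hX : Convex ℝ X) {x z : V} (h : AlgRi X x) (hz : z ∈ X) :
    AlgRi X ((2⁻¹ : ℝ) • x + (2⁻¹ : ℝ) • z) := by
  refine ⟨hX h.1 hz (by norm_num) (by norm_num) (by norm_num), fun y hy => ?_⟩
  obtain ⟨ε, hε, h1⟩ := h.2 y hy
  -- With this `δ`, the prolonged midpoint is a convex combination of `z` and the prolongation of
  -- `x`.
  set δ : ℝ := ε / (2 + ε)
  have hpos : 0 < 2 + ε := by linarith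
  have hδ : 0 < δ := by positivity
  refine ⟨δ, hδ, ?_⟩
  have h2 : (2⁻¹ : ℝ) • x + (2⁻¹ : ℝ) • z + δ • ((2⁻¹ : ℝ) • x + (2⁻¹ : ℝ) • z - y)
      = (1 / (2 + ε)) • (x + ε • (x - y)) + ((1 + ε) / (2 + ε)) • z := by
    simp only [δ]
    match_scalars
    · field_simp
      ring
    · field_simp
      ring
    · field_simp
  rw [h2]
  exact hX h1 hz (by positivity) (by positivity) (by field_simp; ring)

/-- The segment from `p` to `n` meets the hyperplane `a = 0`, where `φ` is nonnegative. Every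
multiplier bound from the positive side therefore lies below every bound from the negative side. -/
lemma cross_nonneg {X : Set V} (hX : Convex ℝ X) {φ a : V → ℝ} (hφ : IsAff φ) (ha : IsAff a)
    (h : ∀ x ∈ X, a x = 0 → 0 ≤ φ x) {p n : V} (hp : p ∈ X) (hn : n ∈ X) (hap : 0 < a p)
    (han : a n < 0) : -φ p / a p ≤ φ n / (-a n) := by
  have hd : 0 < a p - a n := by linarith
  have hst : (-a n) / (a p - a n) + a p / (a p - a n) = 1 := by field_simp; ring
  have h1 := h (((-a n) / (a p - a n)) • p + (a p / (a p - a n)) • n)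
    (hX hp hn (div_nonneg (by linarith) hd.le) (by positivity) hst)
    (by rw [ha _ _ _ _ hst]; simp only [smul_eq_mul]; field_simp; ring)
  rw [hφ _ _ _ _ hst] at h1
  simp only [smul_eq_mul] at h1
  have h2 : 0 ≤ (-a n) * φ p + a p * φ n := by
    have : (-a n) / (a p - a n) * φ p + a p / (a p - a n) * φ n
      = ((-a n) * φ p + a p * φ n) / (a p - a n) := by ring
    rw [this] at h1
    by_contra hc
    exact absurd h1 (not_le.2 (div_neg_of_neg_of_pos (not_le.1 hc) hd))
  rw [div_le_div_iff₀ hap (by linarith)]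
  linarith

/-- A multiplier for one affine equation. -/
lemma exists_multiplier_eq {X : Set V} (hX : Convex ℝ X) {φ a : V → ℝ} (hφ : IsAff φ)
    (ha : IsAff a) {x₀ : V} (hx₀ : AlgRi X x₀) (ha₀ : a x₀ = 0)
    (h : ∀ x ∈ X, a x = 0 → 0 ≤ φ x) : ∃ η : ℝ, ∀ x ∈ X, 0 ≤ φ x + η * a x := by
  by_cases hall : ∀ x ∈ X, a x = 0
  · exact ⟨0, fun x hx => by simpa using h x hx (hall x hx)⟩
  -- Relative interiority makes `a` take both signs, so both families of bounds on the multiplier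
  -- are nonempty.
  have hex : (∃ p ∈ X, 0 < a p) ∧ ∃ n ∈ X, a n < 0 := by
    push Not at hall
    obtain ⟨x, hx, hax⟩ := hall
    obtain ⟨ε, hε, h1⟩ := hx₀.2 x hx
    have h2 := ha.prolong x₀ x ε
    rw [ha₀] at h2
    rcases lt_or_gt_of_ne hax with h3 | h3
    · exact ⟨⟨_, h1, by rw [h2]; nlinarith⟩, x, hx, h3⟩
    · exact ⟨⟨x, hx, h3⟩, _, h1, by rw [h2]; nlinarith⟩
  obtain ⟨⟨p, hp, hap⟩, n, hn, han⟩ := hex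
  obtain ⟨η, hη1, hη2⟩ := exists_between_of_forall_le
    (s := {r | ∃ q ∈ X, 0 < a q ∧ r = -φ q / a q})
    (t := {r | ∃ m ∈ X, a m < 0 ∧ r = φ m / (-a m)}) ⟨_, p, hp, hap, rfl⟩ ⟨_, n, hn, han, rfl⟩
    (by
      rintro _ ⟨q, hq, haq, rfl⟩ _ ⟨m, hm, ham, rfl⟩
      exact cross_nonneg hX hφ ha h hq hm haq ham)
  refine ⟨η, fun x hx => ?_⟩
  rcases lt_trichotomy (a x) 0 with h3 | h3 | h3
  · have := hη2 ⟨x, hx, h3, rfl⟩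
    rw [le_div_iff₀ (by linarith)] at this
    linarith
  · simpa [h3] using h x hx h3
  · have := hη1 ⟨x, hx, h3, rfl⟩
    rw [div_le_iff₀ h3] at this
    linarith

/-- A multiplier for one affine inequality with a Slater point. -/
lemma exists_multiplier_lt {X : Set V} (hX : Convex ℝ X) {φ a : V → ℝ} (hφ : IsAff φ)
    (ha : IsAff a) {x₀ : V} (hx₀ : x₀ ∈ X) (ha₀ : a x₀ < 0)
    (h : ∀ x ∈ X, a x ≤ 0 → 0 ≤ φ x) : ∃ η : ℝ, 0 ≤ η ∧ ∀ x ∈ X, 0 ≤ φ x + η * a x := by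
  -- The extra lower bound 0 enforces the sign of the multiplier. No point with `a > 0` is needed,
  -- since the Slater point supplies an upper bound.
  obtain ⟨η, hη1, hη2⟩ := exists_between_of_forall_le
    (s := {r | r = 0 ∨ ∃ q ∈ X, 0 < a q ∧ r = -φ q / a q})
    (t := {r | ∃ m ∈ X, a m < 0 ∧ r = φ m / (-a m)}) ⟨0, Or.inl rfl⟩ ⟨_, x₀, hx₀, ha₀, rfl⟩
    (by
      rintro _ (rfl | ⟨q, hq, haq, rfl⟩) _ ⟨m, hm, ham, rfl⟩
      · exact div_nonneg (h m hm ham.le) (by linarith)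
      · exact cross_nonneg hX hφ ha (fun x hx hax => h x hx hax.le) hq hm haq ham)
  refine ⟨η, hη1 (Or.inl rfl), fun x hx => ?_⟩
  rcases lt_trichotomy (a x) 0 with h3 | h3 | h3
  · have := hη2 ⟨x, hx, h3, rfl⟩
    rw [le_div_iff₀ (by linarith)] at this
    linarith
  · simpa [h3] using h x hx h3.le
  · have := hη1 (Or.inr ⟨x, hx, h3, rfl⟩)
    rw [div_le_iff₀ h3] at this
    linarith

/-- Lagrange multipliers for finitely many affine inequalities (`P i`) and equations (`¬ P i`) on a
convex set, under a relative interior condition. -/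
theorem exists_multipliers {ι : Type*} (P : ι → Prop) {a : ι → V → ℝ} (ha : ∀ i, IsAff (a i))
    (s : Finset ι) : ∀ {X : Set V}, Convex ℝ X → ∀ {φ : V → ℝ}, IsAff φ → ∀ {x₀ : V},
      AlgRi X x₀ → (∀ i ∈ s, a i x₀ ≤ 0 ∧ (¬ P i → a i x₀ = 0)) →
      (∀ x ∈ X, (∀ i ∈ s, a i x ≤ 0 ∧ (¬ P i → a i x = 0)) → 0 ≤ φ x) →
      ∃ ν : ι → ℝ, (∀ i, P i → 0 ≤ ν i) ∧ ∀ x ∈ X, 0 ≤ φ x + ∑ i ∈ s, ν i * a i x := by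
  classical
  induction s using Finset.induction_on with
  | empty =>
    intro X _ φ _ x₀ _ _ h
    exact ⟨0, fun _ _ => le_rfl, fun x hx => by simpa using h x hx (by simp)⟩
  | insert m s hm ih =>
    intro X hX φ hφ x₀ hx₀ hf h
    have upd : ∀ (ν : ι → ℝ) (c : ℝ) (x : V), ∑ i ∈ insert m s, Function.update ν m c i * a i x
        = c * a m x + ∑ i ∈ s, ν i * a i x := by
      intro ν c x
      rw [Finset.sum_insert hm, Function.update_self]
      congr 1
      refine Finset.sum_congr rfl fun i hi => ?_
      rw [Function.update_of_ne (by rintro rfl; exact hm hi)]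
    have updP : ∀ (ν : ι → ℝ) (c : ℝ), (∀ i, P i → 0 ≤ ν i) → (P m → 0 ≤ c) →
        ∀ i, P i → 0 ≤ Function.update ν m c i := by
      intro ν c h1 h2 i hi
      rcases eq_or_ne i m with rfl | hne
      · simpa using h2 hi
      · simpa [Function.update_of_ne hne] using h1 i hi
    have hs : ∀ i ∈ s, a i x₀ ≤ 0 ∧ (¬ P i → a i x₀ = 0) := fun i hi =>
      hf i (Finset.mem_insert_of_mem hi)
    have affsum : ∀ ν : ι → ℝ, IsAff (fun x => ∑ i ∈ s, ν i * a i x) := fun ν =>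
      IsAff.sum s fun i => (ha i).const_mul _
    have eqcase : a m x₀ = 0 → (∀ x ∈ X, a m x = 0 →
        (∀ i ∈ s, a i x ≤ 0 ∧ (¬ P i → a i x = 0)) → 0 ≤ φ x) →
        ∃ ν : ι → ℝ, (∀ i, P i → 0 ≤ ν i) ∧ ∃ η : ℝ, ∀ x ∈ X,
          0 ≤ (φ x + ∑ i ∈ s, ν i * a i x) + η * a m x := by
      intro h0 h1
      obtain ⟨ν, hν, h2⟩ := ih ((ha m).convex_zero hX) hφ (hx₀.inter_zero (ha m) h0) hs
        (fun x hx hxs => h1 x hx.1 hx.2 hxs)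
      obtain ⟨η, hη⟩ := exists_multiplier_eq hX (hφ.add (affsum ν)) (ha m) hx₀ h0
        (fun x hx hx0 => h2 x ⟨hx, hx0⟩)
      exact ⟨ν, hν, η, hη⟩
    by_cases hP : P m
    · by_cases hex : ∃ x ∈ X, (∀ i ∈ s, a i x ≤ 0 ∧ (¬ P i → a i x = 0)) ∧ a m x < 0
      · obtain ⟨z, hz, hzs, hzm⟩ := hex
        -- The midpoint is still in the relative interior and is strict in constraint `m`. This
        -- constraint is dualized first, over the points feasible for `s`, and the induction
        -- hypothesis then handles `s`.
        have hmix := hx₀.mix hX hz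
        set x₁ := (2⁻¹ : ℝ) • x₀ + (2⁻¹ : ℝ) • z
        have hv : ∀ i, a i x₁ = 2⁻¹ * a i x₀ + 2⁻¹ * a i z := fun i => by
          simpa using ha i x₀ z 2⁻¹ 2⁻¹ (by norm_num)
        have hx₁s : ∀ i ∈ s, a i x₁ ≤ 0 ∧ (¬ P i → a i x₁ = 0) := fun i hi => by
          rw [hv]
          refine ⟨by linarith [(hs i hi).1, (hzs i hi).1], fun hPi => ?_⟩
          rw [(hs i hi).2 hPi, (hzs i hi).2 hPi]
          simp
        have hx₁m : a m x₁ < 0 := by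
          rw [hv]
          linarith [(hf m (Finset.mem_insert_self m s)).1]
        have hconv : Convex ℝ {x | x ∈ X ∧ ∀ i ∈ s, a i x ≤ 0 ∧ (¬ P i → a i x = 0)} := by
          intro x hx y hy c d hc hd hcd
          refine ⟨hX hx.1 hy.1 hc hd hcd, fun i hi => ?_⟩
          rw [ha i _ _ _ _ hcd]
          simp only [smul_eq_mul]
          refine ⟨by nlinarith [(hx.2 i hi).1, (hy.2 i hi).1], fun hPi => ?_⟩
          rw [(hx.2 i hi).2 hPi, (hy.2 i hi).2 hPi]
          simp
        obtain ⟨c, hc, h1⟩ := exists_multiplier_lt hconv hφ (ha m) ⟨hmix.1, hx₁s⟩ hx₁m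
          (fun x hx hxm => h x hx.1 fun i hi => by
            rcases Finset.mem_insert.1 hi with rfl | hi
            · exact ⟨hxm, fun hn => absurd hP hn⟩
            · exact hx.2 i hi)
        obtain ⟨ν, hν, h2⟩ := ih hX (hφ.add ((ha m).const_mul c)) hmix hx₁s
          (fun x hx hxs => h1 x ⟨hx, hxs⟩)
        refine ⟨Function.update ν m c, updP ν c hν fun _ => hc, fun x hx => ?_⟩
        rw [upd]
        linarith [h2 x hx]
      · push Not at hex
        -- Constraint `m` can never be strict, so `a m` is itself nonnegative on the points feasible
        -- for `s`. The induction hypothesis with objective `a m` and `eq_zero_of_nonneg` give `a m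
        -- = -∑ ν a` on all of `X`.
        obtain ⟨ν, hν, h1⟩ := ih hX (ha m) hx₀ hs hex
        have hle : ∀ x₁ : V, (∀ i ∈ s, a i x₁ ≤ 0 ∧ (¬ P i → a i x₁ = 0)) →
            ∑ i ∈ s, ν i * a i x₁ ≤ 0 := fun x₁ hx₁ => by
          refine Finset.sum_nonpos fun i hi => ?_
          by_cases hPi : P i
          · exact mul_nonpos_of_nonneg_of_nonpos (hν i hPi) (hx₁ i hi).1
          · simp [(hx₁ i hi).2 hPi]
        have hm0 := (hf m (Finset.mem_insert_self m s)).1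
        have hzero := hx₀.eq_zero_of_nonneg ((ha m).add (affsum ν))
          (by linarith [hle x₀ hs]) h1
        have hm0' : a m x₀ = 0 := le_antisymm hm0 (hex x₀ hx₀.1 hs)
        obtain ⟨ν', hν', η, hη⟩ := eqcase hm0' (fun x hx hxm hxs => h x hx fun i hi => by
            rcases Finset.mem_insert.1 hi with rfl | hi
            · exact ⟨hxm.le, fun _ => hxm⟩
            · exact hxs i hi)
        rcases le_or_gt 0 η with h3 | h3
        · refine ⟨Function.update ν' m η, updP ν' η hν' fun _ => h3, fun x hx => ?_⟩
          rw [upd]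
          linarith [hη x hx]
        -- A multiplier of the wrong sign is removed by substituting `a m = -∑ ν a`, which only adds
        -- nonnegative amounts to the multipliers of the other inequalities.
        · refine ⟨Function.update (fun i => ν' i + (-η) * ν i) m 0,
            updP _ 0 (fun i hi => ?_) fun _ => le_rfl, fun x hx => ?_⟩
          · have := mul_nonneg (neg_pos.2 h3).le (hν i hi)
            linarith [hν' i hi]
          · rw [upd]
            have h4 := hη x hx
            have h5 := hzero x hx
            have h6 : ∑ i ∈ s, (ν' i + -η * ν i) * a i x
                = ∑ i ∈ s, ν' i * a i x + (-η) * ∑ i ∈ s, ν i * a i x := by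
              rw [Finset.mul_sum, ← Finset.sum_add_distrib]
              exact Finset.sum_congr rfl fun i _ => by ring
            rw [h6]
            have h7 : ∑ i ∈ s, ν i * a i x = - a m x := by linarith
            rw [h7]
            linarith
    · have hm0 := (hf m (Finset.mem_insert_self m s)).2 hP
      obtain ⟨ν, hν, η, hη⟩ := eqcase hm0 (fun x hx hxm hxs => h x hx fun i hi => by
          rcases Finset.mem_insert.1 hi with rfl | hi
          · exact ⟨hxm.le, fun _ => hxm⟩
          · exact hxs i hi)
      refine ⟨Function.update ν m η, updP ν η hν fun hc => absurd hc hP, fun x hx => ?_⟩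
      rw [upd]
      linarith [hη x hx]

end Multipliers

/-! ### Multipliers for vector-valued constraints -/

section Families

variable {V : Type*} [AddCommGroup V] [Module ℝ V]

lemma vec_inner_eq_sum {n : ℕ} (x y : Vec n) : (inner ℝ x y : ℝ) = ∑ r, x r * y r := by
  rw [PiLp.inner_apply]
  exact Finset.sum_congr rfl fun r _ => by simp [mul_comm]

/-- Multipliers for two finite families of vector-valued affine constraints, which are inequalities
with respect to the orthant (`P m`, `Q m`) or equations. -/
theorem exists_vec_multipliers₂ {M N : Type*} [Fintype M] [Fintype N] {m : M → ℕ} {n : N → ℕ}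
    (P : M → Prop) (Q : N → Prop) {E : (i : M) → V → Vec (m i)} {F : (i : N) → V → Vec (n i)}
    (hE : ∀ i, IsAff (E i)) (hF : ∀ i, IsAff (F i)) {X : Set V} (hX : Convex ℝ X) {φ : V → ℝ}
    (hφ : IsAff φ) {x₀ : V} (hx₀ : AlgRi X x₀)
    (hE₀ : ∀ i, (∀ r, E i x₀ r ≤ 0) ∧ (¬ P i → E i x₀ = 0))
    (hF₀ : ∀ i, (∀ r, F i x₀ r ≤ 0) ∧ (¬ Q i → F i x₀ = 0))
    (h : ∀ x ∈ X, (∀ i, (∀ r, E i x r ≤ 0) ∧ (¬ P i → E i x = 0)) →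
      (∀ i, (∀ r, F i x r ≤ 0) ∧ (¬ Q i → F i x = 0)) → 0 ≤ φ x) :
    ∃ (η : (i : M) → Vec (m i)) (ζ : (i : N) → Vec (n i)), (∀ i, P i → ∀ r, 0 ≤ η i r) ∧
      (∀ i, Q i → ∀ r, 0 ≤ ζ i r) ∧
      ∀ x ∈ X, 0 ≤ φ x + ∑ i, inner ℝ (η i) (E i x) + ∑ i, inner ℝ (ζ i) (F i x) := by
  classical
  let a : (Σ i, Fin (m i)) ⊕ (Σ i, Fin (n i)) → V → ℝ :=
    Sum.elim (fun q x => E q.1 x q.2) (fun q x => F q.1 x q.2)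
  have ha : ∀ q, IsAff (a q) := by
    rintro (q | q)
    · exact (hE q.1).coord q.2
    · exact (hF q.1).coord q.2
  obtain ⟨ν, hν, h1⟩ := exists_multipliers (Sum.elim (fun q => P q.1) (fun q => Q q.1)) ha
    Finset.univ hX hφ hx₀ (by
      rintro (q | q) -
      · refine ⟨(hE₀ q.1).1 q.2, fun hn => ?_⟩
        have : E q.1 x₀ = 0 := (hE₀ q.1).2 hn
        simp [a, this]
      · refine ⟨(hF₀ q.1).1 q.2, fun hn => ?_⟩
        have : F q.1 x₀ = 0 := (hF₀ q.1).2 hn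
        simp [a, this])
    (fun x hx hxs => h x hx
      (fun i => ⟨fun r => (hxs (Sum.inl ⟨i, r⟩) (Finset.mem_univ _)).1, fun hn => by
        ext r
        exact (hxs (Sum.inl ⟨i, r⟩) (Finset.mem_univ _)).2 hn⟩)
      (fun i => ⟨fun r => (hxs (Sum.inr ⟨i, r⟩) (Finset.mem_univ _)).1, fun hn => by
        ext r
        exact (hxs (Sum.inr ⟨i, r⟩) (Finset.mem_univ _)).2 hn⟩))
  refine ⟨fun i => WithLp.toLp 2 fun r => ν (Sum.inl ⟨i, r⟩),
    fun i => WithLp.toLp 2 fun r => ν (Sum.inr ⟨i, r⟩), fun i hi r => hν (Sum.inl ⟨i, r⟩) hi,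
    fun i hi r => hν (Sum.inr ⟨i, r⟩) hi, fun x hx => ?_⟩
  have h2 := h1 x hx
  simp only [Fintype.sum_sum_type, Fintype.sum_sigma, a, Sum.elim_inl, Sum.elim_inr] at h2
  simp only [vec_inner_eq_sum]
  linarith

/-- Multipliers for a finite family of vector-valued affine equations. -/
theorem exists_vec_multipliers {M : Type*} [Fintype M] {m : M → ℕ}
    {E : (i : M) → V → Vec (m i)} (hE : ∀ i, IsAff (E i)) {X : Set V} (hX : Convex ℝ X)
    {φ : V → ℝ} (hφ : IsAff φ) {x₀ : V} (hx₀ : AlgRi X x₀) (hE₀ : ∀ i, E i x₀ = 0)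
    (h : ∀ x ∈ X, (∀ i, E i x = 0) → 0 ≤ φ x) :
    ∃ η : (i : M) → Vec (m i), ∀ x ∈ X, 0 ≤ φ x + ∑ i, inner ℝ (η i) (E i x) := by
  obtain ⟨η, ζ, -, -, h1⟩ := exists_vec_multipliers₂ (N := Empty) (n := fun _ => 0)
    (F := fun _ _ => 0) (fun _ => False) (fun _ => False) hE (fun i => i.elim) hX hφ hx₀
    (fun i => ⟨fun r => by simp [hE₀ i], fun _ => hE₀ i⟩) (fun i => i.elim)
    (fun x hx h1 _ => h x hx fun i => (h1 i).2 id)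
  exact ⟨η, fun x hx => by simpa using h1 x hx⟩

lemma IsAff.convex_zero_vec {M : Type*} {m : M → ℕ} {E : (i : M) → V → Vec (m i)}
    (hE : ∀ i, IsAff (E i)) {X : Set V} (hX : Convex ℝ X) :
    Convex ℝ {x | x ∈ X ∧ ∀ i, E i x = 0} := by
  intro x hx y hy s t hs ht hst
  refine ⟨hX hx.1 hy.1 hs ht hst, fun i => ?_⟩
  simp [hE i x y s t hst, hx.2, hy.2]

lemma AlgRi.inter_zero_vec {M : Type*} {m : M → ℕ} {E : (i : M) → V → Vec (m i)}
    (hE : ∀ i, IsAff (E i)) {X : Set V} {x : V} (h : AlgRi X x) (hx : ∀ i, E i x = 0) :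
    AlgRi {x | x ∈ X ∧ ∀ i, E i x = 0} x := by
  refine ⟨⟨h.1, hx⟩, fun y hy => ?_⟩
  obtain ⟨ε, hε, h1⟩ := h.2 y hy.1
  refine ⟨ε, hε, h1, fun i => ?_⟩
  have : x + ε • (x - y) = (1 + ε) • x + (-ε) • y := by module
  rw [this, hE i _ _ _ _ (by ring), hx, hy.2]
  simp

end Families

/-! ### Calculus of the algebraic relative interior -/

section AlgRi

open Filter Topology

variable {V W : Type*} [AddCommGroup V] [Module ℝ V] [AddCommGroup W] [Module ℝ W]

lemma AlgRi.eventually {X : Set V} (hX : Convex ℝ X) {x : V} (h : AlgRi X x) {y : V}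
    (hy : y ∈ X) : ∀ᶠ δ in 𝓝[>] (0 : ℝ), x + δ • (x - y) ∈ X := by
  obtain ⟨ε, hε, h1⟩ := h.2 y hy
  filter_upwards [Ioc_mem_nhdsGT hε] with δ hδ
  have : x + δ • (x - y) = (1 - δ / ε) • x + (δ / ε) • (x + ε • (x - y)) := by
    match_scalars
    all_goals field_simp
    all_goals ring
  rw [this]
  exact hX h.1 h1 (by rw [sub_nonneg, div_le_one hε]; exact hδ.2) (div_nonneg hδ.1.le hε.le)
    (by ring)

lemma AlgRi.of_eventually {X : Set V} {x : V} (hx : x ∈ X)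
    (h : ∀ y ∈ X, ∀ᶠ δ in 𝓝[>] (0 : ℝ), x + δ • (x - y) ∈ X) : AlgRi X x := by
  refine ⟨hx, fun y hy => ?_⟩
  obtain ⟨δ, h1, h2⟩ := ((h y hy).and self_mem_nhdsWithin).exists
  exact ⟨δ, h2, h1⟩

lemma AlgRi.univ (x : V) : AlgRi (Set.univ : Set V) x :=
  ⟨mem_univ _, fun _ _ => ⟨1, one_pos, mem_univ _⟩⟩

lemma AlgRi.prod {X : Set V} (hX : Convex ℝ X) {Y : Set W} (hY : Convex ℝ Y) {x : V} {y : W}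
    (hx : AlgRi X x) (hy : AlgRi Y y) : AlgRi {q : V × W | q.1 ∈ X ∧ q.2 ∈ Y} (x, y) := by
  refine .of_eventually ⟨hx.1, hy.1⟩ fun z hz => ?_
  filter_upwards [hx.eventually hX hz.1, hy.eventually hY hz.2] with δ h1 h2
  exact ⟨h1, h2⟩

lemma AlgRi.pi {ι : Type*} [Finite ι] {V : ι → Type*} [∀ i, AddCommGroup (V i)]
    [∀ i, Module ℝ (V i)] {X : (i : ι) → Set (V i)} (hX : ∀ i, Convex ℝ (X i)) {x : (i : ι) → V i}
    (hx : ∀ i, AlgRi (X i) (x i)) : AlgRi {f : (i : ι) → V i | ∀ i, f i ∈ X i} x := by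
  refine .of_eventually (fun i => (hx i).1) fun z hz => ?_
  exact eventually_all.2 fun i => (hx i).eventually (hX i) (hz i)

lemma convex_pi_mem {ι : Type*} {V : ι → Type*} [∀ i, AddCommGroup (V i)]
    [∀ i, Module ℝ (V i)] {X : (i : ι) → Set (V i)} (hX : ∀ i, Convex ℝ (X i)) :
    Convex ℝ {f : (i : ι) → V i | ∀ i, f i ∈ X i} :=
  fun _ hx _ hy _ _ hs ht hst i => hX i (hx i) (hy i) hs ht hst

lemma convex_prod_mem {X : Set V} (hX : Convex ℝ X) {Y : Set W} (hY : Convex ℝ Y) :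
    Convex ℝ {q : V × W | q.1 ∈ X ∧ q.2 ∈ Y} :=
  fun _ hx _ hy _ _ hs ht hst => ⟨hX hx.1 hy.1 hs ht hst, hY hx.2 hy.2 hs ht hst⟩

/-- The cone over a convex set. -/
def coneOver (Q : Set V) : Set (ℝ × V) := {q | 0 < q.1 ∧ q.1⁻¹ • q.2 ∈ Q}

lemma convex_coneOver {Q : Set V} (hQ : Convex ℝ Q) : Convex ℝ (coneOver Q) := by
  rintro ⟨l, x⟩ ⟨hl, hx⟩ ⟨m, y⟩ ⟨hm, hy⟩ s t hs ht hst
  simp only at hl hx hm hy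
  have hpos : 0 < s * l + t * m := by
    rcases hs.lt_or_eq with h | h
    · have := mul_pos h hl
      have := mul_nonneg ht hm.le
      linarith
    · have : t = 1 := by linarith
      rw [← h, this]
      linarith
  refine ⟨hpos, ?_⟩
  have : (s * l + t * m)⁻¹ • (s • x + t • y)
      = (s * l / (s * l + t * m)) • (l⁻¹ • x) + (t * m / (s * l + t * m)) • (m⁻¹ • y) := by
    match_scalars <;> field_simp
  show (s * l + t * m)⁻¹ • (s • x + t • y) ∈ Q
  rw [this]
  exact hQ hx hy (by positivity) (by positivity) (by field_simp)

lemma AlgRi.coneOver {Q : Set V} (hQ : Convex ℝ Q) {l : ℝ} (hl : 0 < l) {x : V}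
    (h : AlgRi Q x) : AlgRi (coneOver Q) (l, l • x) := by
  refine .of_eventually ⟨hl, ?_⟩ ?_
  · simpa [smul_smul, inv_mul_cancel₀ hl.ne'] using h.1
  rintro ⟨m, y⟩ ⟨hm, hy⟩
  simp only at hm hy
  have h1 := h.eventually hQ hy
  have hcont : Tendsto (fun δ : ℝ => l + δ * (l - m)) (𝓝[>] 0) (𝓝 l) := by
    have : Continuous fun δ : ℝ => l + δ * (l - m) := by fun_prop
    simpa using (this.tendsto 0).mono_left nhdsWithin_le_nhds
  have hpos : ∀ᶠ δ in 𝓝[>] (0 : ℝ), 0 < l + δ * (l - m) := hcont.eventually (lt_mem_nhds hl)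
  -- After division by the weight, a prolongation by `δ` in the cone is a prolongation in `Q` by
  -- this reparametrized step, which also tends to zero from the right.
  have ht : Tendsto (fun δ : ℝ => δ * m / (l + δ * (l - m))) (𝓝[>] 0) (𝓝[>] 0) := by
    refine tendsto_nhdsWithin_iff.2 ⟨?_, ?_⟩
    · have h2 : Tendsto (fun δ : ℝ => δ * m) (𝓝[>] 0) (𝓝 0) := by
        have : Continuous fun δ : ℝ => δ * m := by fun_prop
        simpa using (this.tendsto 0).mono_left nhdsWithin_le_nhds
      have h3 := h2.div hcont hl.ne'
      rw [zero_div] at h3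
      exact h3
    · filter_upwards [hpos, self_mem_nhdsWithin] with δ h2 h3
      exact div_pos (mul_pos h3 hm) h2
  filter_upwards [hpos, ht.eventually h1] with δ h2 h3
  refine ⟨h2, ?_⟩
  convert h3 using 1
  show (l + δ * (l - m))⁻¹ • (l • x + δ • (l • x - y)) = _
  match_scalars
  · field_simp
    ring
  · field_simp

/-- Points above the graph of a cone-convex function, over a relative interior point of the domain,
are relative interior points of the epigraph. -/
lemma AlgRi.epigraph {W : Type*} [NormedAddCommGroup W] [NormedSpace ℝ W] {C : Set W}
    {E : Set (V × W)} (hE : Convex ℝ E) (hC : ∀ x w, (x, w) ∈ E → ∀ c ∈ C, (x, w + c) ∈ E)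
    {x₀ : V} (hx₀ : AlgRi {x | ∃ w, (x, w) ∈ E} x₀) {w₀ w' : W} (hw' : (x₀, w') ∈ E)
    (hint : w₀ - w' ∈ interior C) : AlgRi E (x₀, w₀) := by
  have hmem : (x₀, w₀) ∈ E := by
    simpa using hC x₀ w' hw' _ (interior_subset hint)
  refine ⟨hmem, ?_⟩
  rintro ⟨x, w⟩ hxw
  obtain ⟨ε, hε, w₁, hw₁⟩ := hx₀.2 x ⟨w, hxw⟩
  have hcont : Continuous fun θ : ℝ => (w₀ - w') + θ • (ε • (w₀ - w) + w' - w₁) := by fun_prop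
  have h1 : ∀ᶠ θ in 𝓝[>] (0 : ℝ), (w₀ - w') + θ • (ε • (w₀ - w) + w' - w₁) ∈ interior C := by
    have := (hcont.tendsto 0).mono_left (nhdsWithin_le_nhds (s := Ioi (0 : ℝ)))
    refine this.eventually (isOpen_interior.mem_nhds ?_)
    simpa using hint
  obtain ⟨θ, h2, h3⟩ := (h1.and (Ioc_mem_nhdsGT one_pos)).exists
  refine ⟨θ * ε, mul_pos h3.1 hε, ?_⟩
  -- The horizontal prolongation may need a large height `w₁`. Mixing it with `(x₀, w')` at a small
  -- ratio `θ` changes the vertical slack so little that it stays in the interior of `C`.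
  have h4 := hC _ _ (hE hw' hw₁ (sub_nonneg.2 h3.2) h3.1.le (by ring)) _ (interior_subset h2)
  convert h4 using 1
  ext1
  · show x₀ + (θ * ε) • (x₀ - x) = (1 - θ) • x₀ + θ • (x₀ + ε • (x₀ - x))
    module
  · show w₀ + (θ * ε) • (w₀ - w)
      = ((1 - θ) • w' + θ • w₁) + (w₀ - w' + θ • (ε • (w₀ - w) + w' - w₁))
    module

/-- The line through the point and `y` stays in the affine span, where the point is interior. This
brings the topological Slater condition into the algebraic form used here. -/
lemma AlgRi.of_intrinsicInterior [TopologicalSpace V] [IsTopologicalAddGroup V]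
    [ContinuousSMul ℝ V] {X : Set V} {x : V} (h : x ∈ intrinsicInterior ℝ X) : AlgRi X x := by
  obtain ⟨⟨x', hx'⟩, h1, rfl⟩ := mem_intrinsicInterior.1 h
  refine ⟨intrinsicInterior_subset h, fun y hy => ?_⟩
  have hy' : y ∈ affineSpan ℝ X := subset_affineSpan ℝ X hy
  have hmem : ∀ t : ℝ, x' + t • (x' - y) ∈ affineSpan ℝ X := fun t => by
    have := AffineSubspace.smul_vsub_vadd_mem (affineSpan ℝ X) t hx' hy' hx'
    simpa [add_comm] using this
  let γ : ℝ → affineSpan ℝ X := fun t => ⟨x' + t • (x' - y), hmem t⟩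
  have hγ : Continuous γ := by
    refine Continuous.subtype_mk ?_ _
    fun_prop
  have hγ0 : γ 0 = ⟨x', hx'⟩ := by simp [γ]
  have h2 : ∀ᶠ t in 𝓝[>] (0 : ℝ), γ t ∈ ((↑) ⁻¹' X : Set (affineSpan ℝ X)) := by
    have := (hγ.tendsto 0).mono_left (nhdsWithin_le_nhds (s := Ioi (0 : ℝ)))
    refine this.eventually ?_
    rw [hγ0]
    exact mem_interior_iff_mem_nhds.1 h1
  obtain ⟨t, h3, h4⟩ := (h2.and self_mem_nhdsWithin).exists
  exact ⟨t, h4, h3⟩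

end AlgRi

/-! ### Affine minorants and the Fenchel–Moreau theorem -/

section FenchelMoreau

variable {d : ℕ}

/-- The affine function `z ↦ zᵀ w - r` is a minorant of `f`. -/
def Minor (f : Vec d → EReal) (w : Vec d) (r : ℝ) : Prop :=
  ∀ z, ((inner ℝ z w - r : ℝ) : EReal) ≤ f z

/-- Proper lower semicontinuous convex functions. -/
structure Reg (f : Vec d → EReal) : Prop where
  lsc : LowerSemicontinuous f
  convex : ConvexR f
  proper : ProperR f

/-- Conjugates and support functions are only ever compared with real bounds. Affine minorants then
replace extended real arithmetic. -/
lemma conj_le_coe_iff {f : Vec d → EReal} {w : Vec d} {r : ℝ} :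
    conj f w ≤ (r : EReal) ↔ Minor f w r := by
  unfold conj Minor
  rw [iSup_le_iff]
  refine forall_congr' fun z => ?_
  induction f z with
  | bot =>
    simp only [le_bot_iff, EReal.coe_ne_bot, EReal.coe_sub_bot, top_le_iff,
      EReal.coe_ne_top]
  | coe x =>
    norm_cast
    constructor <;> intro h <;> linarith
  | top => simp

lemma mem_domR_conj_iff {f : Vec d → EReal} {w : Vec d} :
    w ∈ domR (conj f) ↔ ∃ r, Minor f w r := by
  simp only [← conj_le_coe_iff]
  constructor
  · intro h
    have h : conj f w < ⊤ := h
    obtain ⟨r, h1, -⟩ := EReal.lt_iff_exists_real_btwn.1 h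
    exact ⟨r, h1.le⟩
  · rintro ⟨r, h⟩
    exact lt_of_le_of_lt h (EReal.coe_lt_top r)

lemma supp_domR_conj_le_iff {f : Vec d → EReal} {v : Vec d} {s : ℝ} :
    supp (domR (conj f)) v ≤ (s : EReal) ↔ ∀ w r, Minor f w r → (inner ℝ v w : ℝ) ≤ s := by
  unfold supp
  simp only [iSup_le_iff, mem_domR_conj_iff, EReal.coe_le_coe_iff, forall_exists_index,
    real_inner_comm]

/-- A continuous linear functional on the product space, in coordinates. -/
lemma dual_prod_eq (F : StrongDual ℝ (Vec d × ℝ)) :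
    ∃ (a : Vec d) (b : ℝ), ∀ z t, F (z, t) = inner ℝ z a + b * t := by
  refine ⟨(InnerProductSpace.toDual ℝ (Vec d)).symm (F.comp (.inl ℝ _ _)), F (0, 1),
    fun z t => ?_⟩
  rw [real_inner_comm, InnerProductSpace.toDual_symm_apply]
  have h1 : ((z, t) : Vec d × ℝ) = (z, 0) + t • (0, 1) := by simp
  rw [h1, map_add, map_smul]
  simp [mul_comm]

/-- Hahn–Banach for a point strictly below the closed convex epigraph. The coefficient `b` cannot be
negative because the epigraph is unbounded upwards; `b = 0` is a vertical hyperplane and has to be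
allowed. -/
lemma Reg.separate {f : Vec d → EReal} (hf : Reg f) {x : Vec d} {s : ℝ} (h : (s : EReal) < f x) :
    ∃ (a : Vec d) (b u : ℝ), 0 ≤ b ∧ inner ℝ x a + b * s < u ∧
      ∀ z t, f z ≤ ((t : ℝ) : EReal) → u < inner ℝ z a + b * t := by
  have hclosed : IsClosed {q : Vec d × ℝ | f q.1 ≤ (q.2 : EReal)} := by
    have := hf.lsc.isClosed_epigraph
    exact this.preimage (f := fun q : Vec d × ℝ => (q.1, (q.2 : EReal)))
      (continuous_fst.prodMk (continuous_coe_real_ereal.comp continuous_snd))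
  obtain ⟨F, u, h1, h2⟩ := geometric_hahn_banach_point_closed (x := (x, s)) hf.convex hclosed
    (by simpa using h)
  obtain ⟨a, b, hF⟩ := dual_prod_eq F
  rw [hF] at h1
  have h3 : ∀ z t, f z ≤ ((t : ℝ) : EReal) → u < inner ℝ z a + b * t := fun z t hzt => by
    have := h2 (z, t) hzt
    rwa [hF] at this
  refine ⟨a, b, u, ?_, h1, h3⟩
  by_contra hb
  push Not at hb
  obtain ⟨z, hz⟩ := hf.proper.2
  obtain ⟨t, ht, -⟩ := EReal.lt_iff_exists_real_btwn.1 hz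
  have h4 : ∀ c : ℝ, 0 ≤ c → u < inner ℝ z a + b * (t + c) := fun c hc =>
    h3 z _ (ht.le.trans (by exact_mod_cast (by linarith : t ≤ t + c)))
  -- This upward shift lowers the functional by its full excess over `u`, contradicting the
  -- separation.
  have h5 := h4 ((|inner ℝ z a + b * t - u|) / (-b)) (div_nonneg (abs_nonneg _) (by linarith))
  have h6 : b * (|inner ℝ z a + b * t - u| / (-b)) = -|inner ℝ z a + b * t - u| := by
    have := hb.ne
    field_simp
  have := le_abs_self (inner ℝ z a + b * t - u)
  nlinarith

lemma minor_of_separate {f : Vec d → EReal} (hbot : ∀ x, ⊥ < f x) {a : Vec d} {b u : ℝ}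
    (hb : 0 < b) (h : ∀ z t, f z ≤ ((t : ℝ) : EReal) → u < inner ℝ z a + b * t) :
    Minor f (-(b⁻¹ • a)) (-(b⁻¹ * u)) := by
  intro z
  induction hz : f z with
  | bot => exact absurd hz (hbot z).ne'
  | top => exact le_top
  | coe t =>
    have h1 := h z t hz.le
    rw [EReal.coe_le_coe_iff, inner_neg_right, inner_smul_right]
    have h2 : t = b⁻¹ * (b * t) := by field_simp
    rw [h2, ← mul_neg, sub_neg_eq_add, ← mul_add]
    exact mul_le_mul_of_nonneg_left (by linarith) (inv_pos.2 hb).le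

/-- Separating a point just below the graph, over the domain, cannot give a vertical hyperplane,
since the graph point lies over the same base point. -/
lemma Reg.exists_minor {f : Vec d → EReal} (hf : Reg f) : ∃ w r, Minor f w r := by
  obtain ⟨x, hx⟩ := hf.proper.2
  have hx' := hf.proper.1 x
  lift f x to ℝ using ⟨hx.ne, hx'.ne'⟩ with y hy
  obtain ⟨a, b, u, hb, h1, h2⟩ := hf.separate (x := x) (s := y - 1)
    (by rw [← hy]; exact_mod_cast sub_one_lt y)
  rcases hb.lt_or_eq with hb | rfl
  · exact ⟨_, _, minor_of_separate hf.proper.1 hb h2⟩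
  · have := h2 x y hy.ge
    linarith

/-- A proper lower semicontinuous convex function is the supremum of its affine minorants. -/
theorem Reg.le_of_minor {f : Vec d → EReal} (hf : Reg f) {x : Vec d} {s : ℝ}
    (h : ∀ w r, Minor f w r → (inner ℝ x w : ℝ) - r ≤ s) : f x ≤ (s : EReal) := by
  by_contra hs
  obtain ⟨a, b, u, hb, h1, h2⟩ := hf.separate (not_le.1 hs)
  rcases hb.lt_or_eq with hb | rfl
  · have h3 := h _ _ (minor_of_separate hf.proper.1 hb h2)
    rw [inner_neg_right, inner_smul_right] at h3
    have h4 : b⁻¹ * (inner ℝ x a + b * s) < b⁻¹ * u :=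
      mul_lt_mul_of_pos_left h1 (inv_pos.2 hb)
    have h5 : b⁻¹ * (inner ℝ x a + b * s) = b⁻¹ * inner ℝ x a + s := by field_simp
    linarith
  -- Vertical hyperplane: `u - zᵀa` is negative on the domain and positive at `x`. Adding large
  -- multiples of it to any minorant keeps a minorant whose value at `x` is unbounded.
  · obtain ⟨w, r, hw⟩ := hf.exists_minor
    have h3 : ∀ c : ℝ, 0 ≤ c → Minor f (w - c • a) (r - c * u) := fun c hc z => by
      induction hz : f z with
      | bot => exact absurd hz (hf.proper.1 z).ne'
      | top => exact le_top
      | coe t =>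
        have h4 := h2 z t hz.le
        have h5 := hw z
        rw [hz, EReal.coe_le_coe_iff] at h5
        rw [EReal.coe_le_coe_iff, inner_sub_right, inner_smul_right]
        nlinarith
    have hpos : 0 < u - inner ℝ x a := by linarith
    have h4 := h _ _ (h3 (|s + r - inner ℝ x w + 1| / (u - inner ℝ x a))
      (div_nonneg (abs_nonneg _) hpos.le))
    rw [inner_sub_right, inner_smul_right] at h4
    have h5 : |s + r - inner ℝ x w + 1| / (u - inner ℝ x a) * (u - inner ℝ x a)
      = |s + r - inner ℝ x w + 1| := by field_simp
    have h6 := le_abs_self (s + r - inner ℝ x w + 1)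
    linarith

end FenchelMoreau

/-! ### Dual cones -/

section Cones

variable {n : ℕ} {C : ProperCone ℝ (Vec n)}

lemma dualCone_inner_nonneg {l y : Vec n} (hl : l ∈ dualCone C) (hy : y ∈ C) :
    0 ≤ (inner ℝ l y : ℝ) := by
  rw [real_inner_comm]
  exact ProperCone.mem_innerDual.1 hl hy

/-- The bipolar theorem. The zero functional imposes nothing and is dropped, because moment
conditions and recession values only involve nonzero ones. -/
lemma mem_iff_forall_dualCone {y : Vec n} :
    y ∈ C ↔ ∀ l ∈ dualCone C, l ≠ 0 → 0 ≤ (inner ℝ l y : ℝ) := by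
  refine ⟨fun hy l hl _ => dualCone_inner_nonneg hl hy, fun h => ?_⟩
  rw [← ProperCone.innerDual_innerDual C, ProperCone.mem_innerDual]
  intro l hl
  rcases eq_or_ne l 0 with rfl | h0
  · simp
  · exact h l hl h0

/-- Otherwise the cone would be the whole space, which contains a line. One nonzero scalarization is
enough to detect that a value is not `+∞_C`. -/
lemma exists_dualCone_ne_zero (hn : 0 < n) (hC : IsProper C) : ∃ l ∈ dualCone C, l ≠ 0 := by
  by_contra h
  push Not at h
  have hall : ∀ y : Vec n, y ∈ C := fun y =>
    mem_iff_forall_dualCone.2 fun l hl h0 => absurd (h l hl) h0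
  have h1 := hC.pointed (EuclideanSpace.single ⟨0, hn⟩ 1) (hall _) (hall _)
  have h2 := congrArg (fun y : Vec n => y ⟨0, hn⟩) h1
  simp at h2

lemma interior_add_mem {x y : Vec n} (hx : x ∈ interior (C : Set (Vec n))) (hy : y ∈ C) :
    x + y ∈ interior (C : Set (Vec n)) := by
  have hopen : IsOpen ((fun z => z - y) ⁻¹' interior (C : Set (Vec n))) :=
    isOpen_interior.preimage (by fun_prop)
  refine interior_maximal (fun z hz => ?_) hopen (by simpa using hx)
  have h1 : z - y ∈ C := interior_subset hz
  simpa using C.add_mem h1 hy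

lemma interior_smul_mem {x : Vec n} (hx : x ∈ interior (C : Set (Vec n))) {t : ℝ} (ht : 0 < t) :
    t • x ∈ interior (C : Set (Vec n)) := by
  have hopen : IsOpen ((fun z => t⁻¹ • z) ⁻¹' interior (C : Set (Vec n))) :=
    isOpen_interior.preimage (by fun_prop)
  refine interior_maximal (fun z hz => ?_) hopen (by simpa [smul_smul, ht.ne'] using hx)
  have h1 : t⁻¹ • z ∈ C := interior_subset hz
  simpa [smul_smul, ht.ne'] using C.smul_mem h1 ht.le

end Cones

/-! ### Cone-convex functions and their perspectives -/

section VectorFunctions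

variable {d n : ℕ} {C : ProperCone ℝ (Vec n)} {f : Vec d → ExtVec n}

/-- Proper, star lower semicontinuous, cone-convex functions. -/
def VReg (C : ProperCone ℝ (Vec n)) (f : Vec d → ExtVec n) : Prop :=
  ProperV f ∧ StarLscV C f ∧ ConvexV C f

lemma VReg.eq_fin (hf : VReg C f) {x : Vec d} (hx : x ∈ domV f) :
    f x = ExtVec.fin (f x).toVec := by
  have h1 := hf.1.1 x
  have h2 : f x ≠ .posInf := hx
  cases h : f x <;> simp_all [ExtVec.toVec]

lemma VReg.scal_le_iff (hf : VReg C f) {l : Vec n} {x : Vec d} {t : ℝ} :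
    ExtVec.scal l (f x) ≤ (t : EReal) ↔ x ∈ domV f ∧ (inner ℝ l (f x).toVec : ℝ) ≤ t := by
  have h1 := hf.1.1 x
  cases h : f x <;> simp_all [ExtVec.toVec, domV, ExtVec.scal]

lemma VReg.le_fin_iff (hf : VReg C f) {x : Vec d} {w : Vec n} :
    ExtVec.le C (f x) (.fin w) ↔ x ∈ domV f ∧ w - (f x).toVec ∈ C := by
  have h1 := hf.1.1 x
  cases h : f x <;> simp_all [ExtVec.toVec, domV, ExtVec.le]

lemma VReg.le_fin_iff_scal (hf : VReg C f) (hn : 0 < n) (hC : IsProper C) {x : Vec d}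
    {w : Vec n} : ExtVec.le C (f x) (.fin w) ↔
      ∀ l ∈ dualCone C, l ≠ 0 → ExtVec.scal l (f x) ≤ ((inner ℝ l w : ℝ) : EReal) := by
  rw [hf.le_fin_iff, mem_iff_forall_dualCone]
  simp only [hf.scal_le_iff, inner_sub_right, sub_nonneg]
  constructor
  · rintro ⟨h1, h2⟩ l hl h0
    exact ⟨h1, h2 l hl h0⟩
  · intro h
    obtain ⟨l, hl, h0⟩ := exists_dualCone_ne_zero hn hC
    exact ⟨(h l hl h0).1, fun l hl h0 => (h l hl h0).2⟩

lemma VReg.combo (hf : VReg C f) {x y : Vec d} (hx : x ∈ domV f) (hy : y ∈ domV f) {s t : ℝ}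
    (hs : 0 ≤ s) (ht : 0 ≤ t) (hst : s + t = 1) :
    s • x + t • y ∈ domV f ∧ s • (f x).toVec + t • (f y).toVec - (f (s • x + t • y)).toVec ∈ C := by
  obtain rfl : t = 1 - s := by linarith
  have h := hf.2.2.2 x hx y hy s ⟨hs, by linarith⟩
  rw [hf.eq_fin hx, hf.eq_fin hy] at h
  exact hf.le_fin_iff.1 h

lemma VReg.reg_scal (hf : VReg C f) {l : Vec n} (hl : l ∈ dualCone C) (h0 : l ≠ 0) :
    Reg fun x => ExtVec.scal l (f x) := by
  refine ⟨hf.2.1 l hl h0, ?_, ?_, ?_⟩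
  · rintro ⟨x, a⟩ hx ⟨y, b⟩ hy s t hs ht hst
    have hx := hf.scal_le_iff.1 hx
    have hy := hf.scal_le_iff.1 hy
    obtain ⟨h1, h2⟩ := hf.combo hx.1 hy.1 hs ht hst
    refine hf.scal_le_iff.2 ⟨h1, ?_⟩
    have h3 := dualCone_inner_nonneg hl h2
    simp only [inner_sub_right, inner_add_right, inner_smul_right] at h3
    have h4 := mul_le_mul_of_nonneg_left hx.2 hs
    have h5 := mul_le_mul_of_nonneg_left hy.2 ht
    show _ ≤ s * a + t * b
    have h6 : s • ((x, a) : Vec d × ℝ) + t • (y, b) = (s • x + t • y, s * a + t * b) := rfl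
    rw [h6]
    linarith
  · intro x
    have h1 := hf.1.1 x
    cases h : f x <;> simp_all [ExtVec.scal]
  · obtain ⟨x, hx⟩ := hf.1.2
    refine ⟨x, ?_⟩
    show ExtVec.scal l (f x) < ⊤
    rw [hf.eq_fin hx]
    exact EReal.coe_lt_top _

/-- The point `(v, t, ω)` satisfies all linear inequalities which characterize the epigraph of the
closed perspective of `f`. -/
def PerspEpi (C : ProperCone ℝ (Vec n)) (f : Vec d → ExtVec n) (v : Vec d) (t : ℝ) (ω : Vec n) :
    Prop :=
  ∀ l ∈ dualCone C, l ≠ 0 → ∀ w r, Minor (fun x => ExtVec.scal l (f x)) w r →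
    (inner ℝ v w : ℝ) ≤ t * r + inner ℝ l ω

lemma VReg.persp_le_iff_of_pos (hf : VReg C f) {v : Vec d} {t : ℝ} (ht : 0 < t) {ω : Vec n} :
    ExtVec.le C (persp C f v t) (.fin ω) ↔
      t⁻¹ • v ∈ domV f ∧ ω - t • (f (t⁻¹ • v)).toVec ∈ C := by
  have h1 := hf.1.1 (t⁻¹ • v)
  simp only [persp, ht, if_true]
  cases h : f (t⁻¹ • v) <;> simp_all [ExtVec.toVec, domV, ExtVec.le, ExtVec.smul, ht.ne']

lemma VReg.persp_le_zero_iff_of_pos (hf : VReg C f) {v : Vec d} {t : ℝ} (ht : 0 < t) :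
    ExtVec.le C (persp C f v t) (.fin 0) ↔ ExtVec.le C (f (t⁻¹ • v)) (.fin 0) := by
  rw [hf.persp_le_iff_of_pos ht, hf.le_fin_iff, zero_sub, zero_sub, ← smul_neg]
  refine and_congr_right fun _ => ⟨fun h => ?_, fun h => C.smul_mem h ht.le⟩
  have := C.smul_mem h (inv_pos.2 ht).le
  rwa [smul_smul, inv_mul_cancel₀ ht.ne', one_smul] at this

lemma VReg.perspEpi_of_persp_le (hf : VReg C f) {v : Vec d} {t : ℝ} (ht : 0 ≤ t) {ω : Vec n}
    (h : ExtVec.le C (persp C f v t) (.fin ω)) : PerspEpi C f v t ω := by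
  intro l hl h0 w r hw
  rcases ht.lt_or_eq with ht | rfl
  · obtain ⟨h1, h2⟩ := (hf.persp_le_iff_of_pos ht).1 h
    have h3 := dualCone_inner_nonneg hl h2
    have h4 : ((inner ℝ (t⁻¹ • v) w - r : ℝ) : EReal) ≤ ExtVec.scal l (f (t⁻¹ • v)) := hw _
    rw [hf.eq_fin h1] at h4
    simp only [ExtVec.scal, EReal.coe_le_coe_iff, inner_smul_left, RCLike.conj_to_real] at h4
    rw [inner_sub_right, inner_smul_right] at h3
    have h5 := mul_le_mul_of_nonneg_left h4 ht.le
    rw [mul_sub, ← mul_assoc, mul_inv_cancel₀ ht.ne', one_mul] at h5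
    linarith
  · simp only [persp, lt_irrefl, if_false, true_and] at h
    split_ifs at h with hex
    · have h1 := hex.2.choose_spec l hl h0
      have h2 : ω - hex.2.choose ∈ C := h
      have h3 := dualCone_inner_nonneg hl h2
      have h4 := supp_domR_conj_le_iff.1 h1.ge w r hw
      rw [inner_sub_right] at h3
      linarith
    · exact absurd h (by simp [ExtVec.le])

/-- Fenchel–Moreau for each scalarization at `v/t`. At `t = 0` there is no such converse in general,
since the scalar recession values need not come from a single vector. -/
lemma VReg.persp_le_of_perspEpi (hf : VReg C f) (hn : 0 < n) (hC : IsProper C) {v : Vec d}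
    {t : ℝ} (ht : 0 < t) {ω : Vec n} (h : PerspEpi C f v t ω) :
    ExtVec.le C (persp C f v t) (.fin ω) := by
  rw [hf.persp_le_iff_of_pos ht]
  have h1 : ExtVec.le C (f (t⁻¹ • v)) (.fin (t⁻¹ • ω)) := by
    refine (hf.le_fin_iff_scal hn hC).2 fun l hl h0 => ?_
    refine (hf.reg_scal hl h0).le_of_minor fun w r hw => ?_
    have h2 := mul_le_mul_of_nonneg_left (h l hl h0 w r hw) (inv_pos.2 ht).le
    rw [mul_add, ← mul_assoc, inv_mul_cancel₀ ht.ne', one_mul] at h2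
    rw [inner_smul_left, inner_smul_right]
    simp only [RCLike.conj_to_real]
    linarith
  obtain ⟨h2, h3⟩ := hf.le_fin_iff.1 h1
  refine ⟨h2, ?_⟩
  have h4 := C.smul_mem h3 ht.le
  rwa [smul_sub, smul_smul, mul_inv_cancel₀ ht.ne', one_smul] at h4

lemma VReg.supp_zero (hf : VReg C f) {l : Vec n} (hl : l ∈ dualCone C) (h0 : l ≠ 0) :
    supp (domR (conj fun x => ExtVec.scal l (f x))) 0 = 0 := by
  refine le_antisymm ?_ ?_
  · exact supp_domR_conj_le_iff.2 fun w r _ => by simp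
  · obtain ⟨w, r, hw⟩ := (hf.reg_scal hl h0).exists_minor
    unfold supp
    refine le_iSup₂_of_le w (mem_domR_conj_iff.2 ⟨r, hw⟩) ?_
    simp

/-- In the direction `v = 0` all recession values vanish, so the vector 0 realizes them and the
perspective is finite there. -/
lemma VReg.persp_zero_le_of_perspEpi (hf : VReg C f) {ω : Vec n} (h : PerspEpi C f 0 0 ω) :
    ExtVec.le C (persp C f 0 0) (.fin ω) := by
  have hex : ∃ y, IsRecessionValue C f 0 y :=
    ⟨0, fun l hl h0 => by simp [hf.supp_zero hl h0]⟩
  simp only [persp, lt_irrefl, if_false, true_and, hex, dif_pos]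
  show ω - hex.choose ∈ C
  refine mem_iff_forall_dualCone.2 fun l hl h0 => ?_
  have h1 := hex.choose_spec l hl h0
  rw [hf.supp_zero hl h0] at h1
  have h2 : (inner ℝ l hex.choose : ℝ) = 0 := by exact_mod_cast h1
  obtain ⟨w, r, hw⟩ := (hf.reg_scal hl h0).exists_minor
  have h3 := h l hl h0 w r hw
  rw [inner_sub_right, h2]
  simpa using h3

lemma PerspEpi.combo {v v' : Vec d} {t t' : ℝ} {ω ω' : Vec n} (h : PerspEpi C f v t ω)
    (h' : PerspEpi C f v' t' ω') {a b : ℝ} (ha : 0 ≤ a) (hb : 0 ≤ b) :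
    PerspEpi C f (a • v + b • v') (a * t + b * t') (a • ω + b • ω') := by
  intro l hl h0 w r hw
  have h1 := mul_le_mul_of_nonneg_left (h l hl h0 w r hw) ha
  have h2 := mul_le_mul_of_nonneg_left (h' l hl h0 w r hw) hb
  simp only [inner_add_left, inner_smul_left, inner_add_right, inner_smul_right,
    RCLike.conj_to_real]
  linarith

/-- A recession direction of the function is a recession direction of its zero sublevel set. -/
lemma VReg.sublevel_add (hf : VReg C f) (hn : 0 < n) (hC : IsProper C) {v z : Vec d}
    (h : PerspEpi C f v 0 0) (hz : ExtVec.le C (f z) (.fin 0)) {t : ℝ} (ht : 0 ≤ t) :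
    ExtVec.le C (f (z + t • v)) (.fin 0) := by
  rw [hf.le_fin_iff_scal hn hC] at hz ⊢
  intro l hl h0
  refine (hf.reg_scal hl h0).le_of_minor fun w r hw => ?_
  have h1 := h l hl h0 w r hw
  have h2 := (hw z).trans (hz l hl h0)
  rw [EReal.coe_le_coe_iff] at h2
  rw [inner_add_left, inner_smul_left]
  simp only [RCLike.conj_to_real, inner_zero_right, zero_mul, add_zero] at h1 h2 ⊢
  have := mul_nonpos_of_nonneg_of_nonpos ht h1
  linarith

end VectorFunctions

/-! ### Perspectives of concave functions -/

section ConcavePerspective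

variable {d : ℕ} {g : Vec d → EReal}

/-- The point `(v, t, τ)` satisfies all linear inequalities which characterize the hypograph of the
closed perspective of `g`. -/
def PerspHypo (g : Vec d → EReal) (v : Vec d) (t τ : ℝ) : Prop :=
  ∀ w r, Minor (fun z => - g z) w r → (inner ℝ v w : ℝ) ≤ t * r - τ

lemma coe_toReal_of_mem_domR (hg : Reg fun z => - g z) {z : Vec d}
    (hz : z ∈ domR fun z => - g z) : (((g z).toReal : ℝ) : EReal) = g z := by
  have h1 := hg.proper.1 z
  have h2 : - g z < ⊤ := hz
  refine EReal.coe_toReal ?_ ?_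
  · rintro h
    simp [h] at h1
  · rintro h
    simp [h] at h2

lemma le_concPersp_iff_of_pos (hg : Reg fun z => - g z) {v : Vec d} {t τ : ℝ} (ht : 0 < t) :
    (τ : EReal) ≤ concPersp g v t ↔
      t⁻¹ • v ∈ domR (fun z => - g z) ∧ τ ≤ t * (g (t⁻¹ • v)).toReal := by
  have h1 := hg.proper.1 (t⁻¹ • v)
  simp only [concPersp, ht, if_true, domR, mem_ofPred_eq]
  induction h : g (t⁻¹ • v) with
  | bot => simp [EReal.coe_mul_bot_of_pos ht]
  | coe x => 
    have h2 : -(x : EReal) < ⊤ := by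
      rw [← EReal.coe_neg]
      exact EReal.coe_lt_top _
    norm_cast
    simp [h2]
  | top => simp [h] at h1

lemma perspHypo_of_le_concPersp (hg : Reg fun z => - g z) {v : Vec d} {t τ : ℝ} (ht : 0 ≤ t)
    (h : (τ : EReal) ≤ concPersp g v t) : PerspHypo g v t τ := by
  intro w r hw
  rcases ht.lt_or_eq with ht | rfl
  · obtain ⟨h1, h2⟩ := (le_concPersp_iff_of_pos hg ht).1 h
    have h3 : _ ≤ - g (t⁻¹ • v) := hw (t⁻¹ • v)
    rw [← coe_toReal_of_mem_domR hg h1, ← EReal.coe_neg, EReal.coe_le_coe_iff, inner_smul_left] at h3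
    simp only [RCLike.conj_to_real] at h3
    have h5 := mul_le_mul_of_nonneg_left h3 ht.le
    rw [mul_sub, ← mul_assoc, mul_inv_cancel₀ ht.ne', one_mul] at h5
    linarith
  · simp only [concPersp, lt_irrefl, if_false, if_true] at h
    have h1 := EReal.neg_le_neg_iff.2 h
    rw [neg_neg, ← EReal.coe_neg] at h1
    have := supp_domR_conj_le_iff.1 h1 w r hw
    linarith

/-- Unlike for vector-valued functions, `t = 0` is included: there the scalar perspective is defined
by exactly these linear inequalities. -/
lemma le_concPersp_of_perspHypo (hg : Reg fun z => - g z) {v : Vec d} {t τ : ℝ} (ht : 0 ≤ t)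
    (h : PerspHypo g v t τ) : (τ : EReal) ≤ concPersp g v t := by
  rcases ht.lt_or_eq with ht | rfl
  · rw [le_concPersp_iff_of_pos hg ht]
    have h1 : - g (t⁻¹ • v) ≤ ((-(t⁻¹ * τ) : ℝ) : EReal) := by
      refine hg.le_of_minor fun w r hw => ?_
      have h2 := mul_le_mul_of_nonneg_left (h w r hw) (inv_pos.2 ht).le
      rw [mul_sub, ← mul_assoc, inv_mul_cancel₀ ht.ne', one_mul] at h2
      rw [inner_smul_left]
      simp only [RCLike.conj_to_real]
      linarith
    have h2 : t⁻¹ • v ∈ domR (fun z => - g z) := lt_of_le_of_lt h1 (EReal.coe_lt_top _)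
    refine ⟨h2, ?_⟩
    rw [← coe_toReal_of_mem_domR hg h2, ← EReal.coe_neg, EReal.coe_le_coe_iff, neg_le_neg_iff] at h1
    rwa [inv_mul_le_iff₀ ht] at h1
  · simp only [concPersp, lt_irrefl, if_false, if_true]
    rw [← EReal.neg_le_neg_iff, neg_neg, ← EReal.coe_neg, supp_domR_conj_le_iff]
    intro w r hw
    have := h w r hw
    linarith

lemma PerspHypo.combo {v v' : Vec d} {t t' τ τ' : ℝ} (h : PerspHypo g v t τ)
    (h' : PerspHypo g v' t' τ') {a b : ℝ} (ha : 0 ≤ a) (hb : 0 ≤ b) :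
    PerspHypo g (a • v + b • v') (a * t + b * t') (a * τ + b * τ') := by
  intro w r hw
  have h1 := mul_le_mul_of_nonneg_left (h w r hw) ha
  have h2 := mul_le_mul_of_nonneg_left (h' w r hw) hb
  simp only [inner_add_left, inner_smul_left, RCLike.conj_to_real]
  linarith

end ConcavePerspective

/-! ### Extended real sums and separable suprema -/

section Sums

lemma ereal_coe_sum {ι : Type*} (s : Finset ι) (f : ι → ℝ) :
    ((∑ i ∈ s, f i : ℝ) : EReal) = ∑ i ∈ s, ((f i : ℝ) : EReal) := by
  classical
  induction s using Finset.induction_on with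
  | empty => simp
  | insert a s ha ih => rw [Finset.sum_insert ha, Finset.sum_insert ha, EReal.coe_add, ih]

lemma ereal_sum_ne_bot {ι : Type*} (s : Finset ι) {f : ι → EReal} (hf : ∀ i ∈ s, f i ≠ ⊥) :
    ∑ i ∈ s, f i ≠ ⊥ := by
  classical
  induction s using Finset.induction_on with
  | empty => simp
  | insert a s ha ih =>
    rw [Finset.sum_insert ha, Ne, EReal.add_eq_bot_iff, not_or]
    exact ⟨hf a (Finset.mem_insert_self a s), ih fun i hi => hf i (Finset.mem_insert_of_mem hi)⟩

lemma ereal_add_ne_top {a b : EReal} (ha : a ≠ ⊥) (hb : b ≠ ⊥) (h : a + b ≠ ⊤) :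
    a ≠ ⊤ ∧ b ≠ ⊤ := by
  constructor
  · rintro rfl
    exact h (EReal.top_add_of_ne_bot hb)
  · rintro rfl
    exact h (EReal.add_top_of_ne_bot ha)

lemma ereal_sum_ne_top {ι : Type*} (s : Finset ι) {f : ι → EReal} (hf : ∀ i ∈ s, f i ≠ ⊥)
    (h : ∑ i ∈ s, f i ≠ ⊤) : ∀ i ∈ s, f i ≠ ⊤ := by
  classical
  induction s using Finset.induction_on with
  | empty => simp
  | insert a s ha ih =>
    have h1 : ∀ i ∈ s, f i ≠ ⊥ := fun i hi => hf i (Finset.mem_insert_of_mem hi)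
    rw [Finset.sum_insert ha] at h
    have h2 := ereal_add_ne_top (hf a (Finset.mem_insert_self a s)) (ereal_sum_ne_bot s h1) h
    intro i hi
    rcases Finset.mem_insert.1 hi with rfl | hi
    · exact h2.1
    · exact ih h1 h2.2 i hi

/-- If all selections from finitely many nonempty sets have a sum of at most `r`, then the sets have
upper bounds whose sum is at most `r`. -/
lemma exists_split {ι : Type*} [Fintype ι] {T : ι → Set ℝ} (hT : ∀ b, (T b).Nonempty) {r : ℝ}
    (h : ∀ t : ι → ℝ, (∀ b, t b ∈ T b) → ∑ b, t b ≤ r) :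
    ∃ w : ι → ℝ, (∀ b, ∀ t ∈ T b, t ≤ w b) ∧ ∑ b, w b ≤ r := by
  classical
  choose t₀ ht₀ using hT
  have hbdd : ∀ b, BddAbove (T b) := fun b => by
    -- Freezing the other selections at `t₀` bounds the remaining one.
    refine ⟨r - ∑ c ∈ Finset.univ.erase b, t₀ c, fun t ht => ?_⟩
    have h1 := h (Function.update t₀ b t) fun c => by
      rcases eq_or_ne c b with rfl | hc
      · simpa using ht
      · simpa [Function.update_of_ne hc] using ht₀ c
    rw [← Finset.add_sum_erase _ _ (Finset.mem_univ b), Function.update_self] at h1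
    rw [Finset.sum_congr rfl fun c hc => Function.update_of_ne (Finset.ne_of_mem_erase hc) _ _]
      at h1
    linarith
  refine ⟨fun b => sSup (T b), fun b t ht => le_csSup (hbdd b) ht, ?_⟩
  refine le_of_forall_pos_le_add fun ε hε => ?_
  -- The extra 1 covers an empty index type; the total error is still at most `ε`.
  have hcard : 0 < (Fintype.card ι : ℝ) + 1 := by positivity
  have h1 : ∀ b, ∃ t ∈ T b, sSup (T b) - ε / (Fintype.card ι + 1) < t := fun b =>
    exists_lt_of_lt_csSup ⟨t₀ b, ht₀ b⟩ (sub_lt_self _ (by positivity))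
  choose t ht1 ht2 using h1
  have h2 : ∑ b, (sSup (T b) - ε / (Fintype.card ι + 1)) ≤ ∑ b, t b :=
    Finset.sum_le_sum fun b _ => (ht2 b).le
  rw [Finset.sum_sub_distrib, Finset.sum_const, Finset.card_univ, nsmul_eq_mul] at h2
  have h3 : (Fintype.card ι : ℝ) * (ε / (Fintype.card ι + 1)) ≤ ε := by
    rw [mul_div_assoc', div_le_iff₀ hcard]
    nlinarith
  linarith [h t ht1]

end Sums

lemma conj_ne_bot {d : ℕ} {f : Vec d → EReal} (hf : ∃ x, f x < ⊤) (w : Vec d) :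
    conj f w ≠ ⊥ := by
  obtain ⟨x, hx⟩ := hf
  refine ne_bot_of_le_ne_bot ?_ (le_iSup (fun x => ((inner ℝ x w : ℝ) : EReal) - f x) x)
  induction h : f x with
  | bot => simp
  | coe y =>
    rw [← EReal.coe_sub]
    exact EReal.coe_ne_bot _
  | top => simp [h] at hx

/-! ### Minorants tested on the effective domain -/

section ScalarMinorants

variable {d n : ℕ} {C : ProperCone ℝ (Vec n)} {f : Vec d → ExtVec n}

lemma VReg.minor_scal_iff (hf : VReg C f) {l : Vec n} {w : Vec d} {r : ℝ} :
    Minor (fun x => ExtVec.scal l (f x)) w r ↔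
      ∀ z ∈ domV f, (inner ℝ z w : ℝ) - r ≤ inner ℝ l (f z).toVec := by
  refine ⟨fun h z hz => ?_, fun h z => ?_⟩
  · have h1 : _ ≤ ExtVec.scal l (f z) := h z
    rw [hf.eq_fin hz] at h1
    exact EReal.coe_le_coe_iff.1 h1
  · by_cases hz : z ∈ domV f
    · show _ ≤ ExtVec.scal l (f z)
      rw [hf.eq_fin hz]
      exact EReal.coe_le_coe_iff.2 (h z hz)
    · have h1 : f z = .posInf := not_not.1 hz
      simp [h1, ExtVec.scal]

lemma minor_neg_iff {g : Vec d → EReal} (hg : Reg fun z => - g z) {w : Vec d} {r : ℝ} :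
    Minor (fun z => - g z) w r ↔
      ∀ z ∈ domR (fun z => - g z), (g z).toReal + inner ℝ z w ≤ r := by
  refine ⟨fun h z hz => ?_, fun h z => ?_⟩
  · have h1 : _ ≤ - g z := h z
    rw [← coe_toReal_of_mem_domR hg hz, ← EReal.coe_neg, EReal.coe_le_coe_iff] at h1
    linarith
  · by_cases hz : z ∈ domR (fun z => - g z)
    · have h1 := h z hz
      show _ ≤ - g z
      rw [← coe_toReal_of_mem_domR hg hz, ← EReal.coe_neg, EReal.coe_le_coe_iff]
      linarith
    · have h1 : ¬ (- g z < ⊤) := hz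
      rw [not_lt_top_iff] at h1
      simp [h1]

end ScalarMinorants

/-! ### Constraints of (AP-W') and weak duality with (D-UQ) -/

namespace Data

variable {D : Data}

lemma Standing.c_vreg (hD : D.Standing) (k) (l) : VReg (D.C k l) (D.c k l) := hD.c_reg k l

lemma Standing.h_vreg (hD : D.Standing) (j) (k) : VReg (D.H j) (D.hc j k) := hD.hc_reg j k

lemma Standing.g_reg (hD : D.Standing) (k) (i) : Reg fun z => - D.gc k i z :=
  ⟨(hD.gc_reg k i).2.1.1, (hD.gc_reg k i).2.2, (hD.gc_reg k i).1⟩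

/-- Upper bounds on the individual conjugates certify an upper bound `r` on their sum. -/
def ApwEpi (k : Fin D.nK) (i : Fin (D.nI k)) (x : D.ApwVar) (r : ℝ) : Prop :=
  (∀ j, x.beta j ∈ dualCone (D.H j)) ∧ (∀ l, x.nu k i l ∈ dualCone (D.C k l)) ∧
    ∃ (r₀ : ℝ) (r₁ : Fin D.nJ → ℝ) (r₂ : Fin (D.nL k) → ℝ),
      Minor (fun z => - D.gc k i z) (x.y0 k i) r₀ ∧
      (∀ j, Minor (fun z => ExtVec.scal (x.beta j) (D.hc j k z)) (x.y1 k i j) (r₁ j)) ∧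
      (∀ l, Minor (fun z => ExtVec.scal (x.nu k i l) (D.c k l z)) (x.y2 k i l) (r₂ l)) ∧
      r₀ + ∑ j, r₁ j + ∑ l, r₂ l ≤ r

lemma scalConj_ne_bot {d n : ℕ} {C : ProperCone ℝ (Vec n)} {f : Vec d → ExtVec n}
    (hf : VReg C f) (l : Vec n) (y : Vec d) : scalConj C f l y ≠ ⊥ := by
  unfold scalConj
  split_ifs
  · refine conj_ne_bot ?_ y
    obtain ⟨x, hx⟩ := hf.1.2
    refine ⟨x, ?_⟩
    rw [hf.eq_fin hx]
    exact EReal.coe_lt_top _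
  · simp

lemma scalConj_le_coe_iff {d n : ℕ} {C : ProperCone ℝ (Vec n)} {f : Vec d → ExtVec n}
    {l : Vec n} {y : Vec d} {r : ℝ} : scalConj C f l y ≤ (r : EReal) ↔
      l ∈ dualCone C ∧ Minor (fun x => ExtVec.scal l (f x)) y r := by
  unfold scalConj
  split_ifs with h
  · simp [h, conj_le_coe_iff]
  · simp [h]

/-- No summand is `-∞`, so a finite bound on the sum makes every conjugate finite, and their values
serve as the individual bounds. -/
lemma apwLhs_le_iff (hD : D.Standing) {k : Fin D.nK} {i : Fin (D.nI k)} {x : D.ApwVar} {r : ℝ} :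
    D.apwLhs k i x ≤ (r : EReal) ↔ ApwEpi k i x r := by
  have hb0 : conj (fun z => - D.gc k i z) (x.y0 k i) ≠ ⊥ :=
    conj_ne_bot (hD.g_reg k i).proper.2 _
  have hb1 : ∀ j ∈ Finset.univ, scalConj (D.H j) (D.hc j k) (x.beta j) (x.y1 k i j) ≠ ⊥ :=
    fun j _ => scalConj_ne_bot (hD.h_vreg j k) _ _
  have hb2 : ∀ l ∈ Finset.univ, scalConj (D.C k l) (D.c k l) (x.nu k i l) (x.y2 k i l) ≠ ⊥ :=
    fun l _ => scalConj_ne_bot (hD.c_vreg k l) _ _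
  constructor
  · intro h
    have h1 : D.apwLhs k i x ≠ ⊤ := ne_top_of_le_ne_top (EReal.coe_ne_top r) h
    obtain ⟨h2, h3⟩ := ereal_add_ne_top
      (by rw [Ne, EReal.add_eq_bot_iff, not_or]; exact ⟨hb0, ereal_sum_ne_bot _ hb1⟩)
      (ereal_sum_ne_bot _ hb2) h1
    obtain ⟨h4, h5⟩ := ereal_add_ne_top hb0 (ereal_sum_ne_bot _ hb1) h2
    have h6 := ereal_sum_ne_top _ hb1 h5
    have h7 := ereal_sum_ne_top _ hb2 h3
    have e0 := EReal.coe_toReal h4 hb0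
    have e1 := fun j => EReal.coe_toReal (h6 j (Finset.mem_univ j)) (hb1 j (Finset.mem_univ j))
    have e2 := fun l => EReal.coe_toReal (h7 l (Finset.mem_univ l)) (hb2 l (Finset.mem_univ l))
    refine ⟨fun j => (scalConj_le_coe_iff.1 (e1 j).ge).1,
      fun l => (scalConj_le_coe_iff.1 (e2 l).ge).1, _, _, _, conj_le_coe_iff.1 e0.ge,
      fun j => (scalConj_le_coe_iff.1 (e1 j).ge).2,
      fun l => (scalConj_le_coe_iff.1 (e2 l).ge).2, ?_⟩
    rw [← EReal.coe_le_coe_iff]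
    simp only [EReal.coe_add, ereal_coe_sum, e0, e1, e2]
    exact h
  · rintro ⟨h1, h2, r₀, r₁, r₂, h3, h4, h5, h6⟩
    refine le_trans ?_ (EReal.coe_le_coe_iff.2 h6)
    simp only [EReal.coe_add, ereal_coe_sum]
    exact add_le_add (add_le_add (conj_le_coe_iff.2 h3) (Finset.sum_le_sum fun j _ =>
      scalConj_le_coe_iff.2 ⟨h1 j, h4 j⟩)) (Finset.sum_le_sum fun l _ =>
      scalConj_le_coe_iff.2 ⟨h2 l, h5 l⟩)

lemma apwLhs_ne_bot (hD : D.Standing) (k : Fin D.nK) (i : Fin (D.nI k)) (x : D.ApwVar) :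
    D.apwLhs k i x ≠ ⊥ := by
  have hb0 : conj (fun z => - D.gc k i z) (x.y0 k i) ≠ ⊥ :=
    conj_ne_bot (hD.g_reg k i).proper.2 _
  simp only [apwLhs, Ne, EReal.add_eq_bot_iff, not_or]
  exact ⟨⟨hb0, ereal_sum_ne_bot _ fun j _ => scalConj_ne_bot (hD.h_vreg j k) _ _⟩,
    ereal_sum_ne_bot _ fun l _ => scalConj_ne_bot (hD.c_vreg k l) _ _⟩

/-! ### Values on the effective support -/

lemma nonempty_I (hD : D.Standing) (k) : Nonempty (Fin (D.nI k)) := ⟨⟨0, hD.nI_pos k⟩⟩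

lemma gc_le_g (hD : D.Standing) {k : Fin D.nK} (i : Fin (D.nI k)) {z : Vec D.d} (hz : z ∈ D.S k) :
    D.gc k i z ≤ D.g z := by
  rw [hD.g_eq k z hz]
  exact le_iSup (fun i => D.gc k i z) i

lemma exists_g_eq (hD : D.Standing) {k : Fin D.nK} {z : Vec D.d} (hz : z ∈ D.S k) :
    ∃ i, D.g z = D.gc k i z := by
  have := nonempty_I hD k
  obtain ⟨i, hi⟩ := exists_eq_ciSup_of_finite (f := fun i => D.gc k i z)
  exact ⟨i, by rw [hD.g_eq k z hz, ← hi]⟩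

lemma mem_SbarU_iff (hD : D.Standing) {k : Fin D.nK} {z : Vec D.d} :
    z ∈ D.SbarU k ↔ z ∈ D.S k ∧ (∀ j, z ∈ domV (D.hc j k)) ∧ D.g z ≠ ⊥ := by
  unfold SbarU
  rw [mem_iUnion]
  constructor
  · rintro ⟨i, h1, h2, h3⟩
    refine ⟨h1, h2, ?_⟩
    have h4 : - D.gc k i z < ⊤ := h3
    intro h5
    have h6 := gc_le_g hD i h1
    rw [h5, le_bot_iff] at h6
    simp [h6] at h4
  · rintro ⟨h1, h2, h3⟩
    obtain ⟨i, hi⟩ := exists_g_eq hD h1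
    refine ⟨i, h1, h2, ?_⟩
    show - D.gc k i z < ⊤
    rw [← hi, lt_top_iff_ne_top]
    simpa using h3

lemma g_ne_top (hD : D.Standing) {k : Fin D.nK} {z : Vec D.d} (hz : z ∈ D.S k) : D.g z ≠ ⊤ := by
  obtain ⟨i, hi⟩ := exists_g_eq hD hz
  rw [hi]
  intro h
  have := (hD.g_reg k i).proper.1 z
  simp [h] at this

lemma coe_toReal_g (hD : D.Standing) {k : Fin D.nK} {z : Vec D.d} (hz : z ∈ D.SbarU k) :
    (((D.g z).toReal : ℝ) : EReal) = D.g z := by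
  have h := (mem_SbarU_iff hD).1 hz
  exact EReal.coe_toReal (g_ne_top hD h.1) h.2.2

lemma gc_toReal_le (hD : D.Standing) {k : Fin D.nK} {i : Fin (D.nI k)} {z : Vec D.d}
    (hz : z ∈ D.Sbar k i) : (D.gc k i z).toReal ≤ (D.g z).toReal := by
  have h1 := gc_le_g hD i hz.1
  rw [← coe_toReal_g hD (mem_iUnion.2 ⟨i, hz⟩), ← coe_toReal_of_mem_domR (hD.g_reg k i) hz.2.2,
    EReal.coe_le_coe_iff] at h1
  exact h1

lemma exists_mem_Sbar (hD : D.Standing) {k : Fin D.nK} {z : Vec D.d} (hz : z ∈ D.SbarU k) :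
    ∃ i, z ∈ D.Sbar k i ∧ D.g z = D.gc k i z := by
  have h := (mem_SbarU_iff hD).1 hz
  obtain ⟨i, hi⟩ := exists_g_eq hD h.1
  refine ⟨i, ⟨h.1, h.2.1, ?_⟩, hi⟩
  show - D.gc k i z < ⊤
  rw [← hi, lt_top_iff_ne_top]
  simpa using h.2.2

lemma neg_c_mem (hD : D.Standing) {k : Fin D.nK} {z : Vec D.d} (hz : z ∈ D.S k)
    (l : Fin (D.nL k)) : z ∈ domV (D.c k l) ∧ - (D.c k l z).toVec ∈ D.C k l := by
  have := (hD.c_vreg k l).le_fin_iff.1 (hz l)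
  simpa using this

lemma mem_duqFeas_iff (hD : D.Standing) {x : D.DuqVar} : x ∈ D.duqFeas ↔
    (∀ k, ∀ z ∈ D.SbarU k,
      (D.g z).toReal - x.1 k - ∑ j, inner ℝ (x.2 j) (D.hc j k z).toVec ≤ 0) ∧
    ∀ j, x.2 j ∈ dualCone (D.H j) := by
  refine and_congr_left fun _ => forall_congr' fun k => ?_
  rw [iSup₂_le_iff]
  refine forall₂_congr fun z hz => ?_
  have h := (mem_SbarU_iff hD).1 hz
  have h1 : ∀ j, ExtVec.scal (x.2 j) (D.hc j k z)
      = ((inner ℝ (x.2 j) (D.hc j k z).toVec : ℝ) : EReal) := fun j => by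
    conv_lhs => rw [(hD.h_vreg j k).eq_fin (h.2.1 j)]
    rfl
  simp only [h1]
  rw [← ereal_coe_sum, ← coe_toReal_g hD hz, ← EReal.coe_sub, ← EReal.coe_sub]
  simp only [EReal.toReal_coe]
  exact_mod_cast Iff.rfl

/-- Weak duality between the reformulated worst-case problem and the dual problem. -/
lemma mem_duqFeas_of_apwFeas (hD : D.Standing) {x : D.ApwVar} (hx : x ∈ D.apwFeas) :
    ((x.alpha, x.beta) : D.DuqVar) ∈ D.duqFeas := by
  obtain ⟨h1, h2, h3, h4⟩ := hx
  refine (mem_duqFeas_iff hD).2 ⟨fun k z hz => ?_, h3⟩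
  -- Only the index attaining the maximum at `z` is used. Adding the Fenchel–Young inequalities of
  -- its constraint cancels the `y` terms, and the `c` terms are nonpositive on `S_k`.
  obtain ⟨i, hzi, hgi⟩ := exists_mem_Sbar hD hz
  obtain ⟨-, -, r₀, r₁, r₂, m0, m1, m2, hr⟩ := (apwLhs_le_iff hD).1 (h1 k i)
  have e0 := (minor_neg_iff (hD.g_reg k i)).1 m0 z hzi.2.2
  have e1 : ∑ j, ((inner ℝ z (x.y1 k i j) : ℝ) - r₁ j)
      ≤ ∑ j, inner ℝ (x.beta j) (D.hc j k z).toVec := Finset.sum_le_sum fun j _ =>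
    (hD.h_vreg j k).minor_scal_iff.1 (m1 j) z (hzi.2.1 j)
  have e2 : ∑ l, ((inner ℝ z (x.y2 k i l) : ℝ) - r₂ l) ≤ 0 := Finset.sum_nonpos fun l _ => by
    obtain ⟨h5, h6⟩ := neg_c_mem hD hzi.1 l
    have h7 := (hD.c_vreg k l).minor_scal_iff.1 (m2 l) z h5
    have h8 := dualCone_inner_nonneg (h4 k i l) h6
    rw [inner_neg_right] at h8
    linarith
  have e3 := congrArg (fun y => (inner ℝ z y : ℝ)) (h2 k i)
  simp only [inner_add_right, inner_sum, inner_zero_right] at e3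
  rw [Finset.sum_sub_distrib] at e1 e2
  rw [hgi]
  show _ - x.alpha k - ∑ j, inner ℝ (x.beta j) _ ≤ 0
  linarith

end Data

/-! ### Expectations with infinite parts -/

section Expectations

variable {Ω : Type} [MeasurableSpace Ω] {P : Measure Ω} {f : Ω → EReal} {φ : Ω → ℝ}

lemma lintegral_parts_eq (hf : f =ᵐ[P] fun z => (φ z : EReal)) :
    (∫⁻ z, (f z).toENNReal ∂P) = (∫⁻ z, ENNReal.ofReal (φ z) ∂P) ∧
      (∫⁻ z, (- f z).toENNReal ∂P) = ∫⁻ z, ENNReal.ofReal (- φ z) ∂P := by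
  constructor
  · refine lintegral_congr_ae ?_
    filter_upwards [hf] with z hz
    rw [hz, EReal.real_coe_toENNReal]
  · refine lintegral_congr_ae ?_
    filter_upwards [hf] with z hz
    rw [hz, ← EReal.coe_neg, EReal.real_coe_toENNReal]

lemma exp_eq_integral (hφ : Integrable φ P) (hf : f =ᵐ[P] fun z => (φ z : EReal)) :
    expLow P f = ((∫ z, φ z ∂P : ℝ) : EReal) ∧ expUp P f = ((∫ z, φ z ∂P : ℝ) : EReal) := by
  obtain ⟨h1, h2⟩ := lintegral_parts_eq hf
  have h3 : (∫⁻ z, ENNReal.ofReal (φ z) ∂P) ≠ ⊤ := hφ.lintegral_lt_top.ne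
  have h4 : (∫⁻ z, ENNReal.ofReal (- φ z) ∂P) ≠ ⊤ := hφ.neg.lintegral_lt_top.ne
  have h5 := integral_eq_lintegral_pos_part_sub_lintegral_neg_part hφ
  unfold expLow expUp
  rw [h1, h2, if_neg (fun h => h3 h.1), if_neg (fun h => h3 h.1), h5, EReal.coe_sub,
    EReal.coe_ennreal_toReal h3, EReal.coe_ennreal_toReal h4]
  exact ⟨rfl, rfl⟩

lemma integrable_posPart (hφ : AEMeasurable φ P) (h : (∫⁻ z, ENNReal.ofReal (φ z) ∂P) ≠ ⊤) :
    Integrable (fun z => max (φ z) 0) P := by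
  refine ⟨(hφ.max aemeasurable_const).aestronglyMeasurable, ?_⟩
  have h0 : 0 ≤ᵐ[P] fun z => max (φ z) 0 := Filter.Eventually.of_forall fun z => le_max_right _ _
  rw [hasFiniteIntegral_iff_ofReal h0]
  have h1 : ∀ z, ENNReal.ofReal (max (φ z) 0) = ENNReal.ofReal (φ z) := fun z => by
    rw [ENNReal.ofReal_max]
    simp
  simp only [h1]
  exact lt_top_iff_ne_top.2 h

/-- The convention `∞ - ∞ = +∞` makes a real upper bound control the positive part. -/
lemma lintegral_ne_top_of_expUp_le {c : ℝ} (h : expUp P f ≤ (c : EReal)) :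
    (∫⁻ z, (f z).toENNReal ∂P) ≠ ⊤ := by
  intro h1
  unfold expUp at h
  split_ifs at h with h2
  · simp at h
  · rw [h1] at h
    have h3 : (∫⁻ z, (- f z).toENNReal ∂P) ≠ ⊤ := fun h3 => h2 ⟨h1, h3⟩
    lift (∫⁻ z, (- f z).toENNReal ∂P) to NNReal using h3 with b
    rw [EReal.coe_ennreal_top] at h
    have h4 : (⊤ : EReal) - ((b : ENNReal) : EReal) = ⊤ := EReal.top_sub_coe (b : ℝ)
    rw [h4] at h
    simp at h

/-- Here the convention is `-∞`, so any other value of the expectation controls the negative part.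
-/
lemma lintegral_ne_top_of_expLow_ne_bot (h : expLow P f ≠ ⊥) :
    (∫⁻ z, (- f z).toENNReal ∂P) ≠ ⊤ := by
  intro h1
  unfold expLow at h
  split_ifs at h with h2
  · exact h rfl
  · rw [h1] at h
    have h3 : (∫⁻ z, (f z).toENNReal ∂P) ≠ ⊤ := fun h3 => h2 ⟨h3, h1⟩
    lift (∫⁻ z, (f z).toENNReal ∂P) to NNReal using h3 with b
    rw [EReal.coe_ennreal_top] at h
    exact h (EReal.sub_top _)

end Expectations

namespace Data

variable {D : Data}

/-! ### Discrete distributions -/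

/-- The discrete measure that assigns mass `λ_{ik}` to the point `z_{ik}`. -/
def disc (D : Data) (lam : (k : Fin D.nK) → Fin (D.nI k) → ℝ)
    (z : (k : Fin D.nK) → Fin (D.nI k) → Vec D.d) : Measure (Vec D.d) :=
  ∑ k, ∑ i, ENNReal.ofReal (lam k i) • Measure.dirac (z k i)

lemma recovered_eq_disc (x : D.AdbVar) :
    D.recovered x = D.disc x.lam fun k i => (x.lam k i)⁻¹ • x.v k i := by
  unfold recovered disc
  refine Finset.sum_congr rfl fun k _ => Finset.sum_congr rfl fun i _ => ?_
  split_ifs with h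
  · rfl
  · rw [ENNReal.ofReal_of_nonpos (not_lt.1 h), zero_smul]

variable {lam : (k : Fin D.nK) → Fin (D.nI k) → ℝ}
  {z : (k : Fin D.nK) → Fin (D.nI k) → Vec D.d}

lemma disc_apply (s : Set (Vec D.d)) : D.disc lam z s
    = ∑ k, ∑ i, ENNReal.ofReal (lam k i) * s.indicator 1 (z k i) := by
  simp only [disc, Measure.coe_finsetSum, Finset.sum_apply, Measure.smul_apply,
    Measure.dirac_apply, smul_eq_mul]

lemma disc_null {s : Set (Vec D.d)} (h : ∀ k i, 0 < lam k i → z k i ∉ s) :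
    D.disc lam z s = 0 := by
  rw [disc_apply]
  refine Finset.sum_eq_zero fun k _ => Finset.sum_eq_zero fun i _ => ?_
  by_cases hl : 0 < lam k i
  · rw [indicator_of_notMem (h k i hl), mul_zero]
  · rw [ENNReal.ofReal_of_nonpos (not_lt.1 hl), zero_mul]

lemma integrable_disc (φ : Vec D.d → ℝ) : Integrable φ (D.disc lam z) := by
  unfold disc
  refine integrable_finsetSum_measure.2 fun k _ => integrable_finsetSum_measure.2 fun i _ => ?_
  exact (integrable_dirac (by simp)).smul_measure ENNReal.ofReal_ne_top

lemma integral_disc (hlam : ∀ k i, 0 ≤ lam k i) (φ : Vec D.d → ℝ) :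
    ∫ x, φ x ∂(D.disc lam z) = ∑ k, ∑ i, lam k i * φ (z k i) := by
  have hint : ∀ k i, Integrable φ (ENNReal.ofReal (lam k i) • Measure.dirac (z k i)) :=
    fun k i => (integrable_dirac (by simp)).smul_measure ENNReal.ofReal_ne_top
  unfold disc
  rw [integral_finsetSum_measure fun k _ => integrable_finsetSum_measure.2 fun i _ => hint k i]
  refine Finset.sum_congr rfl fun k _ => ?_
  rw [integral_finsetSum_measure fun i _ => hint k i]
  refine Finset.sum_congr rfl fun i _ => ?_
  rw [integral_smul_measure, integral_dirac, ENNReal.toReal_ofReal (hlam k i), smul_eq_mul]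

lemma exp_disc (hlam : ∀ k i, 0 ≤ lam k i) {f : Vec D.d → EReal}
    (hf : ∀ k i, 0 < lam k i → (((f (z k i)).toReal : ℝ) : EReal) = f (z k i)) :
    expLow (D.disc lam z) f = ((∑ k, ∑ i, lam k i * (f (z k i)).toReal : ℝ) : EReal) ∧
      expUp (D.disc lam z) f = ((∑ k, ∑ i, lam k i * (f (z k i)).toReal : ℝ) : EReal) := by
  rw [← integral_disc hlam fun x => (f x).toReal]
  refine exp_eq_integral (integrable_disc _) ?_
  refine disc_null fun k i hl h => h ?_
  exact (hf k i hl).symm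

/-- Atoms of weight zero may lie anywhere, so this applies both to points of (FR) and to the
recovered distribution, where `v/λ` is meaningless for `λ = 0`. -/
lemma disc_mem_puqFeas (hD : D.Standing) (hlam : ∀ k i, 0 ≤ lam k i)
    (hsum : ∀ k, ∑ i, lam k i = D.p k) (hz : ∀ k i, 0 < lam k i → z k i ∈ D.SbarU k)
    (hmom : ∀ j, D.mu j - ∑ k, ∑ i, lam k i • (D.h j (z k i)).toVec ∈ D.H j) :
    D.disc lam z ∈ D.puqFeas ∧
      D.puqObj (D.disc lam z) = ((∑ k, ∑ i, lam k i * (D.g (z k i)).toReal : ℝ) : EReal) := by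
  have hobj : D.puqObj (D.disc lam z)
      = ((∑ k, ∑ i, lam k i * (D.g (z k i)).toReal : ℝ) : EReal) :=
    (exp_disc hlam fun k i hl => coe_toReal_g hD (hz k i hl)).1
  have hS : ∀ k i, 0 < lam k i → z k i ∈ D.S k := fun k i hl => ((mem_SbarU_iff hD).1 (hz k i hl)).1
  refine ⟨⟨⟨⟨?_⟩, ?_, ?_, ?_⟩, ?_⟩, hobj⟩
  · rw [disc_apply]
    simp only [indicator_univ, Pi.one_apply, mul_one]
    have h1 : ∀ k, ∑ i, ENNReal.ofReal (lam k i) = ENNReal.ofReal (D.p k) := fun k => by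
      rw [← hsum k, ENNReal.ofReal_sum_of_nonneg fun i _ => hlam k i]
    rw [Finset.sum_congr rfl fun k _ => h1 k,
      ← ENNReal.ofReal_sum_of_nonneg fun k _ => (hD.p_pos k).le, hD.p_sum, ENNReal.ofReal_one]
  · exact disc_null fun k i hl h => h (mem_iUnion.2 ⟨k, hS k i hl⟩)
  · intro k
    rw [disc_apply, Finset.sum_eq_single k]
    · rw [← hsum k, ENNReal.ofReal_sum_of_nonneg fun i _ => hlam k i]
      refine Finset.sum_congr rfl fun i _ => ?_
      rcases (hlam k i).lt_or_eq with hl | hl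
      · rw [indicator_of_mem (hS k i hl), Pi.one_apply, mul_one]
      · simp [← hl]
    · intro k' _ hk
      refine Finset.sum_eq_zero fun i _ => ?_
      rcases (hlam k' i).lt_or_eq with hl | hl
      · rw [indicator_of_notMem, mul_zero]
        exact fun h => (disjoint_left.1 (hD.S_disjoint k' k hk)) (hS k' i hl) h
      · simp [← hl]
    · simp
  · intro j l hl h0
    have hfin : ∀ k i, 0 < lam k i → ExtVec.scal l (D.h j (z k i))
        = ((inner ℝ l (D.h j (z k i)).toVec : ℝ) : EReal) := fun k i hp => by
      rw [hD.h_eq j k _ (hS k i hp)]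
      conv_lhs => rw [(hD.h_vreg j k).eq_fin (((mem_SbarU_iff hD).1 (hz k i hp)).2.1 j)]
      rfl
    rw [(exp_disc hlam fun k i hp => by rw [hfin k i hp, EReal.toReal_coe]).2,
      EReal.coe_le_coe_iff]
    have h1 := dualCone_inner_nonneg hl (hmom j)
    simp only [inner_sub_right, inner_sum, inner_smul_right] at h1
    have h2 : ∑ k, ∑ i, lam k i * (ExtVec.scal l (D.h j (z k i))).toReal
        = ∑ k, ∑ i, lam k i * inner ℝ l (D.h j (z k i)).toVec := by
      refine Finset.sum_congr rfl fun k _ => Finset.sum_congr rfl fun i _ => ?_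
      rcases (hlam k i).lt_or_eq with hp | hp
      · rw [hfin k i hp, EReal.toReal_coe]
      · simp [← hp]
    rw [h2]
    linarith
  · rw [hobj]
    exact EReal.coe_ne_bot _

/-- Every feasible point of the finite reduction gives a discrete distribution. -/
lemma frVal_le_puqVal (hD : D.Standing) :
    supVal D.frFeas D.frObj ≤ supVal D.puqFeas D.puqObj := by
  refine iSup₂_le fun x hx => ?_
  obtain ⟨h1, h2, h3, h4⟩ := hx
  obtain ⟨h5, h6⟩ := disc_mem_puqFeas hD h4 h1 (fun k i _ => h3 k i) h2
  refine le_iSup₂_of_le _ h5 ?_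
  rw [h6, frObj]
  simp only [ereal_coe_sum, EReal.coe_mul]
  refine Finset.sum_le_sum fun k _ => Finset.sum_le_sum fun i _ => ?_
  rw [coe_toReal_g hD (h3 k i)]

/-! ### Weak duality for the uncertainty quantification problem -/

/-- An intersection of sublevel sets of lower semicontinuous scalarizations. It supplies the
measurability of the pieces. -/
lemma isClosed_S (hD : D.Standing) (k : Fin D.nK) : IsClosed (D.S k) := by
  have h : D.S k = ⋂ l, ⋂ w ∈ dualCone (D.C k l), ⋂ _ : w ≠ 0,
      {z | ExtVec.scal w (D.c k l z) ≤ 0} := by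
    ext z
    simp only [S, mem_ofPred_eq, mem_iInter]
    refine forall_congr' fun l => ?_
    rw [(hD.c_vreg k l).le_fin_iff_scal (hD.dC_pos k l) (hD.C_proper k l)]
    simp
  rw [h]
  refine isClosed_iInter fun l => isClosed_biInter fun w hw => isClosed_iInter fun h0 => ?_
  exact ((hD.c_vreg k l).reg_scal hw h0).lsc.isClosed_preimage 0

/-- Outside the union of the `S_k` the functions `g` and `h_j` are arbitrary, so only almost
everywhere measurability is available. -/
lemma aemeasurable_of_S (hD : D.Standing) {P : Measure (Vec D.d)} (hP : P (⋃ k, D.S k)ᶜ = 0)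
    {f : Vec D.d → EReal} {fk : Fin D.nK → Vec D.d → EReal} (hfk : ∀ k, Measurable (fk k))
    (hf : ∀ k, ∀ z ∈ D.S k, f z = fk k z) : AEMeasurable f P := by
  rw [← Measure.restrict_eq_self_of_ae_mem (s := ⋃ k, D.S k) (μ := P) hP, aemeasurable_iUnion_iff]
  intro k
  refine (hfk k).aemeasurable.congr ?_
  filter_upwards [ae_restrict_mem (isClosed_S hD k).measurableSet] with z hz
  exact (hf k z hz).symm

lemma measurable_gc (hD : D.Standing) (k) (i) : Measurable (D.gc k i) := by
  have h : Measurable fun z => - - D.gc k i z := (hD.g_reg k i).lsc.measurable.neg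
  simpa using h

/-- Integrating the dual constraint requires integrability, which the hypotheses give only on one
side: for the negative part of `g` and the positive parts of the scalarized moments. The pointwise
inequality between them supplies the other side. -/
lemma puqObj_le_duqObj (hD : D.Standing) {P : Measure (Vec D.d)} (hP : P ∈ D.puqFeas)
    {x : D.DuqVar} (hx : x ∈ D.duqFeas) : D.puqObj P ≤ D.duqObj x := by
  obtain ⟨⟨hprob, hsupp, hmass, hmom⟩, hbot⟩ := hP
  obtain ⟨hx1, hx2⟩ := (mem_duqFeas_iff hD).1 hx
  have hscal : ∀ j, ∀ l ∈ dualCone (D.H j), l ≠ 0 →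
      AEMeasurable (fun z => ExtVec.scal l (D.h j z)) P := fun j l hl h0 =>
    aemeasurable_of_S hD hsupp
      (fun k => ((hD.h_vreg j k).reg_scal hl h0).lsc.measurable)
      (fun k z hz => by rw [hD.h_eq j k z hz])
  have hgm : AEMeasurable D.g P := aemeasurable_of_S hD hsupp
    (fun k => Measurable.iSup fun i => measurable_gc hD k i) (fun k z hz => hD.g_eq k z hz)
  have hneg := lintegral_ne_top_of_expLow_ne_bot hbot
  -- The finite parts exclude `g = -∞` and `h_j = +∞_C` almost everywhere, so the dual constraint,
  -- imposed only on the effective support, holds almost everywhere.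
  have hae : ∀ᵐ z ∂P, ∃ k, z ∈ D.SbarU k := by
    have h1 : ∀ᵐ z ∂P, z ∈ ⋃ k, D.S k := hsupp
    have h2 : ∀ᵐ z ∂P, D.g z ≠ ⊥ := by
      have h3 : AEMeasurable (fun z => (- D.g z).toENNReal) P := hgm.neg.ereal_toENNReal
      filter_upwards [ae_lt_top' h3 hneg] with z hz
      rw [lt_top_iff_ne_top, EReal.toENNReal_ne_top_iff] at hz
      simpa using hz
    have h4 : ∀ᵐ z ∂P, ∀ j, D.h j z ≠ .posInf := by
      rw [ae_all_iff]
      intro j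
      obtain ⟨l, hl, h0⟩ := exists_dualCone_ne_zero (hD.dH_pos j) (hD.H_proper j)
      filter_upwards [ae_lt_top' (hscal j l hl h0).ereal_toENNReal
        (lintegral_ne_top_of_expUp_le (hmom j l hl h0))] with z hz
      rw [lt_top_iff_ne_top, EReal.toENNReal_ne_top_iff] at hz
      intro h
      simp [h, ExtVec.scal] at hz
    filter_upwards [h1, h2, h4] with z hz1 hz2 hz4
    obtain ⟨k, hk⟩ := mem_iUnion.1 hz1
    refine ⟨k, (mem_SbarU_iff hD).2 ⟨hk, fun j => ?_, hz2⟩⟩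
    have := hz4 j
    rwa [hD.h_eq j k z hk] at this
  let φ : Fin D.nJ → Vec D.d → ℝ := fun j z => inner ℝ (x.2 j) (D.h j z).toVec
  let G : Vec D.d → ℝ := fun z => (D.g z).toReal
  let a : Vec D.d → ℝ := fun z => ∑ k, (D.S k).indicator (fun _ => x.1 k) z
  have hG : D.g =ᵐ[P] fun z => (G z : EReal) := by
    filter_upwards [hae] with z ⟨k, hk⟩
    exact (coe_toReal_g hD hk).symm
  have hφ : ∀ j, (fun z => ExtVec.scal (x.2 j) (D.h j z)) =ᵐ[P] fun z => (φ j z : EReal) := by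
    intro j
    filter_upwards [hae] with z ⟨k, hk⟩
    have h := (mem_SbarU_iff hD).1 hk
    simp only [φ]
    rw [hD.h_eq j k z h.1]
    conv_lhs => rw [(hD.h_vreg j k).eq_fin (h.2.1 j)]
    rfl
  have hle : ∀ᵐ z ∂P, G z ≤ a z + ∑ j, φ j z := by
    filter_upwards [hae] with z ⟨k, hk⟩
    have h := (mem_SbarU_iff hD).1 hk
    have h1 := hx1 k z hk
    have h2 : a z = x.1 k := by
      simp only [a]
      rw [Finset.sum_eq_single k, indicator_of_mem h.1]
      · intro k' _ hne
        exact indicator_of_notMem (disjoint_left.1 (hD.S_disjoint k k' hne.symm) h.1) _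
      · simp
    simp only [φ, G, h2, fun j => hD.h_eq j k z h.1]
    linarith
  have haint : Integrable a P := by
    refine integrable_finsetSum _ fun k _ => ?_
    exact (integrable_const _).indicator (isClosed_S hD k).measurableSet
  have haval : ∫ z, a z ∂P = ∑ k, D.p k * x.1 k := by
    simp only [a]
    rw [integral_finsetSum _ fun k _ =>
      (integrable_const _).indicator (isClosed_S hD k).measurableSet]
    refine Finset.sum_congr rfl fun k _ => ?_
    rw [integral_indicator_const _ (isClosed_S hD k).measurableSet, Measure.real, hmass k,
      ENNReal.toReal_ofReal (hD.p_pos k).le, smul_eq_mul]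
  have hGm : AEMeasurable G P := hgm.ereal_toReal
  have hφm : ∀ j, AEMeasurable (φ j) P := by
    intro j
    rcases eq_or_ne (x.2 j) 0 with h0 | h0
    · simp only [φ, h0, inner_zero_left]
      exact aemeasurable_const
    · refine (hscal j _ (hx2 j) h0).ereal_toReal.congr ?_
      filter_upwards [hφ j] with z hz
      rw [hz, EReal.toReal_coe]
  have hu : ∀ j, Integrable (fun z => max (φ j z) 0) P := by
    intro j
    refine integrable_posPart (hφm j) ?_
    -- The moment condition does not cover the zero functional, for which `φ j` vanishes.
    rcases eq_or_ne (x.2 j) 0 with h0 | h0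
    · simp [φ, h0]
    · rw [← (lintegral_parts_eq (hφ j)).1]
      exact lintegral_ne_top_of_expUp_le (hmom j _ (hx2 j) h0)
  have hGneg : Integrable (fun z => max (- G z) 0) P :=
    integrable_posPart hGm.neg (by rw [← (lintegral_parts_eq hG).2]; exact hneg)
  -- A common integrable bound for `|G|` and all `|φ j|`. The inequality `hle` bounds `G` from above
  -- and, solved for `φ j`, bounds `φ j` from below.
  let B : Vec D.d → ℝ := fun z => max (- G z) 0 + |a z| + ∑ j, max (φ j z) 0
  have hB : Integrable B P := (hGneg.add haint.abs).add (integrable_finsetSum _ fun j _ => hu j)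
  have hunn : ∀ z, 0 ≤ ∑ j, max (φ j z) 0 := fun z =>
    Finset.sum_nonneg fun j _ => le_max_right _ _
  have hsumle : ∀ z, ∑ j, φ j z ≤ ∑ j, max (φ j z) 0 := fun z =>
    Finset.sum_le_sum fun j _ => le_max_left _ _
  have hGint : Integrable G P := by
    refine hB.mono' hGm.aestronglyMeasurable ?_
    filter_upwards [hle] with z hz
    have h1 := le_max_left (- G z) 0
    have h2 := le_max_right (- G z) 0
    have h3 := le_abs_self (a z)
    have h4 := hunn z
    have h5 := hsumle z
    have h6 := abs_nonneg (a z)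
    rw [Real.norm_eq_abs, abs_le]
    constructor <;> simp only [B] <;> linarith
  have hφint : ∀ j, Integrable (φ j) P := by
    intro j
    refine hB.mono' (hφm j).aestronglyMeasurable ?_
    filter_upwards [hle] with z hz
    have h1 := le_max_left (- G z) 0
    have h2 := le_max_right (- G z) 0
    have h3 := le_abs_self (a z)
    have h6 := abs_nonneg (a z)
    have h7 : φ j z ≤ ∑ j, max (φ j z) 0 := (le_max_left _ _).trans
      (Finset.single_le_sum (f := fun j => max (φ j z) 0) (fun j _ => le_max_right _ _)
        (Finset.mem_univ j))
    have h8 : ∑ i ∈ Finset.univ.erase j, φ i z ≤ ∑ i, max (φ i z) 0 := by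
      refine (Finset.sum_le_sum fun i _ => le_max_left (φ i z) 0).trans ?_
      exact Finset.sum_le_sum_of_subset_of_nonneg (Finset.erase_subset _ _)
        fun i _ _ => le_max_right _ _
    have h9 := Finset.add_sum_erase Finset.univ (fun i => φ i z) (Finset.mem_univ j)
    rw [Real.norm_eq_abs, abs_le]
    constructor <;> simp only [B] <;> linarith
  rw [puqObj, (exp_eq_integral hGint hG).1, duqObj, EReal.coe_le_coe_iff]
  have h1 : ∫ z, G z ∂P ≤ ∫ z, (a z + ∑ j, φ j z) ∂P :=
    integral_mono_ae hGint (haint.add (integrable_finsetSum _ fun j _ => hφint j)) hle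
  rw [integral_add haint (integrable_finsetSum _ fun j _ => hφint j),
    integral_finsetSum _ fun j _ => hφint j, haval] at h1
  refine h1.trans (add_le_add le_rfl (Finset.sum_le_sum fun j _ => ?_))
  rcases eq_or_ne (x.2 j) 0 with h0 | h0
  · simp [φ, h0]
  · have h2 := hmom j _ (hx2 j) h0
    rw [(exp_eq_integral (hφint j) (hφ j)).2, EReal.coe_le_coe_iff] at h2
    rwa [real_inner_comm] at h2

lemma puqVal_le_duqVal (hD : D.Standing) :
    supVal D.puqFeas D.puqObj ≤ infVal D.duqFeas D.duqObj :=
  iSup₂_le fun _ hP => le_iInf₂ fun _ hx => puqObj_le_duqObj hD hP hx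

lemma duqVal_le_apwVal (hD : D.Standing) :
    infVal D.duqFeas D.duqObj ≤ infVal D.apwFeas D.apwObj :=
  le_iInf₂ fun _ hx => iInf₂_le_of_le _ (mem_duqFeas_of_apwFeas hD hx) le_rfl

end Data

namespace Data

variable {D : Data}

/-! ### From the reformulated best problem to the finite reduction -/

lemma adb_pos (hD : D.Standing) {x : D.AdbVar} (hx : x ∈ D.adbFeas) {k : Fin D.nK}
    {i : Fin (D.nI k)} (hl : 0 < x.lam k i) :
    (x.lam k i)⁻¹ • x.v k i ∈ D.Sbar k i ∧
      (∀ j, x.omega k i j - x.lam k i • (D.hc j k ((x.lam k i)⁻¹ • x.v k i)).toVec ∈ D.H j) ∧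
      x.tau k i ≤ x.lam k i * (D.gc k i ((x.lam k i)⁻¹ • x.v k i)).toReal := by
  obtain ⟨-, -, h3, h4, h5, -⟩ := hx
  have h6 := fun j => ((hD.h_vreg j k).persp_le_iff_of_pos hl).1 (h4 k i j)
  have h7 := (le_concPersp_iff_of_pos (hD.g_reg k i) hl).1 (h5 k i)
  exact ⟨⟨fun l => ((hD.c_vreg k l).persp_le_zero_iff_of_pos hl).1 (h3 k i l),
    fun j => (h6 j).1, h7.1⟩, fun j => (h6 j).2, h7.2⟩

/-- All perspectives vanish at `(0, 0)`. Any affine minorant shows this: at `v = 0` and `λ = 0` its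
inequality reads `0 ≤ lᵀω`, respectively `0 ≤ -τ`. -/
lemma adb_zero (hD : D.Standing) {x : D.AdbVar} (hx : x ∈ D.adbFeas) {k : Fin D.nK}
    {i : Fin (D.nI k)} (hl : x.lam k i = 0) (hv : x.v k i = 0) :
    (∀ j, x.omega k i j ∈ D.H j) ∧ x.tau k i ≤ 0 := by
  obtain ⟨-, -, -, h4, h5, h6⟩ := hx
  constructor
  · intro j
    have h7 := (hD.h_vreg j k).perspEpi_of_persp_le (h6 k i) (h4 k i j)
    rw [hl, hv] at h7
    refine mem_iff_forall_dualCone.2 fun l hl h0 => ?_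
    obtain ⟨w, r, hw⟩ := ((hD.h_vreg j k).reg_scal hl h0).exists_minor
    simpa using h7 l hl h0 w r hw
  · have h7 := perspHypo_of_le_concPersp (hD.g_reg k i) (h6 k i) (h5 k i)
    rw [hl, hv] at h7
    obtain ⟨w, r, hw⟩ := (hD.g_reg k i).exists_minor
    have h8 := h7 w r hw
    simp only [inner_zero_left] at h8
    linarith

lemma adb_moment (hD : D.Standing) {x : D.AdbVar} (hx : x ∈ D.adbFeas)
    (h0 : ∀ k i, x.lam k i = 0 → x.v k i = 0)
    {z : (k : Fin D.nK) → Fin (D.nI k) → Vec D.d}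
    (hz : ∀ k i, 0 < x.lam k i → z k i = (x.lam k i)⁻¹ • x.v k i) (j : Fin D.nJ) :
    D.mu j - ∑ k, ∑ i, x.lam k i • (D.h j (z k i)).toVec ∈ D.H j := by
  have h1 : D.mu j - ∑ k, ∑ i, x.omega k i j ∈ D.H j := hx.2.1 j
  have h2 : ∑ k, ∑ i, (x.omega k i j - x.lam k i • (D.h j (z k i)).toVec) ∈ D.H j := by
    refine Submodule.sum_mem _ fun k _ => Submodule.sum_mem _ fun i _ => ?_
    rcases (hx.2.2.2.2.2 k i).lt_or_eq with hl | hl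
    · have h3 := adb_pos hD hx hl
      rw [hz k i hl, hD.h_eq j k _ h3.1.1]
      exact h3.2.1 j
    · have h3 := adb_zero hD hx hl.symm (h0 k i hl.symm)
      simpa [← hl] using h3.1 j
  have h3 := (D.H j).add_mem h1 h2
  simp only [Finset.sum_sub_distrib] at h3
  simpa using h3

lemma adb_value (hD : D.Standing) {x : D.AdbVar} (hx : x ∈ D.adbFeas)
    (h0 : ∀ k i, x.lam k i = 0 → x.v k i = 0)
    {z : (k : Fin D.nK) → Fin (D.nI k) → Vec D.d}
    (hz : ∀ k i, 0 < x.lam k i → z k i = (x.lam k i)⁻¹ • x.v k i) :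
    ∑ k, ∑ i, x.tau k i ≤ ∑ k, ∑ i, x.lam k i * (D.g (z k i)).toReal := by
  refine Finset.sum_le_sum fun k _ => Finset.sum_le_sum fun i _ => ?_
  rcases (hx.2.2.2.2.2 k i).lt_or_eq with hl | hl
  · have h3 := adb_pos hD hx hl
    rw [hz k i hl]
    exact h3.2.2.trans (mul_le_mul_of_nonneg_left (gc_toReal_le hD h3.1) hl.le)
  · have h3 := adb_zero hD hx hl.symm (h0 k i hl.symm)
    simpa [← hl] using h3.2

lemma adbObj_le_frVal (hD : D.Standing) {x : D.AdbVar} (hx : x ∈ D.adbFeas)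
    (h0 : ∀ k i, x.lam k i = 0 → x.v k i = 0) :
    D.adbObj x ≤ supVal D.frFeas D.frObj := by
  classical
  choose z₀ hz₀ using hD.Sbar_nonempty
  -- Blocks without weight still need an admissible point in (FR); any point of their nonempty
  -- effective support will do.
  let z : (k : Fin D.nK) → Fin (D.nI k) → Vec D.d := fun k i =>
    if 0 < x.lam k i then (x.lam k i)⁻¹ • x.v k i else z₀ k i
  have hz : ∀ k i, 0 < x.lam k i → z k i = (x.lam k i)⁻¹ • x.v k i := fun k i hl => if_pos hl
  have hmem : ∀ k i, z k i ∈ D.SbarU k := fun k i => by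
    refine mem_iUnion.2 ⟨i, ?_⟩
    by_cases hl : 0 < x.lam k i
    · rw [hz k i hl]
      exact (adb_pos hD hx hl).1
    · simp only [z, if_neg hl]
      exact hz₀ k i
  refine le_iSup₂_of_le ((x.lam, z) : D.FrVar)
    ⟨hx.1, fun j => adb_moment hD hx h0 hz j, hmem, hx.2.2.2.2.2⟩ ?_
  refine (EReal.coe_le_coe_iff.2 (adb_value hD hx h0 hz)).trans_eq ?_
  rw [frObj]
  simp only [ereal_coe_sum, EReal.coe_mul]
  refine Finset.sum_congr rfl fun k _ => Finset.sum_congr rfl fun i _ => ?_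
  rw [coe_toReal_g hD (hmem k i)]

lemma recovered_mem_puqFeas (hD : D.Standing) {x : D.AdbVar} (hx : x ∈ D.adbFeas)
    (h0 : ∀ k i, x.lam k i = 0 → x.v k i = 0) :
    D.recovered x ∈ D.puqFeas ∧ D.adbObj x ≤ D.puqObj (D.recovered x) := by
  have h1 := disc_mem_puqFeas (z := fun k i => (x.lam k i)⁻¹ • x.v k i) hD hx.2.2.2.2.2 hx.1
    (fun k i hl => mem_iUnion.2 ⟨i, (adb_pos hD hx hl).1⟩)
    (adb_moment hD hx h0 fun _ _ _ => rfl)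
  rw [recovered_eq_disc]
  refine ⟨h1.1, ?_⟩
  rw [h1.2]
  exact EReal.coe_le_coe_iff.2 (adb_value hD hx h0 fun _ _ _ => rfl)

/-- Moving a feasible point towards a feasible point with positive weights. -/
lemma adb_mix (hD : D.Standing) {x y : D.AdbVar} (hx : x ∈ D.adbFeas) (hy : y ∈ D.adbFeas)
    (hpos : ∀ k i, 0 < y.lam k i) {ε : ℝ} (h0 : 0 < ε) (h1 : ε < 1) :
    (1 - ε) • x + ε • y ∈ D.adbFeas ∧ ∀ k i, 0 < ((1 - ε) • x + ε • y : D.AdbVar).lam k i := by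
  have hε : 0 ≤ 1 - ε := by linarith
  obtain ⟨x1, x2, x3, x4, x5, x6⟩ := hx
  obtain ⟨y1, y2, y3, y4, y5, y6⟩ := hy
  have hlam : ∀ k i, 0 < ((1 - ε) • x + ε • y : D.AdbVar).lam k i := fun k i =>
    add_pos_of_nonneg_of_pos (mul_nonneg hε (x6 k i)) (mul_pos h0 (hpos k i))
  refine ⟨⟨fun k => ?_, fun j => ?_, fun k i l => ?_, fun k i j => ?_, fun k i => ?_,
    fun k i => (hlam k i).le⟩, hlam⟩
  · show ∑ i, ((1 - ε) * x.lam k i + ε * y.lam k i) = D.p k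
    rw [Finset.sum_add_distrib, ← Finset.mul_sum, ← Finset.mul_sum, x1, y1]
    ring
  · have e1 : D.mu j - ∑ k, ∑ i, x.omega k i j ∈ D.H j := x2 j
    have e2 : D.mu j - ∑ k, ∑ i, y.omega k i j ∈ D.H j := y2 j
    show D.mu j - ∑ k, ∑ i, ((1 - ε) • x.omega k i j + ε • y.omega k i j) ∈ D.H j
    have e3 := (D.H j).add_mem ((D.H j).smul_mem e1 hε) ((D.H j).smul_mem e2 h0.le)
    have e4 : D.mu j - ∑ k, ∑ i, ((1 - ε) • x.omega k i j + ε • y.omega k i j)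
        = (1 - ε) • (D.mu j - ∑ k, ∑ i, x.omega k i j)
          + ε • (D.mu j - ∑ k, ∑ i, y.omega k i j) := by
      simp only [Finset.sum_add_distrib, ← Finset.smul_sum]
      module
    rw [e4]
    exact e3
  -- The linear inequalities of `PerspEpi` survive mixing even if some weights of `x` vanish, and at
  -- the positive mixed weight they are equivalent to the perspective constraint.
  · refine (hD.c_vreg k l).persp_le_of_perspEpi (hD.dC_pos k l) (hD.C_proper k l) (hlam k i) ?_
    have := ((hD.c_vreg k l).perspEpi_of_persp_le (x6 k i) (x3 k i l)).combo
      ((hD.c_vreg k l).perspEpi_of_persp_le (y6 k i) (y3 k i l)) hε h0.le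
    rw [smul_zero, smul_zero, add_zero] at this
    exact this
  · refine (hD.h_vreg j k).persp_le_of_perspEpi (hD.dH_pos j) (hD.H_proper j) (hlam k i) ?_
    exact ((hD.h_vreg j k).perspEpi_of_persp_le (x6 k i) (x4 k i j)).combo
      ((hD.h_vreg j k).perspEpi_of_persp_le (y6 k i) (y4 k i j)) hε h0.le
  · refine le_concPersp_of_perspHypo (hD.g_reg k i) (hlam k i).le ?_
    exact (perspHypo_of_le_concPersp (hD.g_reg k i) (x6 k i) (x5 k i)).combo
      (perspHypo_of_le_concPersp (hD.g_reg k i) (y6 k i) (y5 k i)) hε h0.le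

/-- A feasible point with vanishing weights may have nonzero directions that no distribution
represents. Mixing in a fraction `ε` of `y` makes all weights positive, and the objective is
continuous as `ε → 0`. -/
lemma adbVal_le_frVal_of_pos (hD : D.Standing) {y : D.AdbVar} (hy : y ∈ D.adbFeas)
    (hpos : ∀ k i, 0 < y.lam k i) :
    supVal D.adbFeas D.adbObj ≤ supVal D.frFeas D.frObj := by
  refine iSup₂_le fun x hx => ?_
  have h1 : ∀ ε : ℝ, 0 < ε → ε < 1 →
      (((1 - ε) * ∑ k, ∑ i, x.tau k i + ε * ∑ k, ∑ i, y.tau k i : ℝ) : EReal)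
        ≤ supVal D.frFeas D.frObj := by
    intro ε h0 h1
    obtain ⟨h2, h3⟩ := adb_mix hD hx hy hpos h0 h1
    have h4 := adbObj_le_frVal hD h2 fun k i hl => absurd hl (h3 k i).ne'
    convert h4 using 1
    show _ = ((∑ k, ∑ i, ((1 - ε) * x.tau k i + ε * y.tau k i) : ℝ) : EReal)
    simp only [Finset.sum_add_distrib, Finset.mul_sum]
  have hcont : Continuous fun ε : ℝ =>
      (((1 - ε) * ∑ k, ∑ i, x.tau k i + ε * ∑ k, ∑ i, y.tau k i : ℝ) : EReal) :=
    continuous_coe_real_ereal.comp (by fun_prop)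
  have hlim := (hcont.tendsto 0).mono_left (nhdsWithin_le_nhds (s := Ioi (0 : ℝ)))
  have h2 := le_of_tendsto hlim (b := supVal D.frFeas D.frObj) (by
    filter_upwards [Ioo_mem_nhdsGT one_pos] with ε hε
    exact h1 ε hε.1 hε.2)
  simpa [adbObj] using h2

/-- For bounded support sets, vanishing weights force vanishing directions. -/
lemma adb_v_eq_zero (hD : D.Standing) (hb : ∀ k, Bornology.IsBounded (D.S k)) {k : Fin D.nK}
    {i : Fin (D.nI k)} {v : Vec D.d}
    (h : ∀ l, PerspEpi (D.C k l) (D.c k l) v 0 0) : v = 0 := by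
  obtain ⟨z, hz⟩ := hD.Sbar_nonempty k i
  by_contra hv
  obtain ⟨R, hR⟩ := (hb k).exists_norm_le
  have h1 : ∀ t : ℝ, 0 ≤ t → ‖z + t • v‖ ≤ R := fun t ht => hR _ fun l =>
    (hD.c_vreg k l).sublevel_add (hD.dC_pos k l) (hD.C_proper k l) (h l) (hz.1 l) ht
  have hpos : 0 < ‖v‖ := norm_pos_iff.2 hv
  -- This step has length `R + ‖z‖ + 1`, too long to remain in a ball of radius `R`.
  have h2 := h1 ((R + ‖z‖ + 1) / ‖v‖)
  have hR0 : 0 ≤ R := (norm_nonneg _).trans (hR z hz.1)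
  have hnn : 0 ≤ (R + ‖z‖ + 1) / ‖v‖ := by positivity
  have h3 := norm_sub_le (z + ((R + ‖z‖ + 1) / ‖v‖) • v) z
  rw [add_sub_cancel_left, norm_smul, Real.norm_of_nonneg hnn, div_mul_cancel₀ _ hpos.ne'] at h3
  linarith [h2 hnn]

lemma adb_v_eq_zero_of_lam (hD : D.Standing) (hb : ∀ k, Bornology.IsBounded (D.S k))
    {x : D.AdbVar} (hx : x ∈ D.adbFeas) (k : Fin D.nK) (i : Fin (D.nI k))
    (hl : x.lam k i = 0) : x.v k i = 0 := by
  refine adb_v_eq_zero (i := i) hD hb fun l => ?_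
  have := (hD.c_vreg k l).perspEpi_of_persp_le (hx.2.2.2.2.2 k i) (hx.2.2.1 k i l)
  rwa [hl] at this

/-- The five values form a cycle of inequalities. -/
lemma sameValue_of (hD : D.Standing) (h1 : infVal D.apwFeas D.apwObj ≤ supVal D.adbFeas D.adbObj)
    (h2 : supVal D.adbFeas D.adbObj ≤ supVal D.frFeas D.frObj) : D.SameValue := by
  have a1 := frVal_le_puqVal hD
  have a2 := puqVal_le_duqVal hD
  have a3 := duqVal_le_apwVal hD
  refine ⟨le_antisymm ?_ a3, le_antisymm ?_ a2, le_antisymm ?_ a1, le_antisymm ?_ h2⟩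
  · exact h1.trans (h2.trans (a1.trans a2))
  · exact a3.trans (h1.trans (h2.trans a1))
  · exact a2.trans (a3.trans (h1.trans h2))
  · exact a1.trans (a2.trans (a3.trans h1))

end Data

/-! ### Strong duality from a Slater point of (AP-W') -/

section Aux

lemma eq_zero_of_forall_nonneg {a b : ℝ} (h : ∀ c : ℝ, 0 ≤ c * a + b) : a = 0 := by
  by_contra ha
  have h1 := h (-(|b| + 1) / a)
  rw [div_mul_cancel₀ _ ha] at h1
  linarith [le_abs_self b]

lemma nonneg_of_forall_nonneg {a b : ℝ} (h : ∀ c : ℝ, 0 ≤ c → 0 ≤ c * a + b) : 0 ≤ a := by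
  by_contra ha
  push Not at ha
  have h1 := h ((|b| + 1) / (-a)) (div_nonneg (by positivity) (by linarith))
  have h2 : (|b| + 1) / (-a) * a = -(|b| + 1) := by
    have := ha.ne
    field_simp
  rw [h2] at h1
  linarith [le_abs_self b]

/-- Scalarization is linear in `l`, so the triples `(l, w, r)` are closed under conic combinations.
Joint convexity of `(lᵀf)*(w)` in `(l, w)` follows. -/
lemma Minor.combo_scal {d n : ℕ} {C : ProperCone ℝ (Vec n)} {f : Vec d → ExtVec n}
    (hf : VReg C f) {l l' : Vec n} {w w' : Vec d} {r r' : ℝ}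
    (h : Minor (fun x => ExtVec.scal l (f x)) w r)
    (h' : Minor (fun x => ExtVec.scal l' (f x)) w' r') {s t : ℝ} (hs : 0 ≤ s) (ht : 0 ≤ t) :
    Minor (fun x => ExtVec.scal (s • l + t • l') (f x)) (s • w + t • w') (s * r + t * r') := by
  rw [hf.minor_scal_iff] at h h' ⊢
  intro z hz
  have h1 := mul_le_mul_of_nonneg_left (h z hz) hs
  have h2 := mul_le_mul_of_nonneg_left (h' z hz) ht
  simp only [inner_add_left, inner_smul_left, inner_add_right, inner_smul_right,
    RCLike.conj_to_real]
  linarith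

lemma minor_scal_zero {d n : ℕ} {C : ProperCone ℝ (Vec n)} {f : Vec d → ExtVec n}
    (hf : VReg C f) : Minor (fun x => ExtVec.scal 0 (f x)) 0 0 := by
  rw [hf.minor_scal_iff]
  simp

lemma Minor.smul_scal {d n : ℕ} {C : ProperCone ℝ (Vec n)} {f : Vec d → ExtVec n}
    (hf : VReg C f) {l : Vec n} {w : Vec d} {r : ℝ}
    (h : Minor (fun x => ExtVec.scal l (f x)) w r) {c : ℝ} (hc : 0 ≤ c) :
    Minor (fun x => ExtVec.scal (c • l) (f x)) (c • w) (c * r) := by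
  simpa using h.combo_scal hf (minor_scal_zero hf) hc le_rfl

lemma Minor.combo {d : ℕ} {g : Vec d → EReal} (hg : Reg fun z => - g z) {w w' : Vec d} {r r' : ℝ}
    (h : Minor (fun z => - g z) w r) (h' : Minor (fun z => - g z) w' r') {s t : ℝ} (hs : 0 ≤ s)
    (ht : 0 ≤ t) (hst : s + t = 1) :
    Minor (fun z => - g z) (s • w + t • w') (s * r + t * r') := by
  rw [minor_neg_iff hg] at h h' ⊢
  intro z hz
  have h1 := mul_le_mul_of_nonneg_left (h z hz) hs
  have h2 := mul_le_mul_of_nonneg_left (h' z hz) ht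
  simp only [inner_add_right, inner_smul_right]
  have h3 : (g z).toReal = s * (g z).toReal + t * (g z).toReal := by rw [← add_mul, hst, one_mul]
  linarith

end Aux

namespace Data

variable {D : Data}

lemma convex_apwEpi (hD : D.Standing) (k : Fin D.nK) (i : Fin (D.nI k)) :
    Convex ℝ {q : D.ApwVar × ℝ | ApwEpi k i q.1 q.2} := by
  rintro ⟨x, r⟩ ⟨x1, x2, r₀, r₁, r₂, m0, m1, m2, hr⟩ ⟨y, r'⟩
    ⟨y1, y2, r₀', r₁', r₂', m0', m1', m2', hr'⟩ s t hs ht hst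
  refine ⟨fun j => (dualCone (D.H j)).add_mem ((dualCone (D.H j)).smul_mem (x1 j) hs)
      ((dualCone (D.H j)).smul_mem (y1 j) ht),
    fun l => (dualCone (D.C k l)).add_mem ((dualCone (D.C k l)).smul_mem (x2 l) hs)
      ((dualCone (D.C k l)).smul_mem (y2 l) ht),
    s * r₀ + t * r₀', fun j => s * r₁ j + t * r₁' j, fun l => s * r₂ l + t * r₂' l,
    m0.combo (hD.g_reg k i) m0' hs ht hst, fun j => (m1 j).combo_scal (hD.h_vreg j k) (m1' j) hs ht,
    fun l => (m2 l).combo_scal (hD.c_vreg k l) (m2' l) hs ht, ?_⟩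
  have h1 := mul_le_mul_of_nonneg_left hr hs
  have h2 := mul_le_mul_of_nonneg_left hr' ht
  simp only [Finset.sum_add_distrib, ← Finset.mul_sum]
  show _ ≤ s * r + t * r'
  simp only at h1 h2
  linarith

lemma ApwEpi.mono {k : Fin D.nK} {i : Fin (D.nI k)} {x : D.ApwVar} {r r' : ℝ}
    (h : ApwEpi k i x r) (hr : r ≤ r') : ApwEpi k i x r' := by
  obtain ⟨h1, h2, r₀, r₁, r₂, m0, m1, m2, h3⟩ := h
  exact ⟨h1, h2, r₀, r₁, r₂, m0, m1, m2, h3.trans hr⟩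

/-- The constraint with indices `k`, `i` is affine on the arguments where it is defined. -/
def ApwAffine (k : Fin D.nK) (i : Fin (D.nI k)) : Prop :=
  ∃ A : D.ApwVar →ᵃ[ℝ] ℝ, ∀ x ∈ {x' : D.ApwVar | (∀ j, x'.beta j ∈ dualCone (D.H j)) ∧
      ∀ l, x'.nu k i l ∈ dualCone (D.C k l)},
    D.apwLhs k i x - ((x.alpha k : ℝ) : EReal) = ((A x : ℝ) : EReal)

/-- The graph of an affine constraint function, and the epigraph of any other one. -/
def apwGraph (k : Fin D.nK) (i : Fin (D.nI k)) : Set (D.ApwVar × ℝ) :=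
  {q | ApwEpi k i q.1 q.2 ∧ (ApwAffine k i → D.apwLhs k i q.1 = (q.2 : EReal))}

lemma ApwAffine.exists_isAff {k : Fin D.nK} {i : Fin (D.nI k)} (h : ApwAffine k i) :
    ∃ a : D.ApwVar → ℝ, IsAff a ∧ ∀ x r, ApwEpi k i x r →
      D.apwLhs k i x = ((a x : ℝ) : EReal) := by
  obtain ⟨A, hA⟩ := h
  refine ⟨fun x => A x + x.alpha k, ?_, fun x r hx => ?_⟩
  · have h1 : IsAff (fun x => A x) := fun x y s t hst => by
      have h2 := A.apply_lineMap x y t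
      rw [AffineMap.lineMap_apply_module, AffineMap.lineMap_apply_module] at h2
      obtain rfl : s = 1 - t := by linarith
      exact h2
    have h3 : IsAff (fun x : D.ApwVar => x.alpha k) := fun x y s t _ => rfl
    exact h1.add h3
  · have h1 := hA x ⟨hx.1, hx.2.1⟩
    rw [EReal.coe_add, ← h1, EReal.sub_add_cancel]

lemma convex_apwGraph (hD : D.Standing) (k : Fin D.nK) (i : Fin (D.nI k)) :
    Convex ℝ (apwGraph k i) := by
  rintro ⟨x, r⟩ ⟨hx, hxg⟩ ⟨y, r'⟩ ⟨hy, hyg⟩ s t hs ht hst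
  have h1 := convex_apwEpi hD k i hx hy hs ht hst
  refine ⟨h1, fun hA => ?_⟩
  obtain ⟨a, ha, haff⟩ := hA.exists_isAff
  rw [haff _ _ h1]
  have h2 := (haff _ _ hx).symm.trans (hxg hA)
  have h3 := (haff _ _ hy).symm.trans (hyg hA)
  simp only [EReal.coe_eq_coe_iff] at h2 h3
  have h4 := ha x y s t hst
  rw [h2, h3] at h4
  exact congrArg _ h4

lemma exists_apwEpi_iff (hD : D.Standing) (k : Fin D.nK) (i : Fin (D.nI k)) :
    {x : D.ApwVar | ∃ r, ApwEpi k i x r}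
      = domR (fun x : D.ApwVar => D.apwLhs k i x - ((x.alpha k : ℝ) : EReal)) := by
  ext x
  show (∃ r, ApwEpi k i x r) ↔ D.apwLhs k i x - ((x.alpha k : ℝ) : EReal) < ⊤
  simp only [← apwLhs_le_iff hD]
  have h := apwLhs_ne_bot hD k i x
  generalize D.apwLhs k i x = e at h ⊢
  induction e with
  | bot => exact absurd rfl h
  | coe a =>
    rw [← EReal.coe_sub]
    simp only [EReal.coe_lt_top, iff_true]
    exact ⟨a, le_rfl⟩
  | top => simp

/-- Over a relative interior point of the domain, the graph of an affine function needs no slack,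
and `r ≤ α` remains an affine inequality. For any other function strictness leaves room above the
graph, so `(x, α)` is in the relative interior of the epigraph and the equation `r = α` can be
imposed. -/
lemma exists_algRi_apwGraph (hD : D.Standing) {x : D.ApwVar} (hx : D.ApwSlater x) (k : Fin D.nK)
    (i : Fin (D.nI k)) : ∃ r : ℝ, AlgRi (apwGraph k i) (x, r) ∧ r ≤ x.alpha k ∧
      (¬ ApwAffine k i → r = x.alpha k) := by
  obtain ⟨hfeas, hs, -⟩ := hx
  obtain ⟨hri, hlt⟩ := hs k i
  have hdom := AlgRi.of_intrinsicInterior hri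
  rw [← exists_apwEpi_iff hD] at hdom
  have hx1 := (apwLhs_le_iff hD).1 (hfeas.1 k i)
  by_cases hA : ApwAffine k i
  · obtain ⟨a, ha, haff⟩ := hA.exists_isAff
    have hval := haff _ _ hx1
    have hle := hfeas.1 k i
    rw [hval, EReal.coe_le_coe_iff] at hle
    refine ⟨a x, ⟨⟨(apwLhs_le_iff hD).1 hval.le, fun _ => hval⟩, ?_⟩, hle,
      fun h => absurd hA h⟩
    rintro ⟨y, r⟩ ⟨hy, hyg⟩
    obtain ⟨ε, hε, r', hr'⟩ := hdom.2 y ⟨r, hy⟩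
    refine ⟨ε, hε, ?_⟩
    have h1 := haff _ _ hr'
    have h2 := (haff _ _ hy).symm.trans (hyg hA)
    rw [EReal.coe_eq_coe_iff] at h2
    rw [ha.prolong, h2] at h1
    exact ⟨(apwLhs_le_iff hD).1 h1.le, fun _ => h1⟩
  · have h1 := hlt hA
    have h2 : D.apwLhs k i x < ((x.alpha k : ℝ) : EReal) := by
      rw [EReal.sub_lt_iff (Or.inl (EReal.coe_ne_bot _)) (Or.inl (EReal.coe_ne_top _)),
        zero_add] at h1
      exact h1
    obtain ⟨w, hw1, hw2⟩ := EReal.lt_iff_exists_real_btwn.1 h2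
    rw [EReal.coe_lt_coe_iff] at hw2
    refine ⟨x.alpha k, ?_, le_rfl, fun _ => rfl⟩
    have h3 : apwGraph k i = {q : D.ApwVar × ℝ | ApwEpi k i q.1 q.2} := by
      ext q
      simp [apwGraph, hA]
    rw [h3]
    refine AlgRi.epigraph (C := Ici 0) (convex_apwEpi hD k i) (fun x w hxw c hc => ?_) hdom
      (w' := w) ((apwLhs_le_iff hD).1 hw1.le) ?_
    · exact ApwEpi.mono hxw (le_add_of_nonneg_right hc)
    · rw [interior_Ici]
      exact sub_pos.2 hw2

/-- Variables of the problem with one copy for each constraint. -/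
abbrev CopyVar (D : Data) : Type :=
  ((Σ k, Fin (D.nI k)) → D.ApwVar × ℝ) × (Fin D.nK → ℝ) × ((j : Fin D.nJ) → Vec (D.dH j))

/-- The sum of the variables `y` with indices `k`, `i`. -/
def ySum (x : D.ApwVar) (p : Σ k, Fin (D.nI k)) : Vec D.d :=
  x.y0 p.1 p.2 + ∑ j, x.y1 p.1 p.2 j + ∑ l, x.y2 p.1 p.2 l

lemma isAff_ySum (p : Σ k, Fin (D.nI k)) : IsAff fun x : D.ApwVar => ySum x p := by
  refine ((IsAff.add ?_ (IsAff.sum _ fun j => ?_)).add (IsAff.sum _ fun l => ?_)) <;>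
  exact fun x y s t _ => rfl

/-- Lagrange multipliers for the reformulated worst-case problem. -/
lemma exists_apw_multipliers (hD : D.Standing) {x : D.ApwVar} (hx : D.ApwSlater x) {B : ℝ}
    (hB : ∀ x ∈ D.apwFeas, B ≤ ∑ k, D.p k * x.alpha k + ∑ j, inner ℝ (D.mu j) (x.beta j)) :
    ∃ (lam : (Σ k, Fin (D.nI k)) → ℝ) (η : (Σ k, Fin (D.nI k)) → Vec D.d)
      (ζ : (q : (Σ k, Fin (D.nI k)) × Fin D.nJ) → Vec (D.dH q.2)),
      (∀ p, ApwAffine p.1 p.2 → 0 ≤ lam p) ∧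
      ∀ v : D.CopyVar, (∀ p, v.1 p ∈ apwGraph p.1 p.2) →
        0 ≤ (∑ k, D.p k * v.2.1 k + ∑ j, inner ℝ (D.mu j) (v.2.2 j)) - B
          + ∑ p, lam p * ((v.1 p).2 - v.2.1 p.1) + ∑ p, inner ℝ (η p) (ySum (v.1 p).1 p)
          + ∑ q, inner ℝ (ζ q) ((v.1 q.1).1.beta q.2 - v.2.2 q.2) := by
  choose r hr1 hr2 hr3 using fun p : Σ k, Fin (D.nI k) => exists_algRi_apwGraph hD hx p.1 p.2
  let X : Set D.CopyVar := {v | v.1 ∈ {f : (Σ k, Fin (D.nI k)) → D.ApwVar × ℝ |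
    ∀ p : Σ k, Fin (D.nI k), f p ∈ apwGraph p.1 p.2} ∧ v.2 ∈ Set.univ}
  have hXc : Convex ℝ X :=
    convex_prod_mem (convex_pi_mem fun p : Σ k, Fin (D.nI k) => convex_apwGraph hD p.1 p.2) convex_univ
  -- All copies equal the Slater point, so every coupling equation holds.
  let v₀ : D.CopyVar := (fun p => (x, r p), x.alpha, x.beta)
  have hv₀ : AlgRi X v₀ := AlgRi.prod
    (convex_pi_mem fun p : Σ k, Fin (D.nI k) => convex_apwGraph hD p.1 p.2)
    convex_univ (AlgRi.pi (fun p : Σ k, Fin (D.nI k) => convex_apwGraph hD p.1 p.2) hr1) (AlgRi.univ _)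
  let E₁ : (q : (Σ k, Fin (D.nI k)) × Fin D.nJ) → D.CopyVar → Vec (D.dH q.2) :=
    fun q v => (v.1 q.1).1.beta q.2 - v.2.2 q.2
  let E₂ : (Σ k, Fin (D.nI k)) → D.CopyVar → Vec D.d := fun p v => ySum (v.1 p).1 p
  let a : (Σ k, Fin (D.nI k)) → D.CopyVar → ℝ := fun p v => (v.1 p).2 - v.2.1 p.1
  let φ : D.CopyVar → ℝ := fun v =>
    (∑ k, D.p k * v.2.1 k + ∑ j, inner ℝ (D.mu j) (v.2.2 j)) - B
  have hE₁ : ∀ q, IsAff (E₁ q) := fun q => IsAff.sub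
    (fun x y s t _ => rfl) (fun x y s t _ => rfl)
  have hE₂ : ∀ p, IsAff (E₂ p) := fun p x y s t hst => isAff_ySum p _ _ s t hst
  have ha : ∀ p, IsAff (a p) := fun p => IsAff.sub (fun x y s t _ => rfl) (fun x y s t _ => rfl)
  have hφ : IsAff φ := by
    refine IsAff.sub (IsAff.add (IsAff.sum _ fun k => ?_) (IsAff.sum _ fun j => ?_))
      (IsAff.const B)
    · exact IsAff.const_mul (a := fun v : D.CopyVar => v.2.1 k) (fun x y s t _ => rfl) _
    · exact IsAff.inner_left (a := fun v : D.CopyVar => v.2.2 j) (fun x y s t _ => rfl) _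
  have hv₀₁ : ∀ q, E₁ q v₀ = 0 := fun q => sub_self _
  have hv₀₂ : ∀ p, E₂ p v₀ = 0 := fun p => hx.1.2.1 p.1 p.2
  have hX₁ := IsAff.convex_zero_vec hE₁ hXc
  have hri₁ := hv₀.inter_zero_vec hE₁ hv₀₁
  have hX₂ := IsAff.convex_zero_vec hE₂ hX₁
  have hri₂ := hri₁.inter_zero_vec hE₂ hv₀₂
  -- The inequalities are dualized on the slice where all equations hold; the equations are then
  -- released in the reverse of the order in which they were imposed.
  obtain ⟨lam, hlam, h1⟩ := exists_multipliers (fun p : Σ k, Fin (D.nI k) => ApwAffine p.1 p.2)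
    ha Finset.univ hX₂ hφ hri₂
    (fun p _ => ⟨sub_nonpos.2 (hr2 p), fun hn => sub_eq_zero.2 (hr3 p hn)⟩) (by
      rintro v ⟨⟨⟨hv, -⟩, hv1⟩, hv2⟩ hv3
      have hβ : ∀ (p : Σ k, Fin (D.nI k)) j, (v.1 p).1.beta j = v.2.2 j := fun p j =>
        sub_eq_zero.1 (hv1 (p, j))
      -- The constraint with indices `k`, `i` sees only its own `y` and `ν` variables besides `β`,
      -- so these can be taken from its copy once the copies of `β` agree.
      let y : D.ApwVar := (v.2.1, v.2.2, fun k i => (v.1 ⟨k, i⟩).1.y0 k i,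
        fun k i => (v.1 ⟨k, i⟩).1.y1 k i, fun k i => (v.1 ⟨k, i⟩).1.y2 k i,
        fun k i => (v.1 ⟨k, i⟩).1.nu k i)
      have hepi : ∀ k i, ApwEpi k i y (v.1 ⟨k, i⟩).2 := fun k i => by
        obtain ⟨e1, e2, r₀, r₁, r₂, m0, m1, m2, e3⟩ := (hv ⟨k, i⟩).1
        simp only [hβ] at e1 m1
        exact ⟨e1, e2, r₀, r₁, r₂, m0, m1, m2, e3⟩
      have hy : y ∈ D.apwFeas := by
        refine ⟨fun k i => ?_, fun k i => hv2 ⟨k, i⟩, fun j => ?_, fun k i l => (hepi k i).2.1 l⟩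
        · refine (apwLhs_le_iff hD).2 ((hepi k i).mono ?_)
          exact sub_nonpos.1 (hv3 ⟨k, i⟩ (Finset.mem_univ _)).1
        · obtain ⟨k⟩ : Nonempty (Fin D.nK) := by
            by_contra hne
            rw [not_nonempty_iff] at hne
            have := hD.p_sum
            simp at this
          exact (hepi k ⟨0, hD.nI_pos k⟩).1 j
      have := hB y hy
      exact sub_nonneg.2 this)
  obtain ⟨η, h2⟩ := exists_vec_multipliers hE₂ hX₁
    (hφ.add (IsAff.sum Finset.univ fun p => (ha p).const_mul (lam p))) hri₁ hv₀₂
    (fun v hv hv2 => h1 v ⟨hv, hv2⟩)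
  obtain ⟨ζ, h3⟩ := exists_vec_multipliers hE₁ hXc
    ((hφ.add (IsAff.sum Finset.univ fun p => (ha p).const_mul (lam p))).add
      (IsAff.sum Finset.univ fun p => (hE₂ p).inner_left (η p))) hv₀ hv₀₁
    (fun v hv hv1 => h2 v ⟨hv, hv1⟩)
  exact ⟨lam, η, ζ, hlam, fun v hv => h3 v ⟨hv, mem_univ _⟩⟩

lemma exists_apwVar (k : Fin D.nK) (i : Fin (D.nI k)) (β : (j : Fin D.nJ) → Vec (D.dH j))
    (w₀ : Vec D.d) (w₁ : Fin D.nJ → Vec D.d) (w₂ : Fin (D.nL k) → Vec D.d)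
    (ν : (l : Fin (D.nL k)) → Vec (D.dC k l)) :
    ∃ x : D.ApwVar, x.beta = β ∧ x.y0 k i = w₀ ∧ x.y1 k i = w₁ ∧ x.y2 k i = w₂ ∧
      x.nu k i = ν := by
  refine ⟨(0, β, fun _ _ => w₀, fun _ _ => w₁,
    Function.update (β := fun k => Fin (D.nI k) → Fin (D.nL k) → Vec D.d) 0 k fun _ => w₂,
    Function.update (β := fun k => Fin (D.nI k) → (l : Fin (D.nL k)) → Vec (D.dC k l)) 0 k
      fun _ => ν), rfl, rfl, rfl, ?_, ?_⟩
  · simp [ApwVar.y2]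
  · simp [ApwVar.nu]

/-- Linear inequalities that the multipliers of one constraint satisfy. -/
lemma persp_of_multipliers (hD : D.Standing) {k : Fin D.nK} {i : Fin (D.nI k)} {τ lam : ℝ}
    {v : Vec D.d} {ω : (j : Fin D.nJ) → Vec (D.dH j)}
    (h : ∀ (x : D.ApwVar) (r : ℝ), ApwEpi k i x r →
      τ ≤ lam * r - inner ℝ v (ySum x ⟨k, i⟩) + ∑ j, inner ℝ (ω j) (x.beta j)) :
    PerspHypo (D.gc k i) v lam τ ∧ (∀ j, PerspEpi (D.H j) (D.hc j k) v lam (ω j)) ∧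
      ∀ l, PerspEpi (D.C k l) (D.c k l) v lam 0 := by
  classical
  have key : ∀ (β : (j : Fin D.nJ) → Vec (D.dH j)) (w₀ : Vec D.d) (w₁ : Fin D.nJ → Vec D.d)
      (w₂ : Fin (D.nL k) → Vec D.d) (ν : (l : Fin (D.nL k)) → Vec (D.dC k l))
      (r₀ : ℝ) (r₁ : Fin D.nJ → ℝ) (r₂ : Fin (D.nL k) → ℝ),
      (∀ j, β j ∈ dualCone (D.H j)) → (∀ l, ν l ∈ dualCone (D.C k l)) →
      Minor (fun z => - D.gc k i z) w₀ r₀ →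
      (∀ j, Minor (fun z => ExtVec.scal (β j) (D.hc j k z)) (w₁ j) (r₁ j)) →
      (∀ l, Minor (fun z => ExtVec.scal (ν l) (D.c k l z)) (w₂ l) (r₂ l)) →
      τ ≤ lam * (r₀ + ∑ j, r₁ j + ∑ l, r₂ l) - inner ℝ v (w₀ + ∑ j, w₁ j + ∑ l, w₂ l)
        + ∑ j, inner ℝ (ω j) (β j) := by
    intro β w₀ w₁ w₂ ν r₀ r₁ r₂ hβ hν m0 m1 m2
    obtain ⟨x, rfl, rfl, rfl, rfl, rfl⟩ := exists_apwVar k i β w₀ w₁ w₂ ν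
    exact h x _ ⟨hβ, hν, r₀, r₁, r₂, m0, m1, m2, le_rfl⟩
  refine ⟨fun w r hw => ?_, fun j l hl _ w r hw => ?_, fun l n hn _ w r hw => ?_⟩
  -- Zero multipliers `β` and `ν` with zero minorants isolate the inequality for `g`.
  · have h1 := key 0 w 0 0 0 r 0 0 (fun j => (dualCone (D.H j)).zero_mem)
      (fun l => (dualCone (D.C k l)).zero_mem) hw (fun j => minor_scal_zero (hD.h_vreg j k))
      (fun l => minor_scal_zero (hD.c_vreg k l))
    simp only [Pi.zero_apply, Finset.sum_const_zero, add_zero, inner_zero_right] at h1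
    linarith
  · obtain ⟨w₀, r₀, hw₀⟩ := (hD.g_reg k i).exists_minor
    -- Scaling the functional and its minorant by `c` while keeping a fixed minorant of `-g`
    -- isolates constraint `j`: the coefficient of `c` must be nonnegative.
    have h1 : ∀ c : ℝ, 0 ≤ c → 0 ≤ c * (lam * r - inner ℝ v w + inner ℝ (ω j) l)
        + (lam * r₀ - inner ℝ v w₀ - τ) := fun c hc => by
      have h2 := key (Pi.single j (c • l)) w₀ (Pi.single j (c • w)) 0 0 r₀ (Pi.single j (c * r)) 0
        (fun j' => by
          rcases eq_or_ne j' j with rfl | hne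
          · rw [Pi.single_eq_same]
            exact (dualCone (D.H j')).smul_mem hl hc
          · rw [Pi.single_eq_of_ne hne]
            exact (dualCone (D.H j')).zero_mem)
        (fun l => (dualCone (D.C k l)).zero_mem) hw₀
        (fun j' => by
          rcases eq_or_ne j' j with rfl | hne
          · simp only [Pi.single_eq_same]
            exact hw.smul_scal (hD.h_vreg j' k) hc
          · simp only [Pi.single_eq_of_ne hne]
            exact minor_scal_zero (hD.h_vreg j' k))
        (fun l => minor_scal_zero (hD.c_vreg k l))
      have h3 : ∑ j', inner ℝ (ω j') (Pi.single (M := fun j => Vec (D.dH j)) j (c • l) j')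
          = c * inner ℝ (ω j) l := by
        rw [Fintype.sum_eq_single j fun j' hj => by
          rw [Pi.single_eq_of_ne hj, inner_zero_right], Pi.single_eq_same, inner_smul_right]
      rw [h3] at h2
      simp only [Finset.sum_pi_single', Finset.mem_univ, if_true, Pi.zero_apply,
        Finset.sum_const_zero, add_zero, inner_add_right, inner_smul_right] at h2
      linarith
    have h3 := nonneg_of_forall_nonneg h1
    linarith [real_inner_comm l (ω j)]
  · obtain ⟨w₀, r₀, hw₀⟩ := (hD.g_reg k i).exists_minor
    have h1 : ∀ c : ℝ, 0 ≤ c → 0 ≤ c * (lam * r - inner ℝ v w)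
        + (lam * r₀ - inner ℝ v w₀ - τ) := fun c hc => by
      have h2 := key 0 w₀ 0 (Pi.single l (c • w)) (Pi.single l (c • n)) r₀ 0 (Pi.single l (c * r))
        (fun j => (dualCone (D.H j)).zero_mem)
        (fun l' => by
          rcases eq_or_ne l' l with rfl | hne
          · rw [Pi.single_eq_same]
            exact (dualCone (D.C k l')).smul_mem hn hc
          · rw [Pi.single_eq_of_ne hne]
            exact (dualCone (D.C k l')).zero_mem)
        hw₀ (fun j => minor_scal_zero (hD.h_vreg j k))
        (fun l' => by
          rcases eq_or_ne l' l with rfl | hne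
          · simp only [Pi.single_eq_same]
            exact hw.smul_scal (hD.c_vreg k l') hc
          · simp only [Pi.single_eq_of_ne hne]
            exact minor_scal_zero (hD.c_vreg k l'))
      simp only [Finset.sum_pi_single', Finset.mem_univ, if_true, Pi.zero_apply, inner_zero_right,
        Finset.sum_const_zero, add_zero, inner_add_right, inner_smul_right] at h2
      linarith
    have h3 := nonneg_of_forall_nonneg h1
    rw [inner_zero_right]
    linarith

/-- The multipliers balance the free variables `α` and `β`. -/
lemma apw_multiplier_sums {B : ℝ} {lam : (Σ k, Fin (D.nI k)) → ℝ}
    {η : (Σ k, Fin (D.nI k)) → Vec D.d}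
    {ζ : (q : (Σ k, Fin (D.nI k)) × Fin D.nJ) → Vec (D.dH q.2)}
    {f₀ : (Σ k, Fin (D.nI k)) → D.ApwVar × ℝ} (hf₀ : ∀ p, f₀ p ∈ apwGraph p.1 p.2)
    (hmain : ∀ v : D.CopyVar, (∀ p, v.1 p ∈ apwGraph p.1 p.2) →
      0 ≤ (∑ k, D.p k * v.2.1 k + ∑ j, inner ℝ (D.mu j) (v.2.2 j)) - B
        + ∑ p, lam p * ((v.1 p).2 - v.2.1 p.1) + ∑ p, inner ℝ (η p) (ySum (v.1 p).1 p)
        + ∑ q, inner ℝ (ζ q) ((v.1 q.1).1.beta q.2 - v.2.2 q.2)) :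
    (∀ k, ∑ i, lam ⟨k, i⟩ = D.p k) ∧ (∀ j, ∑ k, ∑ i, ζ (⟨k, i⟩, j) = D.mu j) ∧
    ∀ f : (Σ k, Fin (D.nI k)) → D.ApwVar × ℝ, (∀ p, f p ∈ apwGraph p.1 p.2) →
      B ≤ ∑ p, (lam p * (f p).2 + inner ℝ (η p) (ySum (f p).1 p)
        + ∑ j, inner ℝ (ζ (p, j)) ((f p).1.beta j)) := by
  classical
  have hsumα : ∀ k, ∑ i, lam ⟨k, i⟩ = D.p k := fun k => by
    have h1 : ∀ c : ℝ, 0 ≤ c * (D.p k - ∑ i, lam ⟨k, i⟩) + (-B + ∑ p, lam p * (f₀ p).2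
        + ∑ p, inner ℝ (η p) (ySum (f₀ p).1 p)
        + ∑ q : (Σ k, Fin (D.nI k)) × Fin D.nJ, inner ℝ (ζ q) ((f₀ q.1).1.beta q.2)) := by
      intro c
      have h2 := hmain (f₀, Pi.single k c, 0) hf₀
      have h3 : ∑ p : Σ k, Fin (D.nI k), lam p * ((f₀ p).2 - Pi.single (M := fun _ => ℝ) k c p.1)
          = ∑ p, lam p * (f₀ p).2 - c * ∑ i, lam ⟨k, i⟩ := by
        simp only [mul_sub, Finset.sum_sub_distrib]
        congr 1
        rw [Fintype.sum_sigma, Fintype.sum_eq_single k fun k' hk => by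
          simp [Pi.single_eq_of_ne hk], Finset.mul_sum]
        simp [mul_comm]
      have h4 : ∑ k', D.p k' * Pi.single (M := fun _ => ℝ) k c k' = D.p k * c := by
        rw [Fintype.sum_eq_single k fun k' hk => by simp [Pi.single_eq_of_ne hk]]
        simp
      simp only [h3, h4, Pi.zero_apply, inner_zero_right, Finset.sum_const_zero, sub_zero,
        add_zero] at h2
      linarith
    linarith [eq_zero_of_forall_nonneg h1]
  have hsumβ : ∀ j, ∑ k, ∑ i, ζ (⟨k, i⟩, j) = D.mu j := fun j => by
    -- The coefficient of the free variable `β_j`. Testing with arbitrary multiples of `u` itself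
    -- gives `‖u‖² = 0`.
    set u := D.mu j - ∑ p, ζ (p, j) with hu
    have h1 : ∀ c : ℝ, 0 ≤ c * inner ℝ u u + (-B + ∑ p, lam p * (f₀ p).2
        + ∑ p, inner ℝ (η p) (ySum (f₀ p).1 p)
        + ∑ q : (Σ k, Fin (D.nI k)) × Fin D.nJ, inner ℝ (ζ q) ((f₀ q.1).1.beta q.2)) := by
      intro c
      have h2 := hmain (f₀, 0, Pi.single j (c • u)) hf₀
      have h3 : ∑ j', inner ℝ (D.mu j') (Pi.single (M := fun j => Vec (D.dH j)) j (c • u) j')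
          = c * inner ℝ (D.mu j) u := by
        rw [Fintype.sum_eq_single j fun j' hj => by
          rw [Pi.single_eq_of_ne hj, inner_zero_right], Pi.single_eq_same, inner_smul_right]
      have h4 : ∑ q : (Σ k, Fin (D.nI k)) × Fin D.nJ, inner ℝ (ζ q)
            (Pi.single (M := fun j => Vec (D.dH j)) j (c • u) q.2)
          = c * inner ℝ (∑ p, ζ (p, j)) u := by
        rw [Fintype.sum_prod_type, sum_inner, Finset.mul_sum]
        refine Finset.sum_congr rfl fun p _ => ?_
        rw [Fintype.sum_eq_single j fun j' hj => by
          rw [Pi.single_eq_of_ne hj, inner_zero_right], Pi.single_eq_same, inner_smul_right]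
      simp only [inner_sub_right, Finset.sum_sub_distrib, h3, h4, Pi.zero_apply, mul_zero,
        Finset.sum_const_zero, sub_zero, zero_add] at h2
      have h5 : inner ℝ u u = inner ℝ (D.mu j) u - inner ℝ (∑ p, ζ (p, j)) u := by
        rw [← inner_sub_left]
      rw [h5]
      linarith
    have h2 := eq_zero_of_forall_nonneg h1
    rw [inner_self_eq_zero, hu, sub_eq_zero, Fintype.sum_sigma] at h2
    exact h2.symm
  have hT : ∀ f : (Σ k, Fin (D.nI k)) → D.ApwVar × ℝ, (∀ p, f p ∈ apwGraph p.1 p.2) →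
      B ≤ ∑ p, (lam p * (f p).2 + inner ℝ (η p) (ySum (f p).1 p)
        + ∑ j, inner ℝ (ζ (p, j)) ((f p).1.beta j)) := fun f hf => by
    have h1 := hmain (f, 0, 0) hf
    simp only [Pi.zero_apply, inner_zero_right, Finset.sum_const_zero, sub_zero, mul_zero,
      Fintype.sum_prod_type] at h1
    simp only [Finset.sum_add_distrib]
    linarith
  exact ⟨hsumα, hsumβ, hT⟩

/-- Strong duality under a Slater condition for the worst-case problem. -/
lemma exists_adb_of_apwSlater (hD : D.Standing) {x : D.ApwVar} (hx : D.ApwSlater x)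
    (hb : ∀ k, Bornology.IsBounded (D.S k)) {B : ℝ}
    (hB : ∀ x ∈ D.apwFeas, B ≤ ∑ k, D.p k * x.alpha k + ∑ j, inner ℝ (D.mu j) (x.beta j)) :
    ∃ x ∈ D.adbFeas, B ≤ ∑ k, ∑ i, x.tau k i := by
  classical
  obtain ⟨lam, η, ζ, hlam, hmain⟩ := exists_apw_multipliers hD hx hB
  have hne : ∀ p : Σ k, Fin (D.nI k), ∃ q, q ∈ apwGraph p.1 p.2 := fun p => by
    obtain ⟨r, hr, -⟩ := exists_algRi_apwGraph hD hx p.1 p.2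
    exact ⟨_, hr.1⟩
  choose f₀ hf₀ using hne
  obtain ⟨hsumα, hsumβ, hT⟩ := apw_multiplier_sums hf₀ hmain
  -- The graph points of different constraints are chosen independently, so the bound splits; `-w p`
  -- becomes `τ`, `-η p` becomes `v` and `ζ` becomes `ω`.
  obtain ⟨w, hw1, hw2⟩ := exists_split (r := -B)
    (T := fun p => {t | ∃ q ∈ apwGraph p.1 p.2, t = -(lam p * q.2 + inner ℝ (η p) (ySum q.1 p)
        + ∑ j, inner ℝ (ζ (p, j)) (q.1.beta j))})
    (fun p => ⟨_, f₀ p, hf₀ p, rfl⟩) (fun t ht => by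
      choose f hf1 hf2 using ht
      have h1 := hT f hf1
      rw [Finset.sum_congr rfl fun p _ => hf2 p, Finset.sum_neg_distrib]
      linarith)
  have hgraph : ∀ p, ∀ q ∈ apwGraph p.1 p.2, -w p ≤ lam p * q.2 + inner ℝ (η p) (ySum q.1 p)
      + ∑ j, inner ℝ (ζ (p, j)) (q.1.beta j) := fun p q hq => by
    have := hw1 p _ ⟨q, hq, rfl⟩
    linarith
  -- For non-affine constraints the multiplier belongs to an equation and carries no sign;
  -- nonnegativity follows because the epigraph is closed under increasing `r`.
  have hnn : ∀ p, 0 ≤ lam p := fun p => by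
    by_cases hA : ApwAffine p.1 p.2
    · exact hlam p hA
    · refine nonneg_of_forall_nonneg (b := lam p * (f₀ p).2 + inner ℝ (η p) (ySum (f₀ p).1 p)
        + ∑ j, inner ℝ (ζ (p, j)) ((f₀ p).1.beta j) + w p) fun c hc => ?_
      have h1 := hgraph p ((f₀ p).1, (f₀ p).2 + c)
        ⟨(hf₀ p).1.mono (le_add_of_nonneg_right hc), fun h => absurd h hA⟩
      simp only at h1
      linarith
  have hepi : ∀ k i (x : D.ApwVar) (r : ℝ), ApwEpi k i x r → -w ⟨k, i⟩ ≤ lam ⟨k, i⟩ * r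
      - inner ℝ (-η ⟨k, i⟩) (ySum x ⟨k, i⟩) + ∑ j, inner ℝ (ζ (⟨k, i⟩, j)) (x.beta j) := by
    intro k i x r hr
    -- Since `lam ≥ 0`, the inequality on the graph of an affine function extends to its epigraph.
    rw [inner_neg_left, sub_neg_eq_add]
    by_cases hA : ApwAffine k i
    · obtain ⟨a, -, haff⟩ := hA.exists_isAff
      have h1 := haff x r hr
      have h2 := (apwLhs_le_iff hD).2 hr
      rw [h1, EReal.coe_le_coe_iff] at h2
      have h3 := hgraph ⟨k, i⟩ (x, a x) ⟨(apwLhs_le_iff hD).1 h1.le, fun _ => h1⟩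
      have h4 := mul_le_mul_of_nonneg_left h2 (hnn ⟨k, i⟩)
      simp only at h3
      linarith
    · exact hgraph ⟨k, i⟩ (x, r) ⟨hr, fun h => absurd h hA⟩
  have hpersp := fun k i => persp_of_multipliers hD (hepi k i)
  -- Boundedness enters here: with `v = 0` the perspectives at weight zero are finite and the linear
  -- inequalities suffice.
  have hv : ∀ k i, lam ⟨k, i⟩ = 0 → -η ⟨k, i⟩ = 0 := fun k i h0 => by
    refine adb_v_eq_zero (k := k) (i := i) hD hb fun l => ?_
    have := (hpersp k i).2.2 l
    rwa [h0] at this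
  have hc : ∀ k i l, ExtVec.le (D.C k l) (persp (D.C k l) (D.c k l) (-η ⟨k, i⟩) (lam ⟨k, i⟩))
      (.fin 0) := fun k i l => by
    have h1 := (hpersp k i).2.2 l
    rcases (hnn ⟨k, i⟩).lt_or_eq with h | h
    · exact (hD.c_vreg k l).persp_le_of_perspEpi (hD.dC_pos k l) (hD.C_proper k l) h h1
    · rw [hv k i h.symm, ← h] at h1 ⊢
      exact (hD.c_vreg k l).persp_zero_le_of_perspEpi h1
  have hh : ∀ k i j, ExtVec.le (D.H j) (persp (D.H j) (D.hc j k) (-η ⟨k, i⟩) (lam ⟨k, i⟩))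
      (.fin (ζ (⟨k, i⟩, j))) := fun k i j => by
    have h1 := (hpersp k i).2.1 j
    rcases (hnn ⟨k, i⟩).lt_or_eq with h | h
    · exact (hD.h_vreg j k).persp_le_of_perspEpi (hD.dH_pos j) (hD.H_proper j) h h1
    · rw [hv k i h.symm, ← h] at h1 ⊢
      exact (hD.h_vreg j k).persp_zero_le_of_perspEpi h1
  have hμ : ∀ j, D.mu j - ∑ k, ∑ i, ζ (⟨k, i⟩, j) ∈ D.H j := fun j => by
    rw [hsumβ, sub_self]
    exact (D.H j).zero_mem
  have hval : B ≤ ∑ k, ∑ i, -w ⟨k, i⟩ := by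
    rw [← Fintype.sum_sigma (f := fun p : Σ k, Fin (D.nI k) => -w p), Finset.sum_neg_distrib]
    linarith
  exact ⟨(fun k i => -w ⟨k, i⟩, fun k i => lam ⟨k, i⟩, fun k i j => ζ (⟨k, i⟩, j),
    fun k i => -η ⟨k, i⟩), ⟨hsumα, hμ, hc, hh,
      fun k i => le_concPersp_of_perspHypo (hD.g_reg k i) (hnn ⟨k, i⟩) (hpersp k i).1,
      fun k i => hnn ⟨k, i⟩⟩, hval⟩

end Data

/-! ### Strong duality from a Slater point of (AD-B') -/

section Aux

lemma nonneg_of_forall_pos {a b : ℝ} (h : ∀ c : ℝ, 0 < c → 0 ≤ c * a + b) : 0 ≤ a ∧ 0 ≤ b := by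
  constructor
  · refine nonneg_of_forall_nonneg (b := a + b) fun c hc => ?_
    have := h (c + 1) (by linarith)
    linarith
  · by_contra hb
    push Not at hb
    -- At this `c` the linear term is at most `-b/2`, so the sum is at most `b/2 < 0`.
    have h1 := h (-b / (2 * (|a| + 1))) (div_pos (by linarith) (by positivity))
    have h2 : -b / (2 * (|a| + 1)) * a ≤ -b / 2 := by
      have h3 : -b / (2 * (|a| + 1)) * a = -b / 2 * (a / (|a| + 1)) := by
        field_simp
      rw [h3]
      refine mul_le_of_le_one_right (by linarith) ?_
      rw [div_le_one (by positivity)]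
      linarith [le_abs_self a]
    linarith

variable {d n : ℕ} {C : ProperCone ℝ (Vec n)} {f : Vec d → ExtVec n}

/-- Affine functions with values in `ℝⁿ`. -/
def VAffine (f : Vec d → ExtVec n) : Prop :=
  ∃ a : Vec d → Vec n, IsAff a ∧ ∀ z, f z = .fin (a z)

/-- The epigraph of a cone-convex function; its graph if `P` holds. -/
def vGraph (C : ProperCone ℝ (Vec n)) (f : Vec d → ExtVec n) (P : Prop) : Set (Vec d × Vec n) :=
  {q | ExtVec.le C (f q.1) (.fin q.2) ∧ (P → f q.1 = .fin q.2)}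

lemma convex_epi (hf : VReg C f) :
    Convex ℝ {q : Vec d × Vec n | ExtVec.le C (f q.1) (.fin q.2)} := by
  rintro ⟨x, a⟩ hx ⟨y, b⟩ hy s t hs ht hst
  obtain ⟨x1, x2⟩ := hf.le_fin_iff.1 hx
  obtain ⟨y1, y2⟩ := hf.le_fin_iff.1 hy
  obtain ⟨h1, h2⟩ := hf.combo x1 y1 hs ht hst
  refine hf.le_fin_iff.2 ⟨h1, ?_⟩
  have h3 := C.add_mem (C.add_mem (C.smul_mem x2 hs) (C.smul_mem y2 ht)) h2
  have h4 : s • (a - (f x).toVec) + t • (b - (f y).toVec)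
      + (s • (f x).toVec + t • (f y).toVec - (f (s • x + t • y)).toVec)
      = (s • a + t • b) - (f (s • x + t • y)).toVec := by module
  rw [h4] at h3
  exact h3

lemma convex_vGraph (hf : VReg C f) {P : Prop} (hP : P → VAffine f) : Convex ℝ (vGraph C f P) := by
  rintro ⟨x, a⟩ ⟨hx, hxP⟩ ⟨y, b⟩ ⟨hy, hyP⟩ s t hs ht hst
  refine ⟨convex_epi hf hx hy hs ht hst, fun h => ?_⟩
  obtain ⟨A, hA, hfA⟩ := hP h
  have h1 := hxP h
  have h2 := hyP h
  rw [hfA, ExtVec.fin.injEq] at h1 h2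
  show f (s • x + t • y) = .fin (s • a + t • b)
  simp only at h1 h2
  rw [hfA, hA x y s t hst, h1, h2]

/-- The graph of an affine function is an affine subspace and needs no slack; an epigraph needs
slack in the interior of the cone. -/
lemma algRi_vGraph (hf : VReg C f) {P : Prop} (hP : P → VAffine f) {z : Vec d} {w : Vec n}
    (hz : AlgRi (domV f) z) (hw : P → w = (f z).toVec)
    (hint : ¬ P → w - (f z).toVec ∈ interior (C : Set (Vec n))) :
    AlgRi (vGraph C f P) (z, w) := by
  by_cases h : P
  · obtain ⟨A, hA, hfA⟩ := hP h
    have h1 : vGraph C f P = {q : Vec d × Vec n | q.2 = A q.1} := by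
      ext ⟨x, a⟩
      simp only [vGraph, h, forall_const, hfA, ExtVec.le, ExtVec.fin.injEq, mem_ofPred_eq]
      constructor
      · exact fun h2 => h2.2.symm
      · rintro rfl
        exact ⟨by rw [sub_self]; exact C.zero_mem, rfl⟩
    rw [h1]
    have h2 : w = A z := by rw [hw h, hfA]; rfl
    refine ⟨h2, fun ⟨y, b⟩ hb => ⟨1, one_pos, ?_⟩⟩
    have h3 : b = A y := hb
    show w + (1 : ℝ) • (w - b) = A (z + (1 : ℝ) • (z - y))
    have h4 : z + (1 : ℝ) • (z - y) = (2 : ℝ) • z + (-1 : ℝ) • y := by module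
    rw [h4, hA _ _ _ _ (by norm_num), h2, h3]
    module
  · have h1 : vGraph C f P = {q : Vec d × Vec n | ExtVec.le C (f q.1) (.fin q.2)} := by
      ext q
      simp [vGraph, h]
    rw [h1]
    have hdom : {x | ∃ w, (x, w) ∈ {q : Vec d × Vec n | ExtVec.le C (f q.1) (.fin q.2)}}
        = domV f := by
      ext x
      constructor
      · rintro ⟨w, hw⟩
        exact (hf.le_fin_iff.1 hw).1
      · exact fun hx => ⟨(f x).toVec, hf.le_fin_iff.2 ⟨hx, by rw [sub_self]; exact C.zero_mem⟩⟩
    refine AlgRi.epigraph (C := (C : Set (Vec n))) (convex_epi hf) (fun x w hxw c hc => ?_)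
      (by rw [hdom]; exact hz) (w' := (f z).toVec)
      (hf.le_fin_iff.2 ⟨hz.1, by rw [sub_self]; exact C.zero_mem⟩) (hint h)
    obtain ⟨h2, h3⟩ := hf.le_fin_iff.1 hxw
    refine hf.le_fin_iff.2 ⟨h2, ?_⟩
    have h4 := C.add_mem h3 hc
    rwa [sub_add_eq_add_sub] at h4

/-- The hypograph of a concave function. -/
def gHypo (g : Vec d → EReal) : Set (Vec d × ℝ) := {q | (q.2 : EReal) ≤ g q.1}

lemma mem_gHypo_iff {g : Vec d → EReal} (hg : Reg fun z => - g z) {z : Vec d} {τ : ℝ} :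
    (z, τ) ∈ gHypo g ↔ z ∈ domR (fun z => - g z) ∧ τ ≤ (g z).toReal := by
  have h := le_concPersp_iff_of_pos hg (v := z) (τ := τ) one_pos
  simpa [concPersp, gHypo] using h

lemma convex_gHypo {g : Vec d → EReal} (hg : Reg fun z => - g z) : Convex ℝ (gHypo g) := by
  rintro ⟨x, a⟩ hx ⟨y, b⟩ hy s t hs ht hst
  have h1 : ∀ z (r : ℝ), (z, r) ∈ gHypo g ↔
      ((z, -r) : Vec d × ℝ) ∈ {q : Vec d × ℝ | - g q.1 ≤ (q.2 : EReal)} := fun z r => by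
    simp [gHypo]
  have h2 := hg.convex ((h1 _ _).1 hx) ((h1 _ _).1 hy) hs ht hst
  refine (h1 _ _).2 ?_
  convert h2 using 1
  ext1
  · rfl
  · show -(s * a + t * b) = s * (-a) + t * (-b)
    ring

lemma algRi_gHypo {g : Vec d → EReal} (hg : Reg fun z => - g z) {z : Vec d} {τ : ℝ}
    (hz : AlgRi (domR fun z => - g z) z) (hτ : τ < (g z).toReal) : AlgRi (gHypo g) (z, τ) := by
  have hdom : {x | ∃ w, (x, w) ∈ gHypo g} = domR fun z => - g z := by
    ext x
    simp only [mem_gHypo_iff hg, mem_ofPred_eq]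
    exact ⟨fun ⟨w, hw⟩ => hw.1, fun hx => ⟨_, hx, le_rfl⟩⟩
  refine AlgRi.epigraph (C := Iic 0) (convex_gHypo hg) (fun x w hxw c hc => ?_)
    (by rw [hdom]; exact hz) (w' := (g z).toReal) ((mem_gHypo_iff hg).2 ⟨hz.1, le_rfl⟩) ?_
  · obtain ⟨h1, h2⟩ := (mem_gHypo_iff hg).1 hxw
    exact (mem_gHypo_iff hg).2 ⟨h1, (add_le_of_nonpos_right hc).trans h2⟩
  · rw [interior_Iic]
    exact sub_neg.2 hτ

lemma VReg.persp_ne_posInf_iff {v : Vec d} {t : ℝ} (ht : 0 < t) :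
    persp C f v t ≠ .posInf ↔ t⁻¹ • v ∈ domV f := by
  simp only [persp, ht, if_true, domV, mem_ofPred_eq]
  cases h : f (t⁻¹ • v) <;> simp_all [ExtVec.smul, ht.ne']

end Aux

namespace Data

variable {D : Data}

/-! ### Consequences of the Slater condition -/

/-- At a fixed positive weight, the domain of a perspective is a rescaled copy of the domain of the
function. Prolongations from a test point with the same weights stay in that slice. -/
lemma algRi_of_adb {S : Set D.AdbVar} {x : D.AdbVar} (hx : AlgRi S x) {k : Fin D.nK}
    {i : Fin (D.nI k)} (hl : 0 < x.lam k i) {T : Set (Vec D.d)}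
    (hST : ∀ y : D.AdbVar, y.lam k i = x.lam k i → (y ∈ S ↔ (x.lam k i)⁻¹ • y.v k i ∈ T)) :
    AlgRi T ((x.lam k i)⁻¹ • x.v k i) := by
  refine ⟨(hST x rfl).1 hx.1, fun z hz => ?_⟩
  let y : D.AdbVar := (x.tau, x.lam, x.omega, fun _ _ => x.lam k i • z)
  have hy : y ∈ S := (hST y rfl).2 (by
    show (x.lam k i)⁻¹ • x.lam k i • z ∈ T
    rwa [smul_smul, inv_mul_cancel₀ hl.ne', one_smul])
  obtain ⟨ε, hε, h1⟩ := hx.2 y hy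
  refine ⟨ε, hε, ?_⟩
  have h2 := (hST (x + ε • (x - y)) (by
    show x.lam k i + ε * (x.lam k i - x.lam k i) = x.lam k i
    ring)).1 h1
  convert h2 using 1
  show _ = (x.lam k i)⁻¹ • (x.v k i + ε • (x.v k i - x.lam k i • z))
  match_scalars <;> field_simp

/-- The variable with unit weights and all directions equal to `z`. -/
def unitVar (D : Data) (z : Vec D.d) : D.AdbVar := (0, fun _ _ => 1, 0, fun _ _ => z)

/-- At weight one the perspective is the function itself, so an affine perspective forces an affine
function. By contraposition, a function that is not affine has a strict constraint at the Slater
point. -/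
lemma isAff_unitVar {n : ℕ} (A : D.AdbVar →ᵃ[ℝ] Vec n) : IsAff fun z => A (unitVar D z) := by
  intro x y s t hst
  have h2 := A.apply_lineMap (unitVar D x) (unitVar D y) t
  rw [AffineMap.lineMap_apply_module, AffineMap.lineMap_apply_module] at h2
  obtain rfl : s = 1 - t := by linarith
  refine Eq.trans ?_ h2
  refine congrArg A ?_
  refine Prod.ext ?_ (Prod.ext ?_ (Prod.ext ?_ rfl))
  · simp [unitVar]
  · funext k i
    simp [unitVar]
  · simp [unitVar]

/-- The constraints with index `l` on component `k` are polyhedral. -/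
def PolyC (D : Data) (k : Fin D.nK) (l : Fin (D.nL k)) : Prop :=
  VAffine (D.c k l) ∧ IsOrthant (D.C k l)

/-- The moment constraints with index `j` are polyhedral. -/
def PolyH (D : Data) (j : Fin D.nJ) : Prop := (∀ k, VAffine (D.hc j k)) ∧ IsOrthant (D.H j)

lemma slater_c (hD : D.Standing) {x : D.AdbVar} (hx : D.AdbSlater x)
    (hpos : ∀ k i, 0 < x.lam k i) (k : Fin D.nK) (i : Fin (D.nI k)) (l : Fin (D.nL k)) :
    AlgRi (domV (D.c k l)) ((x.lam k i)⁻¹ • x.v k i) ∧ (¬ PolyC D k l →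
      0 - (D.c k l ((x.lam k i)⁻¹ • x.v k i)).toVec ∈ interior (D.C k l : Set (Vec _))) := by
  have hlt := (hx.2.2.1 k i l).2
  have h0 := AlgRi.of_intrinsicInterior (hx.2.2.1 k i l).1
  have h1 := algRi_of_adb (T := domV (D.c k l)) h0 (hpos k i)
    fun y hy => by
      show persp _ _ (y.v k i) (y.lam k i) ≠ _ ↔ _
      rw [hy, VReg.persp_ne_posInf_iff (hpos k i)]
  refine ⟨h1, fun hn => ?_⟩
  have h2 := hlt fun ⟨⟨A, hA⟩, horth⟩ => hn ⟨⟨_, isAff_unitVar A, fun z => ?_⟩, horth⟩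
  · simp only [persp, hpos k i, if_true] at h2
    rw [(hD.c_vreg k l).eq_fin h1.1] at h2
    have h3 : 0 - x.lam k i • (D.c k l ((x.lam k i)⁻¹ • x.v k i)).toVec
      ∈ interior (D.C k l : Set (Vec _)) := h2
    have h4 := interior_smul_mem h3 (inv_pos.2 (hpos k i))
    rwa [smul_sub, smul_zero, smul_smul, inv_mul_cancel₀ (hpos k i).ne', one_smul] at h4
  · have h3 := hA (unitVar D z) (show (0 : ℝ) ≤ 1 by norm_num)
    have h4 : persp (D.C k l) (D.c k l) z 1 = .fin (A (unitVar D z)) := h3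
    simp only [persp, one_pos, if_true, inv_one, one_smul] at h4
    cases h5 : D.c k l z <;> simp_all [ExtVec.smul]

lemma slater_h_dom {x : D.AdbVar} (hx : D.AdbSlater x)
    (hpos : ∀ k i, 0 < x.lam k i) (k : Fin D.nK) (i : Fin (D.nI k)) (j : Fin D.nJ) :
    AlgRi (domV (D.hc j k)) ((x.lam k i)⁻¹ • x.v k i) := by
  refine algRi_of_adb (AlgRi.of_intrinsicInterior (hx.2.2.2.1 k i j).1) (hpos k i) fun y hy => ?_
  rw [← VReg.persp_ne_posInf_iff (C := D.H j) (hpos k i), ← hy]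
  show ExtVec.add (persp _ _ (y.v k i) (y.lam k i)) _ ≠ _ ↔ _
  cases persp (D.H j) (D.hc j k) (y.v k i) (y.lam k i) <;> simp [ExtVec.add]

lemma slater_h_lt (hD : D.Standing) {x : D.AdbVar} (hx : D.AdbSlater x)
    (hpos : ∀ k i, 0 < x.lam k i) (k : Fin D.nK) (i : Fin (D.nI k)) (j : Fin D.nJ)
    (hn : ¬ VAffine (D.hc j k)) : x.omega k i j
      - x.lam k i • (D.hc j k ((x.lam k i)⁻¹ • x.v k i)).toVec ∈ interior (D.H j : Set (Vec _)) := by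
  have h2 := (hx.2.2.2.1 k i j).2 fun ⟨⟨A, hA⟩, _⟩ => hn ⟨_, isAff_unitVar A, fun z => ?_⟩
  · simp only [persp, hpos k i, if_true] at h2
    rw [(hD.h_vreg j k).eq_fin (slater_h_dom hx hpos k i j).1] at h2
    have h3 : 0 - (x.lam k i • (D.hc j k ((x.lam k i)⁻¹ • x.v k i)).toVec + -x.omega k i j)
      ∈ interior (D.H j : Set (Vec _)) := h2
    convert h3 using 1
    abel
  · have h3 := hA (unitVar D z) (show (0 : ℝ) ≤ 1 by norm_num)
    have h4 : ExtVec.add (persp (D.H j) (D.hc j k) z 1) (.fin (-0))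
      = .fin (A (unitVar D z)) := h3
    simp only [persp, one_pos, if_true, inv_one, one_smul] at h4
    cases h5 : D.hc j k z <;> simp_all [ExtVec.smul, ExtVec.add]

/-- The total slack is the slack of the aggregate moment bound plus the slacks of all blocks. In the
non-polyhedral case one of them is interior: the aggregate bound if the cone is not the orthant,
otherwise a block whose moment function is not affine. -/
lemma slater_moment (hD : D.Standing) {x : D.AdbVar} (hx : D.AdbSlater x)
    (hpos : ∀ k i, 0 < x.lam k i) (j : Fin D.nJ) :
    (D.mu j - ∑ p : Σ k, Fin (D.nI k), x.lam p.1 p.2 •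
      (D.hc j p.1 ((x.lam p.1 p.2)⁻¹ • x.v p.1 p.2)).toVec ∈ D.H j) ∧
    (¬ PolyH D j → D.mu j - ∑ p : Σ k, Fin (D.nI k), x.lam p.1 p.2 •
      (D.hc j p.1 ((x.lam p.1 p.2)⁻¹ • x.v p.1 p.2)).toVec ∈ interior (D.H j : Set (Vec _))) := by
  classical
  set e : (Σ k, Fin (D.nI k)) → Vec (D.dH j) := fun p => x.omega p.1 p.2 j - x.lam p.1 p.2 •
      (D.hc j p.1 ((x.lam p.1 p.2)⁻¹ • x.v p.1 p.2)).toVec with he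
  have hmem : ∀ p, e p ∈ D.H j := fun p => (adb_pos hD hx.1 (hpos p.1 p.2)).2.1 j
  have hω : D.mu j - ∑ p : Σ k, Fin (D.nI k), x.omega p.1 p.2 j ∈ D.H j := by
    rw [Fintype.sum_sigma]
    exact hx.1.2.1 j
  have heq : D.mu j - ∑ p : Σ k, Fin (D.nI k), x.lam p.1 p.2 •
      (D.hc j p.1 ((x.lam p.1 p.2)⁻¹ • x.v p.1 p.2)).toVec
      = (D.mu j - ∑ p : Σ k, Fin (D.nI k), x.omega p.1 p.2 j) + ∑ p, e p := by
    simp only [he, Finset.sum_sub_distrib]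
    abel
  rw [heq]
  refine ⟨(D.H j).add_mem hω (Submodule.sum_mem _ fun p _ => hmem p), fun hn => ?_⟩
  by_cases horth : IsOrthant (D.H j)
  · have h1 : ∃ k, ¬ VAffine (D.hc j k) := by
      by_contra hall
      push Not at hall
      exact hn ⟨hall, horth⟩
    obtain ⟨k, hk⟩ := h1
    have h2 := slater_h_lt hD hx hpos k ⟨0, hD.nI_pos k⟩ j hk
    rw [← Finset.add_sum_erase _ e
      (Finset.mem_univ (⟨k, ⟨0, hD.nI_pos k⟩⟩ : Σ k, Fin (D.nI k))), add_comm, add_assoc]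
    exact interior_add_mem h2 ((D.H j).add_mem (Submodule.sum_mem _ fun p _ => hmem p) hω)
  · have h2 := (hx.2.1 j).2 fun h => horth h.2
    have h3 : 0 - (∑ k, ∑ i, x.omega k i j - D.mu j) ∈ interior (D.H j : Set (Vec _)) := h2
    rw [zero_sub, neg_sub] at h3
    rw [Fintype.sum_sigma (f := fun p : Σ k, Fin (D.nI k) => x.omega p.1 p.2 j)]
    exact interior_add_mem h3 (Submodule.sum_mem _ fun p _ => hmem p)

lemma slater_g (hD : D.Standing) {x : D.AdbVar} (hx : D.AdbSlater x)
    (hpos : ∀ k i, 0 < x.lam k i) (k : Fin D.nK) (i : Fin (D.nI k)) :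
    AlgRi (domR fun z => - D.gc k i z) ((x.lam k i)⁻¹ • x.v k i) := by
  refine algRi_of_adb (AlgRi.of_intrinsicInterior (hx.2.2.2.2 k i).1) (hpos k i) fun y hy => ?_
  show ((y.tau k i : ℝ) : EReal) - concPersp (D.gc k i) (y.v k i) (y.lam k i) < ⊤ ↔
    - D.gc k i ((x.lam k i)⁻¹ • y.v k i) < ⊤
  rw [hy]
  simp only [concPersp, hpos k i, if_true]
  have h1 := (hD.g_reg k i).proper.1 ((x.lam k i)⁻¹ • y.v k i)
  induction h : D.gc k i ((x.lam k i)⁻¹ • y.v k i) with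
  | bot => simp [EReal.coe_mul_bot_of_pos (hpos k i)]
  | coe a =>
    rw [← EReal.coe_mul, ← EReal.coe_sub, ← EReal.coe_neg]
    simp only [EReal.coe_lt_top]
  | top => simp [h] at h1

end Data

/-! ### Decoupled blocks of (AD-B') and their multipliers -/

namespace Data

variable {D : Data}

/-- Variables of one block of the best-case problem, with a copy of the direction for each
constraint. -/
abbrev BlockVar (D : Data) (p : Σ k, Fin (D.nI k)) : Type :=
  (Vec D.d × ℝ) × ((j : Fin D.nJ) → Vec D.d × Vec (D.dH j)) ×
    ((l : Fin (D.nL p.1)) → Vec D.d × Vec (D.dC p.1 l))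

/-- The constraints of one block, for unit weight and without coupling of the copies. -/
def blockSet (D : Data) (p : Σ k, Fin (D.nI k)) : Set (D.BlockVar p) :=
  {u | u.1 ∈ gHypo (D.gc p.1 p.2) ∧ u.2 ∈ {w : ((j : Fin D.nJ) → Vec D.d × Vec (D.dH j)) ×
      ((l : Fin (D.nL p.1)) → Vec D.d × Vec (D.dC p.1 l)) |
    w.1 ∈ {f : (j : Fin D.nJ) → Vec D.d × Vec (D.dH j) |
      ∀ j, f j ∈ vGraph (D.H j) (D.hc j p.1) (PolyH D j)} ∧
    w.2 ∈ {f : (l : Fin (D.nL p.1)) → Vec D.d × Vec (D.dC p.1 l) |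
      ∀ l, f l ∈ vGraph (D.C p.1 l) (D.c p.1 l) (PolyC D p.1 l)}}}

lemma convex_blockSet (hD : D.Standing) (p : Σ k, Fin (D.nI k)) : Convex ℝ (D.blockSet p) :=
  convex_prod_mem (convex_gHypo (hD.g_reg p.1 p.2)) (convex_prod_mem
    (convex_pi_mem fun j => convex_vGraph (hD.h_vreg j p.1) fun h => h.1 p.1)
    (convex_pi_mem fun l => convex_vGraph (hD.c_vreg p.1 l) fun h => h.1))

lemma algRi_blockSet (hD : D.Standing) {p : Σ k, Fin (D.nI k)} {u : D.BlockVar p}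
    (h0 : AlgRi (gHypo (D.gc p.1 p.2)) u.1)
    (h1 : ∀ j, AlgRi (vGraph (D.H j) (D.hc j p.1) (PolyH D j)) (u.2.1 j))
    (h2 : ∀ l, AlgRi (vGraph (D.C p.1 l) (D.c p.1 l) (PolyC D p.1 l)) (u.2.2 l)) :
    AlgRi (D.blockSet p) u :=
  have c1 := convex_pi_mem fun j => convex_vGraph (P := PolyH D j) (hD.h_vreg j p.1)
    fun h => h.1 p.1
  have c2 := convex_pi_mem fun l => convex_vGraph (P := PolyC D p.1 l) (hD.c_vreg p.1 l)
    fun h => h.1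
  AlgRi.prod (convex_gHypo (hD.g_reg p.1 p.2)) (convex_prod_mem c1 c2) h0
    (AlgRi.prod c1 c2
      (AlgRi.pi (fun j => convex_vGraph (hD.h_vreg j p.1) fun h => h.1 p.1) h1)
      (AlgRi.pi (fun l => convex_vGraph (hD.c_vreg p.1 l) fun h => h.1) h2))

/-- The linear functional on one block that is defined by the multipliers. -/
def blockVal (D : Data) (p : Σ k, Fin (D.nI k)) (a : ℝ) (b : (j : Fin D.nJ) → Vec (D.dH j))
    (ν : (l : Fin (D.nL p.1)) → Vec (D.dC p.1 l)) (e₂ : Fin (D.nL p.1) → Vec D.d)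
    (e₁ : Fin D.nJ → Vec D.d) (q : D.BlockVar p) : ℝ :=
  a - q.1.2 + ∑ j, inner ℝ (b j) (q.2.1 j).2 + ∑ l, inner ℝ (ν l) (q.2.2 l).2
    + ∑ l, inner ℝ (e₂ l) ((q.2.2 l).1 - q.1.1) + ∑ j, inner ℝ (e₁ j) ((q.2.1 j).1 - q.1.1)

/-- All blocks with their weights. -/
abbrev CoupledVar (D : Data) : Type := (p : Σ k, Fin (D.nI k)) → ℝ × D.BlockVar p

/-- The deviation from the prescribed total weight of component `k`. -/
def weightGap (k : Fin D.nK) (x : D.CoupledVar) : Vec 1 :=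
  WithLp.toLp 2 fun _ => ∑ i, (x ⟨k, i⟩).1 - D.p k

/-- The deviation from the moment bounds. -/
def momentGap (j : Fin D.nJ) (x : D.CoupledVar) : Vec (D.dH j) :=
  ∑ p, ((x p).2.2.1 j).2 - D.mu j

lemma isAff_weightGap (k : Fin D.nK) : IsAff (weightGap k : D.CoupledVar → Vec 1) := by
  intro x y s t h
  have h0 : ∀ i : Fin (D.nI k), IsAff (fun x : D.CoupledVar => (x ⟨k, i⟩).1) :=
    fun _ _ _ _ _ _ => rfl
  have h1 := IsAff.sub (IsAff.sum Finset.univ h0) (IsAff.const (D.p k)) x y s t h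
  ext r
  exact h1

lemma isAff_momentGap (j : Fin D.nJ) : IsAff (momentGap j : D.CoupledVar → Vec (D.dH j)) :=
  IsAff.sub (IsAff.sum Finset.univ fun p : Σ k, Fin (D.nI k) =>
    (fun _ _ _ _ _ => rfl : IsAff fun x : D.CoupledVar => ((x p).2.2.1 j).2)) (IsAff.const _)

/-- Feasible points of the coupled problem are feasible in the best-case problem. -/
lemma adbFeas_of_coupled (hD : D.Standing) {x : D.CoupledVar}
    (hx : ∀ p, x p ∈ coneOver (D.blockSet p)) (hw : ∀ k, weightGap k x = 0)
    (h1 : ∀ p j, ((x p).2.2.1 j).1 = (x p).2.1.1)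
    (h2 : ∀ p l, ((x p).2.2.2 l).1 = (x p).2.1.1)
    (hm : ∀ j, (∀ r, momentGap j x r ≤ 0) ∧ (¬ PolyH D j → momentGap j x = 0))
    (hu : ∀ p l, (∀ r, ((x p).2.2.2 l).2 r ≤ 0) ∧ (¬ PolyC D p.1 l → ((x p).2.2.2 l).2 = 0)) :
    ((fun k i => (x ⟨k, i⟩).2.1.2, fun k i => (x ⟨k, i⟩).1,
      fun k i j => ((x ⟨k, i⟩).2.2.1 j).2, fun k i => (x ⟨k, i⟩).2.1.1) : D.AdbVar)
      ∈ D.adbFeas := by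
  refine ⟨fun k => ?_, fun j => ?_, fun k i l => ?_, fun k i j => ?_, fun k i => ?_,
    fun k i => (hx ⟨k, i⟩).1.le⟩
  · have h3 := congrArg (fun y : Vec 1 => y 0) (hw k)
    exact sub_eq_zero.1 h3
  · show D.mu j - ∑ k, ∑ i, ((x ⟨k, i⟩).2.2.1 j).2 ∈ D.H j
    have h3 : D.mu j - ∑ k, ∑ i, ((x ⟨k, i⟩).2.2.1 j).2 = - momentGap j x := by
      rw [momentGap, Fintype.sum_sigma, neg_sub]
    rw [h3]
    by_cases hP : PolyH D j
    · refine (hP.2 _).2 fun r => ?_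
      have := (hm j).1 r
      simpa using this
    · rw [(hm j).2 hP, neg_zero]
      exact (D.H j).zero_mem
  · obtain ⟨hl, -, -, h4⟩ := hx ⟨k, i⟩
    refine ((hD.c_vreg k l).persp_le_iff_of_pos hl).2 ?_
    have h5 := (h4 l).1
    replace h5 : ExtVec.le (D.C k l) (D.c k l ((x ⟨k, i⟩).1⁻¹ • ((x ⟨k, i⟩).2.2.2 l).1))
      (.fin ((x ⟨k, i⟩).1⁻¹ • ((x ⟨k, i⟩).2.2.2 l).2)) := h5
    rw [h2 ⟨k, i⟩ l] at h5
    obtain ⟨h6, h7⟩ := (hD.c_vreg k l).le_fin_iff.1 h5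
    refine ⟨h6, ?_⟩
    have h8 : - ((x ⟨k, i⟩).2.2.2 l).2 ∈ D.C k l := by
      by_cases hP : PolyC D k l
      · refine (hP.2 _).2 fun r => ?_
        have := (hu ⟨k, i⟩ l).1 r
        simpa using this
      · rw [(hu ⟨k, i⟩ l).2 hP, neg_zero]
        exact (D.C k l).zero_mem
    have h9 := (D.C k l).add_mem h8 ((D.C k l).smul_mem h7 hl.le)
    rw [smul_sub, smul_smul, mul_inv_cancel₀ hl.ne', one_smul, neg_add_eq_sub, sub_sub_cancel_left]
      at h9
    rw [zero_sub]
    exact h9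
  · obtain ⟨hl, -, h4, -⟩ := hx ⟨k, i⟩
    refine ((hD.h_vreg j k).persp_le_iff_of_pos hl).2 ?_
    have h5 := (h4 j).1
    replace h5 : ExtVec.le (D.H j) (D.hc j k ((x ⟨k, i⟩).1⁻¹ • ((x ⟨k, i⟩).2.2.1 j).1))
      (.fin ((x ⟨k, i⟩).1⁻¹ • ((x ⟨k, i⟩).2.2.1 j).2)) := h5
    rw [h1 ⟨k, i⟩ j] at h5
    obtain ⟨h6, h7⟩ := (hD.h_vreg j k).le_fin_iff.1 h5
    refine ⟨h6, ?_⟩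
    have h9 := (D.H j).smul_mem h7 hl.le
    rw [smul_sub, smul_smul, mul_inv_cancel₀ hl.ne', one_smul] at h9
    exact h9
  · obtain ⟨hl, h4, -⟩ := hx ⟨k, i⟩
    refine (le_concPersp_iff_of_pos (hD.g_reg k i) hl).2 ?_
    obtain ⟨h5, h6⟩ := (mem_gHypo_iff (hD.g_reg k i)).1
      (show ((x ⟨k, i⟩).1⁻¹ • (x ⟨k, i⟩).2.1.1, (x ⟨k, i⟩).1⁻¹ • (x ⟨k, i⟩).2.1.2) ∈ _ from h4)
    refine ⟨h5, ?_⟩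
    rw [smul_eq_mul, inv_mul_le_iff₀ hl] at h6
    exact h6

/-- A relative interior point of the coupled problem. -/
lemma exists_algRi_coupled (hD : D.Standing) {y : D.AdbVar} (hy : D.AdbSlater y)
    (hpos : ∀ k i, 0 < y.lam k i) : ∃ x : D.CoupledVar,
      (∀ p, AlgRi (coneOver (D.blockSet p)) (x p)) ∧ (∀ k, weightGap k x = 0) ∧
      (∀ p j, ((x p).2.2.1 j).1 = (x p).2.1.1) ∧
      (∀ p l, ((x p).2.2.2 l).1 = (x p).2.1.1) ∧
      (∀ j, (∀ r, momentGap j x r ≤ 0) ∧ (¬ PolyH D j → momentGap j x = 0)) ∧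
      ∀ p l, (∀ r, ((x p).2.2.2 l).2 r ≤ 0) ∧ (¬ PolyC D p.1 l → ((x p).2.2.2 l).2 = 0) := by
  classical
  have hK : Nonempty (Fin D.nK) := by
    by_contra hne
    rw [not_nonempty_iff] at hne
    have := hD.p_sum
    simp at this
  have hne : Nonempty (Σ k, Fin (D.nI k)) := ⟨⟨hK.some, ⟨0, hD.nI_pos _⟩⟩⟩
  set N : ℝ := ((Fintype.card (Σ k, Fin (D.nI k)) : ℕ) : ℝ) with hN
  have hNpos : 0 < N := by
    rw [hN]
    exact_mod_cast Fintype.card_pos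
  let z : (p : Σ k, Fin (D.nI k)) → Vec D.d := fun p => (y.lam p.1 p.2)⁻¹ • y.v p.1 p.2
  let m : (j : Fin D.nJ) → Vec (D.dH j) := fun j =>
    D.mu j - ∑ p : Σ k, Fin (D.nI k), y.lam p.1 p.2 • (D.hc j p.1 (z p)).toVec
  -- Each value of `g` is lowered by 1. For non-polyhedral moments the interior slack `m j` is
  -- shared equally among the `N` blocks; after multiplication by `λ` each receives `N⁻¹ m j`, so
  -- the moment bound becomes an equation. For a non-polyhedral `c` the epigraph height 0 already
  -- has interior slack.
  let q : (p : Σ k, Fin (D.nI k)) → D.BlockVar p := fun p =>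
    ((z p, (D.gc p.1 p.2 (z p)).toReal - 1),
      fun j => (z p, if PolyH D j then (D.hc j p.1 (z p)).toVec
        else (D.hc j p.1 (z p)).toVec + ((y.lam p.1 p.2)⁻¹ * N⁻¹) • m j),
      fun l => (z p, if PolyC D p.1 l then (D.c p.1 l (z p)).toVec else 0))
  have hq : ∀ p, AlgRi (D.blockSet p) (q p) := fun p => by
    refine algRi_blockSet hD ?_ (fun j => ?_) fun l => ?_
    · exact algRi_gHypo (hD.g_reg p.1 p.2) (slater_g hD hy hpos p.1 p.2) (sub_one_lt _)
    · refine algRi_vGraph (hD.h_vreg j p.1) (fun h => h.1 p.1) (slater_h_dom hy hpos p.1 p.2 j)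
        (fun h => if_pos h) fun h => ?_
      rw [if_neg h, add_sub_cancel_left]
      exact interior_smul_mem ((slater_moment hD hy hpos j).2 h)
        (mul_pos (inv_pos.2 (hpos p.1 p.2)) (inv_pos.2 hNpos))
    · obtain ⟨h1, h2⟩ := slater_c hD hy hpos p.1 p.2 l
      refine algRi_vGraph (hD.c_vreg p.1 l) (fun h => h.1) h1 (fun h => if_pos h) fun h => ?_
      rw [if_neg h]
      exact h2 h
  refine ⟨fun p => (y.lam p.1 p.2, y.lam p.1 p.2 • q p), fun p =>
    AlgRi.coneOver (convex_blockSet hD p) (hpos p.1 p.2) (hq p), fun k => ?_, fun p j => rfl,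
    fun p l => rfl, fun j => ?_, fun p l => ?_⟩
  · ext r
    show ∑ i, y.lam k i - D.p k = 0
    rw [hy.1.1 k, sub_self]
  · have hm : momentGap j (fun p => (y.lam p.1 p.2, y.lam p.1 p.2 • q p) : D.CoupledVar)
        = ∑ p : Σ k, Fin (D.nI k), y.lam p.1 p.2 • (if PolyH D j then (D.hc j p.1 (z p)).toVec
        else (D.hc j p.1 (z p)).toVec + ((y.lam p.1 p.2)⁻¹ * N⁻¹) • m j) - D.mu j := rfl
    rw [hm]
    by_cases hP : PolyH D j
    · simp only [hP, if_true, not_true_eq_false, false_imp_iff, and_true]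
      intro r
      have h1 := (hP.2 _).1 (slater_moment hD hy hpos j).1 r
      rw [← neg_sub]
      simpa using h1
    · have h1 : ∑ p : Σ k, Fin (D.nI k), y.lam p.1 p.2 • (if PolyH D j then
          (D.hc j p.1 (z p)).toVec
          else (D.hc j p.1 (z p)).toVec + ((y.lam p.1 p.2)⁻¹ * N⁻¹) • m j) - D.mu j = 0 := by
        simp only [hP, if_false, smul_add, Finset.sum_add_distrib, smul_smul]
        have h2 : ∀ p : Σ k, Fin (D.nI k), (y.lam p.1 p.2 * ((y.lam p.1 p.2)⁻¹ * N⁻¹)) • m j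
            = N⁻¹ • m j := fun p => by
          rw [← mul_assoc, mul_inv_cancel₀ (hpos p.1 p.2).ne', one_mul]
        rw [Finset.sum_congr rfl fun p _ => h2 p, Finset.sum_const, Finset.card_univ,
          ← Nat.cast_smul_eq_nsmul ℝ, ← hN, smul_smul, mul_inv_cancel₀ hNpos.ne', one_smul]
        simp only [m]
        abel
      rw [h1]
      exact ⟨fun r => le_rfl, fun _ => rfl⟩
  · have hu : ((y.lam p.1 p.2 • q p).2.2 l).2
        = y.lam p.1 p.2 • (if PolyC D p.1 l then (D.c p.1 l (z p)).toVec else 0) := rfl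
    show (∀ r, ((y.lam p.1 p.2 • q p).2.2 l).2 r ≤ 0) ∧ (_ → ((y.lam p.1 p.2 • q p).2.2 l).2 = 0)
    rw [hu]
    by_cases hP : PolyC D p.1 l
    · simp only [hP, if_true, not_true_eq_false, false_imp_iff, and_true]
      intro r
      have h1 := (neg_c_mem hD (adb_pos hD hy.1 (hpos p.1 p.2)).1.1 l).2
      have h2 := (hP.2 _).1 h1 r
      have h3 : (D.c p.1 l (z p)).toVec r ≤ 0 := by simpa using h2
      exact mul_nonpos_of_nonneg_of_nonpos (hpos p.1 p.2).le h3
    · simp only [hP, if_false, smul_zero]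
      exact ⟨fun r => le_rfl, fun _ => trivial⟩

/-- Lagrange multipliers for the reformulated best-case problem. -/
lemma exists_adb_multipliers (hD : D.Standing) {y : D.AdbVar} (hy : D.AdbSlater y)
    (hpos : ∀ k i, 0 < y.lam k i) {B : ℝ} (hB : ∀ x ∈ D.adbFeas, ∑ k, ∑ i, x.tau k i ≤ B) :
    ∃ (b : (j : Fin D.nJ) → Vec (D.dH j))
      (ν : (q : Σ p : (Σ k, Fin (D.nI k)), Fin (D.nL p.1)) → Vec (D.dC q.1.1 q.2))
      (e₂ : (Σ p : (Σ k, Fin (D.nI k)), Fin (D.nL p.1)) → Vec D.d)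
      (e₁ : (Σ k, Fin (D.nI k)) × Fin D.nJ → Vec D.d) (a : Fin D.nK → Vec 1),
      (∀ j, PolyH D j → ∀ r, 0 ≤ b j r) ∧ (∀ q, PolyC D q.1.1 q.2 → ∀ r, 0 ≤ ν q r) ∧
      ∀ x : D.CoupledVar, (∀ p, x p ∈ coneOver (D.blockSet p)) →
        0 ≤ B - ∑ p, (x p).2.1.2 + ∑ j, inner ℝ (b j) (momentGap j x)
          + ∑ q, inner ℝ (ν q) ((x q.1).2.2.2 q.2).2
          + ∑ q, inner ℝ (e₂ q) (((x q.1).2.2.2 q.2).1 - (x q.1).2.1.1)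
          + ∑ q, inner ℝ (e₁ q) (((x q.1).2.2.1 q.2).1 - (x q.1).2.1.1)
          + ∑ k, inner ℝ (a k) (weightGap k x) := by
  obtain ⟨x₀, hx₀, w₀, c₁, c₂, m₀, u₀⟩ := exists_algRi_coupled hD hy hpos
  let X : Set D.CoupledVar := {f | ∀ p, f p ∈ coneOver (D.blockSet p)}
  have hXc : Convex ℝ X := convex_pi_mem fun p => convex_coneOver (convex_blockSet hD p)
  have hri : AlgRi X x₀ := AlgRi.pi (fun p => convex_coneOver (convex_blockSet hD p)) hx₀
  let E₁ : (Σ k, Fin (D.nI k)) × Fin D.nJ → D.CoupledVar → Vec D.d :=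
    fun q x => ((x q.1).2.2.1 q.2).1 - (x q.1).2.1.1
  let E₂ : (Σ p : (Σ k, Fin (D.nI k)), Fin (D.nL p.1)) → D.CoupledVar → Vec D.d :=
    fun q x => ((x q.1).2.2.2 q.2).1 - (x q.1).2.1.1
  let U : (q : Σ p : (Σ k, Fin (D.nI k)), Fin (D.nL p.1)) → D.CoupledVar → Vec (D.dC q.1.1 q.2) :=
    fun q x => ((x q.1).2.2.2 q.2).2
  have hE₁ : ∀ q, IsAff (E₁ q) := fun q => IsAff.sub
    (fun x y s t _ => rfl) (fun x y s t _ => rfl)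
  have hE₂ : ∀ q, IsAff (E₂ q) := fun q => IsAff.sub
    (fun x y s t _ => rfl) (fun x y s t _ => rfl)
  have hU : ∀ q, IsAff (U q) := fun q x y s t _ => rfl
  let φ : D.CoupledVar → ℝ := fun x => B - ∑ p, (x p).2.1.2
  have hφ : IsAff φ := IsAff.sub (IsAff.const B)
    (IsAff.sum _ fun p => fun x y s t _ => rfl)
  have hX₁ := IsAff.convex_zero_vec (E := fun k => weightGap k) isAff_weightGap hXc
  have hri₁ := hri.inter_zero_vec (E := fun k => weightGap k) isAff_weightGap w₀
  have z₁ : ∀ q, E₁ q x₀ = 0 := fun q => sub_eq_zero.2 (c₁ q.1 q.2)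
  have z₂ : ∀ q, E₂ q x₀ = 0 := fun q => sub_eq_zero.2 (c₂ q.1 q.2)
  have hX₂ := IsAff.convex_zero_vec hE₁ hX₁
  have hri₂ := hri₁.inter_zero_vec hE₁ z₁
  have hX₃ := IsAff.convex_zero_vec hE₂ hX₂
  have hri₃ := hri₂.inter_zero_vec hE₂ z₂
  -- Only polyhedral constraints are inequalities here, so only their multipliers receive a sign.
  -- The remaining signs come later from closedness of the epigraphs under adding cone elements.
  obtain ⟨b, ν, hb, hν, h1⟩ := exists_vec_multipliers₂ (PolyH D)
    (fun q : Σ p : (Σ k, Fin (D.nI k)), Fin (D.nL p.1) => PolyC D q.1.1 q.2)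
    (E := fun j => momentGap j) isAff_momentGap hU hX₃ hφ hri₃ m₀ (fun q => u₀ q.1 q.2)
    (by
      rintro x ⟨⟨⟨hx, hw⟩, hx1⟩, hx2⟩ hm hu
      have hfeas := adbFeas_of_coupled hD hx hw (fun p j => sub_eq_zero.1 (hx1 (p, j)))
        (fun p l => sub_eq_zero.1 (hx2 ⟨p, l⟩)) hm (fun p l => hu ⟨p, l⟩)
      have h2 := hB _ hfeas
      show 0 ≤ B - ∑ p, (x p).2.1.2
      rw [Fintype.sum_sigma]
      exact sub_nonneg.2 h2)
  have hφ₁ := (hφ.add (IsAff.sum Finset.univ fun j => (isAff_momentGap j).inner_left (b j))).add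
    (IsAff.sum Finset.univ fun q => (hU q).inner_left (ν q))
  obtain ⟨e₂, h2⟩ := exists_vec_multipliers hE₂ hX₂ hφ₁ hri₂ z₂ (fun x hx h => h1 x ⟨hx, h⟩)
  have hφ₂ := hφ₁.add (IsAff.sum Finset.univ fun q => (hE₂ q).inner_left (e₂ q))
  obtain ⟨e₁, h3⟩ := exists_vec_multipliers hE₁ hX₁ hφ₂ hri₁ z₁ (fun x hx h => h2 x ⟨hx, h⟩)
  have hφ₃ := hφ₂.add (IsAff.sum Finset.univ fun q => (hE₁ q).inner_left (e₁ q))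
  obtain ⟨a, h4⟩ := exists_vec_multipliers (E := fun k => weightGap k) isAff_weightGap hXc hφ₃ hri
    w₀ (fun x hx h => h3 x ⟨hx, h⟩)
  exact ⟨b, ν, e₂, e₁, a, hb, hν, h4⟩

/-- The multipliers define linear functionals that are nonnegative on the blocks. -/
lemma blockVal_nonneg {B : ℝ} {b : (j : Fin D.nJ) → Vec (D.dH j)}
    {ν : (q : Σ p : (Σ k, Fin (D.nI k)), Fin (D.nL p.1)) → Vec (D.dC q.1.1 q.2)}
    {e₂ : (Σ p : (Σ k, Fin (D.nI k)), Fin (D.nL p.1)) → Vec D.d}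
    {e₁ : (Σ k, Fin (D.nI k)) × Fin D.nJ → Vec D.d} {a : Fin D.nK → Vec 1}
    (hne : ∀ p, (D.blockSet p).Nonempty)
    (h : ∀ x : D.CoupledVar, (∀ p, x p ∈ coneOver (D.blockSet p)) →
        0 ≤ B - ∑ p, (x p).2.1.2 + ∑ j, inner ℝ (b j) (momentGap j x)
          + ∑ q, inner ℝ (ν q) ((x q.1).2.2.2 q.2).2
          + ∑ q, inner ℝ (e₂ q) (((x q.1).2.2.2 q.2).1 - (x q.1).2.1.1)
          + ∑ q, inner ℝ (e₁ q) (((x q.1).2.2.1 q.2).1 - (x q.1).2.1.1)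
          + ∑ k, inner ℝ (a k) (weightGap k x)) :
    (∀ p, ∀ q ∈ D.blockSet p, 0 ≤ D.blockVal p (a p.1 0) b (fun l => ν ⟨p, l⟩)
      (fun l => e₂ ⟨p, l⟩) (fun j => e₁ (p, j)) q) ∧
    ∑ k, D.p k * a k 0 + ∑ j, inner ℝ (D.mu j) (b j) ≤ B := by
  classical
  let G : (p : Σ k, Fin (D.nI k)) → D.BlockVar p → ℝ := fun p q =>
    D.blockVal p (a p.1 0) b (fun l => ν ⟨p, l⟩) (fun l => e₂ ⟨p, l⟩) (fun j => e₁ (p, j)) q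
  -- With each block written as its weight times a unit-weight point, the inequality is affine in
  -- the weights `s`, and all positive weights are allowed because the total weight was dualized.
  have key : ∀ (s : (Σ k, Fin (D.nI k)) → ℝ) (q : (p : Σ k, Fin (D.nI k)) → D.BlockVar p),
      (∀ p, 0 < s p) → (∀ p, q p ∈ D.blockSet p) → 0 ≤ ∑ p, s p * G p (q p)
        + (B - (∑ k, D.p k * a k 0 + ∑ j, inner ℝ (D.mu j) (b j))) := by
    intro s q hs hq
    have h1 := h (fun p => (s p, s p • q p)) fun p => ⟨hs p, by
      show (s p)⁻¹ • s p • q p ∈ _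
      rw [smul_smul, inv_mul_cancel₀ (hs p).ne', one_smul]
      exact hq p⟩
    have e1 : ∑ k, inner ℝ (a k) (weightGap k (fun p => (s p, s p • q p) : D.CoupledVar))
        = ∑ p : Σ k, Fin (D.nI k), s p * a p.1 0 - ∑ k, D.p k * a k 0 := by
      rw [Fintype.sum_sigma, ← Finset.sum_sub_distrib]
      refine Finset.sum_congr rfl fun k _ => ?_
      rw [vec_inner_eq_sum, Fin.sum_univ_one]
      show a k 0 * (∑ i, s ⟨k, i⟩ - D.p k) = ∑ i, s ⟨k, i⟩ * a k 0 - D.p k * a k 0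
      rw [← Finset.sum_mul]
      ring
    have e2 : ∑ j, inner ℝ (b j) (momentGap j (fun p => (s p, s p • q p) : D.CoupledVar))
        = ∑ p, s p * ∑ j, inner ℝ (b j) ((q p).2.1 j).2 - ∑ j, inner ℝ (D.mu j) (b j) := by
      simp only [Finset.mul_sum]
      rw [Finset.sum_comm, ← Finset.sum_sub_distrib]
      refine Finset.sum_congr rfl fun j _ => ?_
      rw [momentGap, inner_sub_right, inner_sum, real_inner_comm (b j)]
      congr 1
      refine Finset.sum_congr rfl fun p _ => ?_
      exact inner_smul_right _ _ _
    have e3 : ∑ r : Σ p : (Σ k, Fin (D.nI k)), Fin (D.nL p.1),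
        inner ℝ (ν r) ((s r.1 • q r.1).2.2 r.2).2
        = ∑ p, s p * ∑ l, inner ℝ (ν ⟨p, l⟩) ((q p).2.2 l).2 := by
      rw [Fintype.sum_sigma]
      refine Finset.sum_congr rfl fun p _ => ?_
      rw [Finset.mul_sum]
      exact Finset.sum_congr rfl fun l _ => inner_smul_right _ _ _
    have e4 : ∑ r : Σ p : (Σ k, Fin (D.nI k)), Fin (D.nL p.1),
        inner ℝ (e₂ r) (((s r.1 • q r.1).2.2 r.2).1 - (s r.1 • q r.1).1.1)
        = ∑ p, s p * ∑ l, inner ℝ (e₂ ⟨p, l⟩) (((q p).2.2 l).1 - (q p).1.1) := by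
      rw [Fintype.sum_sigma]
      refine Finset.sum_congr rfl fun p _ => ?_
      rw [Finset.mul_sum]
      refine Finset.sum_congr rfl fun l _ => ?_
      rw [← inner_smul_right, smul_sub]
      rfl
    have e5 : ∑ r : (Σ k, Fin (D.nI k)) × Fin D.nJ,
        inner ℝ (e₁ r) (((s r.1 • q r.1).2.1 r.2).1 - (s r.1 • q r.1).1.1)
        = ∑ p, s p * ∑ j, inner ℝ (e₁ (p, j)) (((q p).2.1 j).1 - (q p).1.1) := by
      rw [Fintype.sum_prod_type]
      refine Finset.sum_congr rfl fun p _ => ?_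
      rw [Finset.mul_sum]
      refine Finset.sum_congr rfl fun l _ => ?_
      rw [← inner_smul_right, smul_sub]
      rfl
    have e6 : ∑ p, (s p • q p).1.2 = ∑ p, s p * (q p).1.2 := rfl
    simp only at h1
    rw [e1, e2, e3, e4, e5, e6] at h1
    simp only [G, blockVal, mul_add, mul_sub, Finset.sum_add_distrib, Finset.sum_sub_distrib]
    linarith
  choose q₀ hq₀ using hne
  constructor
  · intro p q hq
    -- Letting the weight of block `p` tend to infinity, with the others equal to one, shows that
    -- its functional is nonnegative.
    refine (nonneg_of_forall_pos (b := ∑ p' ∈ Finset.univ.erase p, G p' (q₀ p')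
      + (B - (∑ k, D.p k * a k 0 + ∑ j, inner ℝ (D.mu j) (b j)))) fun c hc => ?_).1
    have h1 := key (Function.update (fun _ => 1) p c) (Function.update q₀ p q)
      (fun p' => by
        rcases eq_or_ne p' p with rfl | hne
        · simpa using hc
        · simp [Function.update_of_ne hne])
      (fun p' => by
        rcases eq_or_ne p' p with rfl | hne
        · simpa using hq
        · simpa [Function.update_of_ne hne] using hq₀ p')
    rw [← Finset.add_sum_erase _ _ (Finset.mem_univ p), Function.update_self,
      Function.update_self] at h1
    have h2 : ∑ p' ∈ Finset.univ.erase p, Function.update (fun _ => (1 : ℝ)) p c p'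
        * G p' (Function.update q₀ p q p') = ∑ p' ∈ Finset.univ.erase p, G p' (q₀ p') := by
      refine Finset.sum_congr rfl fun p' hp' => ?_
      rw [Function.update_of_ne (Finset.ne_of_mem_erase hp'),
        Function.update_of_ne (Finset.ne_of_mem_erase hp'), one_mul]
    rw [h2] at h1
    linarith
  -- Letting all weights tend to zero leaves only the constant term, which is the bound on the
  -- objective.
  · have h1 := (nonneg_of_forall_pos (a := ∑ p, G p (q₀ p))
      (b := B - (∑ k, D.p k * a k 0 + ∑ j, inner ℝ (D.mu j) (b j))) fun c hc => by
        rw [Finset.mul_sum]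
        exact key (fun _ => c) q₀ (fun _ => hc) hq₀).2
    linarith

lemma vGraph_add {d n : ℕ} {C : ProperCone ℝ (Vec n)} {f : Vec d → ExtVec n} (hf : VReg C f)
    {P : Prop} (hP : ¬ P) {q : Vec d × Vec n} (hq : q ∈ vGraph C f P) {c : Vec n} (hc : c ∈ C) :
    (q.1, q.2 + c) ∈ vGraph C f P := by
  obtain ⟨h1, h2⟩ := hf.le_fin_iff.1 hq.1
  refine ⟨hf.le_fin_iff.2 ⟨h1, ?_⟩, fun h => absurd h hP⟩
  have h4 := C.add_mem h2 hc
  rwa [sub_add_eq_add_sub] at h4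

lemma mem_dualCone_of_orthant {n : ℕ} {C : ProperCone ℝ (Vec n)} (hC : IsOrthant C) {l : Vec n}
    (hl : ∀ r, 0 ≤ l r) : l ∈ dualCone C := by
  refine ProperCone.mem_innerDual.2 fun y hy => ?_
  rw [vec_inner_eq_sum]
  exact Finset.sum_nonneg fun r _ => mul_nonneg ((hC y).1 hy r) (hl r)

/-- In the polyhedral case the multipliers carry signs and the orthant is self-dual. Otherwise the
epigraph recedes along every `y` in the cone, and nonnegativity along this ray gives `yᵀb ≥ 0`. -/
lemma beta_mem_dualCone (hD : D.Standing) {p : Σ k, Fin (D.nI k)} {a : ℝ}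
    {b : (j : Fin D.nJ) → Vec (D.dH j)} {ν : (l : Fin (D.nL p.1)) → Vec (D.dC p.1 l)}
    {e₂ : Fin (D.nL p.1) → Vec D.d} {e₁ : Fin D.nJ → Vec D.d} {q : D.BlockVar p}
    (hq : q ∈ D.blockSet p) (h : ∀ q ∈ D.blockSet p, 0 ≤ D.blockVal p a b ν e₂ e₁ q)
    {j : Fin D.nJ} (hP : PolyH D j → ∀ r, 0 ≤ b j r) : b j ∈ dualCone (D.H j) := by
  classical
  by_cases hj : PolyH D j
  · exact mem_dualCone_of_orthant hj.2 (hP hj)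
  refine ProperCone.mem_innerDual.2 fun y hy => ?_
  refine nonneg_of_forall_nonneg (b := D.blockVal p a b ν e₂ e₁ q) fun c hc => ?_
  let f : (j : Fin D.nJ) → Vec D.d × Vec (D.dH j) :=
    Function.update q.2.1 j ((q.2.1 j).1, (q.2.1 j).2 + c • y)
  have hf1 : ∀ j', (f j').1 = (q.2.1 j').1 := fun j' => by
    rcases eq_or_ne j' j with rfl | hne
    · simp [f]
    · simp [f, Function.update_of_ne hne]
  have hf2 : ∑ j', inner ℝ (b j') (f j').2
      = ∑ j', inner ℝ (b j') (q.2.1 j').2 + c * inner ℝ y (b j) := by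
    rw [← Finset.add_sum_erase _ _ (Finset.mem_univ j),
      ← Finset.add_sum_erase _ (fun j' => inner ℝ (b j') (q.2.1 j').2) (Finset.mem_univ j)]
    have h1 : ∑ j' ∈ Finset.univ.erase j, inner ℝ (b j') (f j').2
        = ∑ j' ∈ Finset.univ.erase j, inner ℝ (b j') (q.2.1 j').2 :=
      Finset.sum_congr rfl fun j' hj' => by
        simp [f, Function.update_of_ne (Finset.ne_of_mem_erase hj')]
    have h2 : inner ℝ (b j) (f j).2 = inner ℝ (b j) (q.2.1 j).2 + c * inner ℝ y (b j) := by
      simp [f, inner_add_right, inner_smul_right, real_inner_comm]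
    rw [h1, h2]
    ring
  have h3 := h (q.1, f, q.2.2) ⟨hq.1, fun j' => by
    rcases eq_or_ne j' j with rfl | hne
    · simp only [f, Function.update_self]
      exact vGraph_add (hD.h_vreg j' p.1) hj (hq.2.1 j') ((D.H j').smul_mem hy hc)
    · simp only [f, Function.update_of_ne hne]
      exact hq.2.1 j', hq.2.2⟩
  simp only [blockVal, hf1, hf2] at h3
  simp only [blockVal]
  linarith

lemma nu_mem_dualCone (hD : D.Standing) {p : Σ k, Fin (D.nI k)} {a : ℝ}
    {b : (j : Fin D.nJ) → Vec (D.dH j)} {ν : (l : Fin (D.nL p.1)) → Vec (D.dC p.1 l)}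
    {e₂ : Fin (D.nL p.1) → Vec D.d} {e₁ : Fin D.nJ → Vec D.d} {q : D.BlockVar p}
    (hq : q ∈ D.blockSet p) (h : ∀ q ∈ D.blockSet p, 0 ≤ D.blockVal p a b ν e₂ e₁ q)
    {l : Fin (D.nL p.1)} (hP : PolyC D p.1 l → ∀ r, 0 ≤ ν l r) :
    ν l ∈ dualCone (D.C p.1 l) := by
  classical
  by_cases hl : PolyC D p.1 l
  · exact mem_dualCone_of_orthant hl.2 (hP hl)
  refine ProperCone.mem_innerDual.2 fun y hy => ?_
  refine nonneg_of_forall_nonneg (b := D.blockVal p a b ν e₂ e₁ q) fun c hc => ?_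
  let f : (l : Fin (D.nL p.1)) → Vec D.d × Vec (D.dC p.1 l) :=
    Function.update q.2.2 l ((q.2.2 l).1, (q.2.2 l).2 + c • y)
  have hf1 : ∀ l', (f l').1 = (q.2.2 l').1 := fun l' => by
    rcases eq_or_ne l' l with rfl | hne
    · simp [f]
    · simp [f, Function.update_of_ne hne]
  have hf2 : ∑ l', inner ℝ (ν l') (f l').2
      = ∑ l', inner ℝ (ν l') (q.2.2 l').2 + c * inner ℝ y (ν l) := by
    rw [← Finset.add_sum_erase _ _ (Finset.mem_univ l),
      ← Finset.add_sum_erase _ (fun l' => inner ℝ (ν l') (q.2.2 l').2) (Finset.mem_univ l)]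
    have h1 : ∑ l' ∈ Finset.univ.erase l, inner ℝ (ν l') (f l').2
        = ∑ l' ∈ Finset.univ.erase l, inner ℝ (ν l') (q.2.2 l').2 :=
      Finset.sum_congr rfl fun l' hl' => by
        simp [f, Function.update_of_ne (Finset.ne_of_mem_erase hl')]
    have h2 : inner ℝ (ν l) (f l).2 = inner ℝ (ν l) (q.2.2 l).2 + c * inner ℝ y (ν l) := by
      simp [f, inner_add_right, inner_smul_right, real_inner_comm]
    rw [h1, h2]
    ring
  have h3 := h (q.1, q.2.1, f) ⟨hq.1, hq.2.1, fun l' => by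
    rcases eq_or_ne l' l with rfl | hne
    · simp only [f, Function.update_self]
      exact vGraph_add (hD.c_vreg p.1 l') hl (hq.2.2 l') ((D.C p.1 l').smul_mem hy hc)
    · simp only [f, Function.update_of_ne hne]
      exact hq.2.2 l'⟩
  simp only [blockVal, hf1, hf2] at h3
  simp only [blockVal]
  linarith

/-- A nonnegative block functional certifies a constraint of the worst-case problem. -/
lemma exists_minors_of_blockVal (hD : D.Standing) {p : Σ k, Fin (D.nI k)} {a : ℝ}
    {b : (j : Fin D.nJ) → Vec (D.dH j)} {ν : (l : Fin (D.nL p.1)) → Vec (D.dC p.1 l)}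
    {e₂ : Fin (D.nL p.1) → Vec D.d} {e₁ : Fin D.nJ → Vec D.d}
    (h : ∀ q ∈ D.blockSet p, 0 ≤ D.blockVal p a b ν e₂ e₁ q) :
    ∃ (r₀ : ℝ) (r₁ : Fin D.nJ → ℝ) (r₂ : Fin (D.nL p.1) → ℝ),
      Minor (fun z => - D.gc p.1 p.2 z) (∑ j, e₁ j + ∑ l, e₂ l) r₀ ∧
      (∀ j, Minor (fun z => ExtVec.scal (b j) (D.hc j p.1 z)) (-e₁ j) (r₁ j)) ∧
      (∀ l, Minor (fun z => ExtVec.scal (ν l) (D.c p.1 l z)) (-e₂ l) (r₂ l)) ∧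
      r₀ + ∑ j, r₁ j + ∑ l, r₂ l ≤ a := by
  -- The suprema of these sets are the conjugates in the constraint: `none` belongs to `-g`, `inl`
  -- to the moments and `inr` to the support constraints. Having one copy of the direction per
  -- function makes the selections independent.
  let T : Option (Fin D.nJ ⊕ Fin (D.nL p.1)) → Set ℝ := fun o => match o with
    | none => {t | ∃ z ∈ domR (fun z => - D.gc p.1 p.2 z),
        t = (D.gc p.1 p.2 z).toReal + inner ℝ z (∑ j, e₁ j + ∑ l, e₂ l)}
    | some (.inl j) => {t | ∃ z ∈ domV (D.hc j p.1),
        t = inner ℝ z (-e₁ j) - inner ℝ (b j) (D.hc j p.1 z).toVec}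
    | some (.inr l) => {t | ∃ z ∈ domV (D.c p.1 l),
        t = inner ℝ z (-e₂ l) - inner ℝ (ν l) (D.c p.1 l z).toVec}
  obtain ⟨z₀, hz₀⟩ := hD.Sbar_nonempty p.1 p.2
  obtain ⟨w, hw1, hw2⟩ := exists_split (T := T) (r := a) (fun o => by
      match o with
      | none => exact ⟨_, z₀, hz₀.2.2, rfl⟩
      | some (.inl j) => exact ⟨_, z₀, hz₀.2.1 j, rfl⟩
      | some (.inr l) => exact ⟨_, z₀, (neg_c_mem hD hz₀.1 l).1, rfl⟩)
    (fun t ht => by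
      obtain ⟨x₀, hx₀, h0⟩ := ht none
      choose x₁ hx₁ h1 using fun j => ht (some (.inl j))
      choose x₂ hx₂ h2 using fun l => ht (some (.inr l))
      have h3 := h ((x₀, (D.gc p.1 p.2 x₀).toReal), fun j => (x₁ j, (D.hc j p.1 (x₁ j)).toVec),
        fun l => (x₂ l, (D.c p.1 l (x₂ l)).toVec))
        ⟨(mem_gHypo_iff (hD.g_reg p.1 p.2)).2 ⟨hx₀, le_rfl⟩,
          fun j => ⟨(hD.h_vreg j p.1).le_fin_iff.2 ⟨hx₁ j, by
            rw [sub_self]; exact (D.H j).zero_mem⟩, fun _ => (hD.h_vreg j p.1).eq_fin (hx₁ j)⟩,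
          fun l => ⟨(hD.c_vreg p.1 l).le_fin_iff.2 ⟨hx₂ l, by
            rw [sub_self]; exact (D.C p.1 l).zero_mem⟩,
            fun _ => (hD.c_vreg p.1 l).eq_fin (hx₂ l)⟩⟩
      rw [Fintype.sum_option, Fintype.sum_sum_type, h0, Finset.sum_congr rfl fun j _ => h1 j,
        Finset.sum_congr rfl fun l _ => h2 l]
      simp only [blockVal, inner_sub_right, Finset.sum_sub_distrib] at h3
      simp only [inner_add_right, inner_sum, inner_neg_right, Finset.sum_sub_distrib,
        Finset.sum_neg_distrib]
      have c0 : ∀ j, inner ℝ x₀ (e₁ j) = inner ℝ (e₁ j) x₀ := fun j => real_inner_comm _ _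
      have c1 : ∀ l, inner ℝ x₀ (e₂ l) = inner ℝ (e₂ l) x₀ := fun l => real_inner_comm _ _
      have c2 : ∀ j, inner ℝ (x₁ j) (e₁ j) = inner ℝ (e₁ j) (x₁ j) := fun j => real_inner_comm _ _
      have c3 : ∀ l, inner ℝ (x₂ l) (e₂ l) = inner ℝ (e₂ l) (x₂ l) := fun l => real_inner_comm _ _
      simp only [c0, c1, c2, c3]
      linarith)
  refine ⟨w none, fun j => w (some (.inl j)), fun l => w (some (.inr l)), ?_, fun j => ?_,
    fun l => ?_, ?_⟩
  · exact (minor_neg_iff (hD.g_reg p.1 p.2)).2 fun z hz => hw1 none _ ⟨z, hz, rfl⟩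
  · refine (hD.h_vreg j p.1).minor_scal_iff.2 fun z hz => ?_
    have := hw1 (some (.inl j)) _ ⟨z, hz, rfl⟩
    linarith
  · refine (hD.c_vreg p.1 l).minor_scal_iff.2 fun z hz => ?_
    have := hw1 (some (.inr l)) _ ⟨z, hz, rfl⟩
    linarith
  · rw [Fintype.sum_option, Fintype.sum_sum_type, ← add_assoc] at hw2
    exact hw2

/-- Strong duality under a Slater condition for the best-case problem. -/
lemma exists_apw_of_adbSlater (hD : D.Standing) {y : D.AdbVar} (hy : D.AdbSlater y)
    (hpos : ∀ k i, 0 < y.lam k i) {B : ℝ} (hB : ∀ x ∈ D.adbFeas, ∑ k, ∑ i, x.tau k i ≤ B) :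
    ∃ x ∈ D.apwFeas, ∑ k, D.p k * x.alpha k + ∑ j, inner ℝ (D.mu j) (x.beta j) ≤ B := by
  obtain ⟨b, ν, e₂, e₁, a, hb, hν, h⟩ := exists_adb_multipliers hD hy hpos hB
  obtain ⟨x₀, hx₀, -⟩ := exists_algRi_coupled hD hy hpos
  have hne : ∀ p, (D.blockSet p).Nonempty := fun p => ⟨_, (hx₀ p).1.2⟩
  obtain ⟨hG, hobj⟩ := blockVal_nonneg hne h
  have hβ : ∀ j, b j ∈ dualCone (D.H j) := fun j => by
    obtain ⟨k⟩ : Nonempty (Fin D.nK) := by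
      by_contra hK
      rw [not_nonempty_iff] at hK
      have := hD.p_sum
      simp at this
    obtain ⟨q, hq⟩ := hne ⟨k, ⟨0, hD.nI_pos k⟩⟩
    exact beta_mem_dualCone hD hq (hG _) (hb j)
  have hνd : ∀ k i l, ν ⟨⟨k, i⟩, l⟩ ∈ dualCone (D.C k l) := fun k i l => by
    obtain ⟨q, hq⟩ := hne ⟨k, i⟩
    exact nu_mem_dualCone hD hq (hG ⟨k, i⟩) (l := l) (hν ⟨⟨k, i⟩, l⟩)
  -- The multipliers of the copy equations become the `y` variables, with the sum placed on `g` so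
  -- that they cancel.
  refine ⟨(fun k => a k 0, b, fun k i => ∑ j, e₁ (⟨k, i⟩, j) + ∑ l, e₂ ⟨⟨k, i⟩, l⟩,
    fun k i j => -e₁ (⟨k, i⟩, j), fun k i l => -e₂ ⟨⟨k, i⟩, l⟩, fun k i l => ν ⟨⟨k, i⟩, l⟩),
    ⟨fun k i => ?_, fun k i => ?_, hβ, hνd⟩, hobj⟩
  · exact (apwLhs_le_iff hD).2 ⟨hβ, hνd k i, exists_minors_of_blockVal hD (hG ⟨k, i⟩)⟩
  · show ∑ j, e₁ (⟨k, i⟩, j) + ∑ l, e₂ ⟨⟨k, i⟩, l⟩ + ∑ j, -e₁ (⟨k, i⟩, j)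
      + ∑ l, -e₂ ⟨⟨k, i⟩, l⟩ = 0
    rw [Finset.sum_neg_distrib, Finset.sum_neg_distrib]
    abel

end Data

end ConicUQ
end

/-! ### Assembly of the two parts -/

theorem mainTheorem7 (D : ConicUQ.Data) (hD : D.Standing) :
    ((∃ x : D.AdbVar, D.AdbSlater x ∧ ∀ k i, 0 < x.lam k i) →
      D.SameValue ∧
      (∃ x : D.ApwVar, ConicUQ.SolvesMin D.apwFeas D.apwObj x) ∧
      ∀ x : D.ApwVar, ConicUQ.SolvesMin D.apwFeas D.apwObj x →
        ConicUQ.SolvesMin D.duqFeas D.duqObj (x.alpha, x.beta)) ∧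
    (((∃ x : D.ApwVar, D.ApwSlater x) ∧ ∀ k, Bornology.IsBounded (D.S k)) →
      D.SameValue ∧
      (∃ x : D.AdbVar, ConicUQ.SolvesMax D.adbFeas D.adbObj x) ∧
      ∀ x : D.AdbVar, ConicUQ.SolvesMax D.adbFeas D.adbObj x →
        ConicUQ.SolvesMax D.puqFeas D.puqObj (D.recovered x)) := by
  open ConicUQ ConicUQ.Data in
  constructor
  · rintro ⟨y, hy, hpos⟩
    have hBF := adbVal_le_frVal_of_pos hD hy.1 hpos
    have hFW : supVal D.adbFeas D.adbObj ≤ infVal D.apwFeas D.apwObj :=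
      hBF.trans ((frVal_le_puqVal hD).trans ((puqVal_le_duqVal hD).trans (duqVal_le_apwVal hD)))
    have hyB : D.adbObj y ≤ supVal D.adbFeas D.adbObj := le_iSup₂_of_le y hy.1 le_rfl
    have key : infVal D.apwFeas D.apwObj ≤ supVal D.adbFeas D.adbObj ∧
        ∃ x : D.ApwVar, SolvesMin D.apwFeas D.apwObj x := by
      induction hB : supVal D.adbFeas D.adbObj with
      | bot =>
        rw [hB] at hyB
        exact absurd hyB (by simp [adbObj])
      | top =>
        -- Weak duality makes (AP-W') infeasible, so by convention any point solves it.
        refine ⟨le_top, 0, fun ⟨x, hx⟩ => ?_⟩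
        have h1 : infVal D.apwFeas D.apwObj ≤ D.apwObj x := iInf₂_le_of_le x hx le_rfl
        have h2 := hFW.trans h1
        rw [hB] at h2
        exact absurd (top_le_iff.1 h2) (EReal.coe_ne_top _)
      | coe B =>
        obtain ⟨x, hx, hxB⟩ := exists_apw_of_adbSlater hD hy hpos (B := B) fun x hx => by
          rw [← EReal.coe_le_coe_iff, ← hB]
          exact le_iSup₂_of_le x hx le_rfl
        have h1 : infVal D.apwFeas D.apwObj ≤ D.apwObj x := iInf₂_le_of_le x hx le_rfl
        have h2 : D.apwObj x ≤ (B : EReal) := EReal.coe_le_coe_iff.2 hxB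
        refine ⟨h1.trans h2, x, fun _ => ⟨hx, le_antisymm ?_ h1⟩⟩
        rw [hB] at hFW
        exact h2.trans hFW
    have hsame := sameValue_of hD key.1 hBF
    refine ⟨hsame, key.2, fun x hx hne => ?_⟩
    -- If (D-UQ) is feasible, the common value is below `+∞`, so (AP-W') is feasible and its
    -- solution is a genuine minimizer.
    have hapw : D.apwFeas.Nonempty := by
      by_contra hemp
      rw [not_nonempty_iff_eq_empty] at hemp
      obtain ⟨q, hq⟩ := hne
      have h1 : infVal D.duqFeas D.duqObj ≤ D.duqObj q := iInf₂_le_of_le q hq le_rfl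
      rw [← hsame.1, hemp] at h1
      simp only [infVal, mem_empty_iff_false, iInf_false, iInf_top] at h1
      exact absurd (top_le_iff.1 h1) (EReal.coe_ne_top _)
    obtain ⟨h1, h2⟩ := hx hapw
    refine ⟨mem_duqFeas_of_apwFeas hD h1, ?_⟩
    rw [← hsame.1, ← h2]
    rfl
  · rintro ⟨⟨y, hy⟩, hb⟩
    have hBF : supVal D.adbFeas D.adbObj ≤ supVal D.frFeas D.frObj := iSup₂_le fun x hx =>
      adbObj_le_frVal hD hx fun k i => adb_v_eq_zero_of_lam hD hb hx k i
    have hFW : supVal D.adbFeas D.adbObj ≤ infVal D.apwFeas D.apwObj :=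
      hBF.trans ((frVal_le_puqVal hD).trans ((puqVal_le_duqVal hD).trans (duqVal_le_apwVal hD)))
    have hyW : infVal D.apwFeas D.apwObj ≤ D.apwObj y := iInf₂_le_of_le y hy.1 le_rfl
    have key : infVal D.apwFeas D.apwObj ≤ supVal D.adbFeas D.adbObj ∧
        ∃ x : D.AdbVar, SolvesMax D.adbFeas D.adbObj x := by
      induction hW : infVal D.apwFeas D.apwObj with
      | top =>
        rw [hW] at hyW
        exact absurd (top_le_iff.1 hyW) (EReal.coe_ne_top _)
      | bot =>
        -- Now (AD-B') is infeasible and any point solves it.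
        refine ⟨bot_le, 0, fun ⟨x, hx⟩ => ?_⟩
        have h1 : D.adbObj x ≤ supVal D.adbFeas D.adbObj := le_iSup₂_of_le x hx le_rfl
        have h2 := h1.trans hFW
        rw [hW] at h2
        exact absurd h2 (by simp [adbObj])
      | coe B =>
        obtain ⟨x, hx, hxB⟩ := exists_adb_of_apwSlater hD hy hb (B := B) fun x hx => by
          rw [← EReal.coe_le_coe_iff, ← hW]
          exact iInf₂_le_of_le x hx le_rfl
        have h1 : D.adbObj x ≤ supVal D.adbFeas D.adbObj := le_iSup₂_of_le x hx le_rfl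
        have h2 : (B : EReal) ≤ D.adbObj x := EReal.coe_le_coe_iff.2 hxB
        refine ⟨h2.trans h1, x, fun _ => ⟨hx, le_antisymm h1 ?_⟩⟩
        rw [hW] at hFW
        exact hFW.trans h2
    have hsame := sameValue_of hD key.1 hBF
    refine ⟨hsame, key.2, fun x hx hne => ?_⟩
    have hPB : supVal D.puqFeas D.puqObj = supVal D.adbFeas D.adbObj :=
      hsame.2.2.1.trans hsame.2.2.2
    -- Feasible points of (P-UQ) have value above `-∞`, so equal values make (AD-B') feasible.
    have hadb : D.adbFeas.Nonempty := by
      by_contra hemp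
      rw [not_nonempty_iff_eq_empty] at hemp
      obtain ⟨P, hP⟩ := hne
      have h1 : D.puqObj P ≤ supVal D.puqFeas D.puqObj := le_iSup₂_of_le P hP le_rfl
      rw [hPB, hemp] at h1
      exact hP.2 (by simpa [supVal] using h1)
    obtain ⟨h1, h2⟩ := hx hadb
    obtain ⟨h3, h4⟩ := recovered_mem_puqFeas hD h1 fun k i => adb_v_eq_zero_of_lam hD hb h1 k i
    refine ⟨h3, le_antisymm (le_iSup₂_of_le _ h3 le_rfl) ?_⟩
    rw [hPB, ← h2]
    exact h4
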